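/- Work over $\mathbb F=\mathbb F_2$ and let $n\ge 0$. **Algebras.** For a $k$-element subset (idempotent state) $x\subset\{0,\dots,m\}$ and $1\le i\le m$ let $v_i(x)=\#\{j\in x: j\ge i\}$. The algebra $B_0(m,k)$ has a basis of pure elements $(x,y,\omega)$, where $x,y$ are idempotent states and $\omega_i\in\frac12|v_i(x)-v_i(y)|+\mathbb Z_{\ge0}$ are its weights; $(x,y,\omega)\cdot(y',z,\omega')$ is $(x,z,\omega+\omega')$ if $y=y'$ and $0$ otherwise. Let $I_x=(x,x,0)$, $U_i=\sum_x (x,x,e_i)$, let $R_i$ be the sum of the $(x,y,\frac12e_i)$ with $i-1\in x$, $i\notin x$, $y=(x\setminus\{i-1\})\cup\{i\}$, and $L_i$ the sum of the $(y,x,\frac12 e_i)$ for the same pairs. $B(m,k)$ is the quotient of $B_0(m,k)$ by the two-sided ideal generated by all $R_iR_{i+1}$, $L_{i+1}L_i$, and $I_xU_i$ with $x\cap\{i-1,i\}=\emptyset$. Put $B(n)=B(2n,n)$. For a matching $M$ (partition into pairs) of $\{1,\dots,2n\}$ let $\mu_0^M=\sum_{\{i,j\}\in M}U_iU_j\in B(n)$.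 Let $\Delta$ be minus the total weight, with $\Delta(w)=\Delta(z)=-1$. **Generators.** An idempotent state $x$ of $B(n+1)$ is preferred if $1\le|x\cap\{0,1,2\}|\le2$ and $x\cap\{0,1,2\}\ne\{0,1\}$; then $\psi(x)$ is the idempotent state of $B(n)$ with $0\in\psi(x)\iff|x\cap\{0,1,2\}|=2$ and, for $i>0$, $i\in\psi(x)\iff i+2\in x$. The bimodule is $X_0\oplus X_1\oplus X_2\oplus Y_0\oplus Y_1\oplus Y_2$, where $X_i$ and $Y_i$ each have one generator for each preferred $x$ with $\min x=i$, with right idempotent $I_x$ and left idempotent $I_{\psi(x)}$. **Operations.** For a pure element $b$ from $x$ to $y$ ($x,y$ preferred) let $\Psi(b)$ be the class in $B(n)$ of the pure element from $\psi(x)$ to $\psi(y)$ with weights $\omega_i(\Psi(b))=\omega_{i+2}(b)$. An arrow $P\to Q$ labelled $c\otimes(a_1,\dots,a_j)$, where each $a_i$ is one of $1$, $U_1^{k+1}$, $U_2^{l+1}$, $L_1U_1^k$, $R_1U_1^k$, $L_2U_2^l$, $R_2U_2^l$, contributes the term $c\,\Psi(b_1)\cdots\Psi(b_j)\otimes q$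 to $\delta^1_{1+j}(p,b_1,\dots,b_j)$ whenever $p\in P$ and $q\in Q$ are generators, $b_1,\dots,b_j$ are pure elements, nonzero in $B(n+1)$, that are successively composable from the right idempotent state of $p$ to that of $q$, and each $b_i$ has the same weights at $1$ and $2$ (and the same direction of motion across these strands) as $a_i$. (For $j=0$ the term is $c\otimes q$, for $p,q$ with the same right idempotent.) The operations are the $\mathbb F$-multilinear extensions. The arrows of MarkedMin are, for all $k,l\ge0$: $X_1\to X_2$: $z^l\otimes R_2U_2^l$; $X_2\to X_1$: $z^{l+1}\otimes L_2U_2^l$; $X_1\to X_0$: $w^k\otimes L_1U_1^k$; $X_0\to X_1$: $w^{k+1}\otimes R_1U_1^k$; $X_1\to Y_1$: $w^kz^l\otimes(U_1^{k+1},U_2^{l+1})$ and $w^kz^l\otimes(U_2^{l+1},U_1^{k+1})$; $X_0\to Y_2$: $w^kz^l\otimes(R_1U_1^k,R_2U_2^l)$; $Y_2\to Y_1$: $z^l\otimes L_2U_2^l$; $Y_1\to Y_2$: $z^{l+1}\otimes R_2U_2^l$; $X_2\to Y_0$: $w^kz^l\otimes(L_2U_2^l,L_1U_1^k)$; $Y_0\to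 Y_1$: $w^k\otimes R_1U_1^k$; $Y_1\to Y_0$: $w^{k+1}\otimes L_1U_1^k$; $X_1\to Y_0$: $w^kz^l\otimes(U_2^{l+1},L_1U_1^k)$; $X_1\to Y_2$: $w^kz^l\otimes(U_1^{k+1},R_2U_2^l)$; $X_2\to Y_1$: $w^kz^l\otimes(L_2U_2^l,U_1^{k+1})$; $X_0\to Y_1$: $w^kz^l\otimes(R_1U_1^k,U_2^{l+1})$; without algebra input, $Y_1\to X_1$: $wz$; $Y_2\to X_2$: $w$; $Y_0\to X_0$: $z$; and loops $1\otimes1$ at every type, $w^{k+1}\otimes U_1^{k+1}$ at $X_0,X_1,Y_0,Y_1$, and $z^{l+1}\otimes U_2^{l+1}$ at $X_1,X_2,Y_1,Y_2$. The arrows of MarkedMinHat are $1\otimes1$ at every type and $X_1\to Y_1$: $(U_1,U_2)$ and $(U_2,U_1)$; $X_1\to X_2$: $R_2$; $X_1\to X_0$: $L_1$; $X_0\to Y_2$: $(R_1,R_2)$; $Y_2\to Y_1$: $L_2$; $X_2\to Y_0$: $(L_2,L_1)$; $Y_0\to Y_1$: $R_1$; $X_1\to Y_0$: $(U_2,L_1)$;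 $X_1\to Y_2$: $(U_1,R_2)$; $X_2\to Y_1$: $(L_2,U_1)$; $X_0\to Y_1$: $(R_1,U_2)$. **Notions.** A type $DA$ bimodule has operations $\delta^1_{1+k}:N\otimes A^{\otimes k}\to B\otimes N$ (tensor products over the idempotent rings, maps of bimodules over these rings) that satisfy the usual structure relations. It is curved, for central curvatures $\mu_0^A$ and $\mu_0^B$, if the structure sum plus the sum of all insertions of one $\mu_0^A$ among $a_1,\dots,a_k$ equals $\mu_0^B\otimes x$ for $k=0$ and $0$ for $k>0$. It is $a$-$b$-equivariant if $\delta^1_2(x,a)=b\otimes x$ for all $x$, and $\delta^1_{1+k}(x,a_1,\dots,a_k)=0$ whenever $k>1$ and some $a_i=a$; it is annihilated by $a$ if it is $a$-$0$-equivariant, and unital if it is $1$-$1$-equivariant. It is bounded if for every $M$ there is an $N$ such that, for homogeneous $a_1,\dots,a_k$, $\sum\Delta(a_i)\ge N$ whenever $\delta^1_{1+k}(x,a_1,\dots,a_k)$ has a nonzero term whose algebra element has $\Delta\ge M$. **Proposition.** 1. MarkedMin is a type $DA$ bimodule over $B(n)[w,z]$ and $B(n+1)$, unital and bounded. It is annihilated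 by $U_1U_2$, and it is $U_{r+2}U_{s+2}$-$U_rU_s$-equivariant for all $r,s\in\{1,\dots,2n\}$. 2. MarkedMinHat is a type $DA$ bimodule over $B(n)$ and $B(n+1)$ with the same properties. 3. Let $M_2$ be a matching on $\{1,\dots,2n\}$, and let $M_1$ be the matching on $\{1,\dots,2n+2\}$ with $\{1,2\}\in M_1$ and $\{i,j\}\in M_2\iff\{i+2,j+2\}\in M_1$. With the curvatures $\mu_0^{M_1}$ on $B(n+1)$ and $\mu_0^{M_2}$ on $B(n)$ and $B(n)[w,z]$, MarkedMin and MarkedMinHat are curved type $DA$ bimodules. 4. The specialization of MarkedMin at $w=z=0$ is MarkedMinHat. -/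

import Mathlib

open Polynomial

noncomputable section

namespace BorderedLink

/-! # The bordered algebra `B(m,k)` over the field with two elements -/

/-- An idempotent state for `B(m,k)`: a `k`-element subset of `{0, …, m}`. -/
abbrev State (m k : ℕ) : Type := {x : Finset (Fin (m + 1)) // x.card = k}

/-- The number of elements of `x` to the right of the strand `i`. The strands `1, …, m` are indexed
by `Fin m` from `0`: the index `i` is the strand `i + 1`, which lies between `i` and `i + 1`. -/
def level {m : ℕ} (x : Finset (Fin (m + 1))) (i : Fin m) : ℕ :=
  (x.filter fun j => i.castSucc < j).card

/-- All weights are doubled, so that they are natural numbers. The vector `d` is a possible doubled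
weight vector from `x` to `y`: it exceeds the minimal one, `|level x i - level y i|`, by even
numbers. -/
def Admissible {m : ℕ} (x y : Finset (Fin (m + 1))) (d : Fin m → ℕ) : Prop :=
  ∀ i, level x i ≤ level y i + d i ∧ level y i ≤ level x i + d i ∧
    Even (level x i + level y i + d i)

/-- The pure (monomial) basis elements of the algebra `B₀(m,k)`: such an element is determined by
its initial and terminal idempotent states and its weights (`dwt i` is twice the weight at the
strand `i`). -/
@[ext] structure Pure (m k : ℕ) where
  src : State m k
  tgt : State m k
  dwt : Fin m → ℕ
  adm : Admissible src.1 tgt.1 dwt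

namespace Pure

variable {m k : ℕ}

/-- The product of composable pure elements in `B₀(m,k)`: the weights add. (The product of pure
elements that are not composable is zero.) -/
def mul (p q : Pure m k) (h : p.tgt = q.src) : Pure m k where
  src := p.src
  tgt := q.tgt
  dwt := p.dwt + q.dwt
  adm := by
    intro i
    have h1 := p.adm i
    have h2 := q.adm i
    rw [h] at h1
    obtain ⟨a1, a2, a, ha⟩ := h1
    obtain ⟨b1, b2, b, hb⟩ := h2
    refine ⟨?_, ?_, ?_⟩
    · simp only [Pi.add_apply]; omega
    · simp only [Pi.add_apply]; omega
    · exact ⟨a + b - level q.src.1 i, by simp only [Pi.add_apply]; omega⟩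

/-- The idempotent `I_x`. -/
def idem (x : State m k) : Pure m k where
  src := x
  tgt := x
  dwt := 0
  adm := fun i => ⟨by simp, by simp, ⟨level x.1 i, by simp⟩⟩

/-- `p` is a component `I_x · R_i` of `R_i` (which moves the element `i - 1` of `x` to `i`). -/
def IsR (i : Fin m) (p : Pure m k) : Prop :=
  i.castSucc ∈ p.src.1 ∧ i.succ ∉ p.src.1 ∧
    p.tgt.1 = insert i.succ (p.src.1.erase i.castSucc) ∧ p.dwt = Pi.single i 1

/-- `p` is a component `I_x · L_i` of `L_i` (which moves the element `i` of `x` to `i - 1`). -/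
def IsL (i : Fin m) (p : Pure m k) : Prop :=
  i.succ ∈ p.src.1 ∧ i.castSucc ∉ p.src.1 ∧
    p.tgt.1 = insert i.castSucc (p.src.1.erase i.succ) ∧ p.dwt = Pi.single i 1

/-- `p` is a component `I_x · U_i` of `U_i`. -/
def IsU (i : Fin m) (p : Pure m k) : Prop :=
  p.tgt = p.src ∧ p.dwt = Pi.single i 2

/-- The pure elements in the two-sided ideal of `B₀(m,k)` that is generated by the products
`R_i R_{i+1}` and `L_{i+1} L_i`, and by `I_x U_i` for `x ∩ {i - 1, i} = ∅`. (This ideal is spanned by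
the pure elements that it contains.) -/
inductive InJ : Pure m k → Prop
  | RR (i j : Fin m) (hij : i.val + 1 = j.val) (p q : Pure m k) (hp : IsR i p) (hq : IsR j q)
      (h : p.tgt = q.src) : InJ (p.mul q h)
  | LL (i j : Fin m) (hij : i.val + 1 = j.val) (p q : Pure m k) (hp : IsL j p) (hq : IsL i q)
      (h : p.tgt = q.src) : InJ (p.mul q h)
  | U (i : Fin m) (p : Pure m k) (hp : IsU i p) (h1 : i.castSucc ∉ p.src.1)
      (h2 : i.succ ∉ p.src.1) : InJ p
  | mul_left (p q : Pure m k) (h : p.tgt = q.src) (hq : InJ q) : InJ (p.mul q h)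
  | mul_right (p q : Pure m k) (h : p.tgt = q.src) (hp : InJ p) : InJ (p.mul q h)

end Pure

/-- The algebra `B(m,k)`, the quotient of `B₀(m,k)` by the ideal above. It has a basis consisting of
the pure elements outside the ideal. -/
def Blg (m k : ℕ) : Type := {p : Pure m k // ¬ p.InJ} →₀ ZMod 2

namespace Blg

variable {m k : ℕ}

/-- The coefficients of an element of `B(m,k)` in the basis of pure elements. -/
def coeffs (a : Blg m k) : {p : Pure m k // ¬ p.InJ} →₀ ZMod 2 := a

instance : AddCommGroup (Blg m k) :=
  inferInstanceAs (AddCommGroup ({p : Pure m k // ¬ p.InJ} →₀ ZMod 2))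

instance : Module (ZMod 2) (Blg m k) :=
  inferInstanceAs (Module (ZMod 2) ({p : Pure m k // ¬ p.InJ} →₀ ZMod 2))

open Classical in
/-- The class in `B(m,k)` of a pure element of `B₀(m,k)`. -/
def ofPure (p : Pure m k) : Blg m k :=
  if h : p.InJ then 0 else Finsupp.single ⟨p, h⟩ 1

open Classical in
/-- The product in `B(m,k)` of the classes of two pure elements. -/
def pureMul (p q : Pure m k) : Blg m k :=
  if h : p.tgt = q.src then ofPure (p.mul q h) else 0

/-- The multiplication of `B(m,k)`, the bilinear extension of the product of pure elements. -/
def mulMap : Blg m k →ₗ[ZMod 2] Blg m k →ₗ[ZMod 2] Blg m k :=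
  Finsupp.linearCombination (ZMod 2) fun p : {p : Pure m k // ¬ p.InJ} =>
    (Finsupp.linearCombination (ZMod 2) fun q : {p : Pure m k // ¬ p.InJ} =>
      pureMul p.1 q.1 : Blg m k →ₗ[ZMod 2] Blg m k)

instance : Mul (Blg m k) := ⟨fun a b => mulMap a b⟩

/-- The unit is the sum of all idempotents. -/
instance : One (Blg m k) := ⟨∑ x : State m k, ofPure (Pure.idem x)⟩

theorem mul_eq (a b : Blg m k) : a * b = mulMap a b := rfl

theorem one_eq : (1 : Blg m k) = ∑ x : State m k, ofPure (Pure.idem x) := rfl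

theorem ofPure_of_not (p : Pure m k) (h : ¬ p.InJ) :
    ofPure p = (Finsupp.single ⟨p, h⟩ 1 : {p : Pure m k // ¬ p.InJ} →₀ ZMod 2) := dif_neg h

theorem ofPure_of_inJ (p : Pure m k) (h : p.InJ) : ofPure p = 0 := dif_pos h

theorem induction (P : Blg m k → Prop) (h0 : P 0) (hadd : ∀ a b, P a → P b → P (a + b))
    (hp : ∀ p, ¬ p.InJ → P (ofPure p)) (a : Blg m k) : P a := by
  refine Finsupp.induction_linear (motive := P) a h0 hadd ?_
  rintro ⟨p, h⟩ c
  have hc : c = 0 ∨ c = 1 := by revert c; decide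
  rcases hc with rfl | rfl
  · have : (Finsupp.single ⟨p, h⟩ 0 : {p : Pure m k // ¬ p.InJ} →₀ ZMod 2) = 0 :=
      Finsupp.single_zero _
    rw [this]; exact h0
  · rw [← ofPure_of_not]; exact hp p h

theorem ofPure_mul (p q : Pure m k) : ofPure p * ofPure q = pureMul p q := by
  by_cases hp : p.InJ
  · rw [ofPure_of_inJ p hp, mul_eq, map_zero, LinearMap.zero_apply, pureMul]
    split_ifs with h
    · exact (ofPure_of_inJ _ (.mul_right p q h hp)).symm
    · rfl
  by_cases hq : q.InJ
  · rw [ofPure_of_inJ q hq, mul_eq, map_zero, pureMul]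
    split_ifs with h
    · exact (ofPure_of_inJ _ (.mul_left p q h hq)).symm
    · rfl
  have e1 : mulMap (ofPure p) = (Finsupp.linearCombination (ZMod 2)
      fun q : {p : Pure m k // ¬ p.InJ} => pureMul p q.1 : Blg m k →ₗ[ZMod 2] Blg m k) := by
    rw [ofPure_of_not p hp]
    exact (Finsupp.linearCombination_single (ZMod 2) _ _).trans (one_smul _ _)
  rw [mul_eq, e1, ofPure_of_not q hq]
  exact (Finsupp.linearCombination_single (ZMod 2) _ _).trans (one_smul _ _)

theorem ofPure_mul_of_eq (p q : Pure m k) (h : p.tgt = q.src) :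
    ofPure p * ofPure q = ofPure (p.mul q h) := by rw [ofPure_mul, pureMul, dif_pos h]

theorem ofPure_mul_of_ne (p q : Pure m k) (h : p.tgt ≠ q.src) :
    ofPure p * ofPure q = 0 := by rw [ofPure_mul, pureMul, dif_neg h]

theorem left_distrib' (a b c : Blg m k) : a * (b + c) = a * b + a * c :=
  map_add (mulMap a) b c

theorem right_distrib' (a b c : Blg m k) : (a + b) * c = a * c + b * c := by
  simp only [mul_eq, map_add, LinearMap.add_apply]

theorem zero_mul' (a : Blg m k) : 0 * a = 0 := by
  simp only [mul_eq, map_zero, LinearMap.zero_apply]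

theorem mul_zero' (a : Blg m k) : a * 0 = 0 := map_zero (mulMap a)

theorem mul_assoc' (a b c : Blg m k) : a * b * c = a * (b * c) := by
  refine induction (fun a => a * b * c = a * (b * c)) ?_ ?_ ?_ a
  · simp only [zero_mul']
  · intro x y hx hy; simp only [right_distrib', hx, hy]
  intro p _
  refine induction (fun b => ofPure p * b * c = ofPure p * (b * c)) ?_ ?_ ?_ b
  · simp only [zero_mul', mul_zero']
  · intro x y hx hy; simp only [right_distrib', left_distrib', hx, hy]
  intro q _
  refine induction (fun c => ofPure p * ofPure q * c = ofPure p * (ofPure q * c)) ?_ ?_ ?_ c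
  · simp only [mul_zero']
  · intro x y hx hy; simp only [left_distrib', hx, hy]
  intro r _
  by_cases h1 : p.tgt = q.src <;> by_cases h2 : q.tgt = r.src
  · rw [ofPure_mul_of_eq p q h1, ofPure_mul_of_eq q r h2,
      ofPure_mul_of_eq (p.mul q h1) r h2, ofPure_mul_of_eq p (q.mul r h2) h1]
    congr 1
    ext1 <;> simp [Pure.mul, add_assoc]
  · rw [ofPure_mul_of_eq p q h1, ofPure_mul_of_ne q r h2, mul_zero',
      ofPure_mul_of_ne (p.mul q h1) r h2]
  · rw [ofPure_mul_of_ne p q h1, ofPure_mul_of_eq q r h2, zero_mul',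
      ofPure_mul_of_ne p (q.mul r h2) h1]
  · rw [ofPure_mul_of_ne p q h1, ofPure_mul_of_ne q r h2, mul_zero', zero_mul']

theorem one_mul' (a : Blg m k) : 1 * a = a := by
  refine induction (fun a => 1 * a = a) ?_ ?_ ?_ a
  · exact mul_zero' _
  · intro x y hx hy; simp only [left_distrib', hx, hy]
  intro p _
  rw [one_eq, mul_eq, map_sum, LinearMap.sum_apply, Finset.sum_eq_single p.src]
  · rw [← mul_eq, ofPure_mul_of_eq _ _ rfl]
    congr 1
    ext1 <;> simp [Pure.mul, Pure.idem]
  · intro x _ hx; rw [← mul_eq, ofPure_mul_of_ne _ _ hx]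
  · simp

theorem mul_one' (a : Blg m k) : a * 1 = a := by
  refine induction (fun a => a * 1 = a) ?_ ?_ ?_ a
  · exact zero_mul' _
  · intro x y hx hy; simp only [right_distrib', hx, hy]
  intro p _
  rw [one_eq, mul_eq, map_sum, Finset.sum_eq_single p.tgt]
  · rw [← mul_eq, ofPure_mul_of_eq _ _ rfl]
    congr 1
  · intro x _ hx; rw [← mul_eq, ofPure_mul_of_ne _ _ hx.symm]
  · simp

instance : Ring (Blg m k) where
  __ := (inferInstance : AddCommGroup (Blg m k))
  mul := (· * ·)
  one := 1
  left_distrib := left_distrib'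
  right_distrib := right_distrib'
  zero_mul := zero_mul'
  mul_zero := mul_zero'
  mul_assoc := mul_assoc'
  one_mul := one_mul'
  mul_one := mul_one'

instance : Algebra (ZMod 2) (Blg m k) :=
  Algebra.ofModule
    (fun c x y => by simp only [mul_eq, map_smul, LinearMap.smul_apply])
    (fun c x y => map_smul (mulMap x) c y)

open Classical in
/-- The class in `B(m,k)` of the pure element with the given idempotent states and doubled weights
(and `0` if there is none). -/
def elt (m k : ℕ) (x y : Finset (Fin (m + 1))) (d : Fin m → ℕ) : Blg m k :=
  if h : x.card = k ∧ y.card = k ∧ Admissible x y d then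
    ofPure ⟨⟨x, h.1⟩, ⟨y, h.2.1⟩, d, h.2.2⟩
  else 0

/-- The idempotent `I_x`. -/
def idem (x : State m k) : Blg m k := ofPure (Pure.idem x)

/-- The element `U_i`, the sum of its components `I_x · U_i`. -/
def U (m k : ℕ) (i : Fin m) : Blg m k :=
  ∑ x : State m k, elt m k x.1 x.1 (Pi.single i 2)

end Blg

/-- The algebra `B(n) = B(2n,n)`. -/
abbrev BAlg (n : ℕ) : Type := Blg (2 * n) n

/-- The algebra `B(n)[w,z]`, as `B(n)[z][w]`: the outer variable is `w`, the inner one is `z`. The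
variables commute with all coefficients. -/
abbrev BAlgWZ (n : ℕ) : Type := (BAlg n)[X][X]

/-- A matching on a set of strands: a partition into two-element subsets. -/
def IsMatching {m : ℕ} (M : Finset (Finset (Fin m))) : Prop :=
  (∀ s ∈ M, s.card = 2) ∧ ∀ i, ∃! s, s ∈ M ∧ i ∈ s

/-- The curvature of a matching: the sum of `U_i U_j` over all `{i, j} ∈ M`. -/
def curvature {m : ℕ} (k : ℕ) (M : Finset (Finset (Fin m))) : Blg m k :=
  ∑ i, ∑ j, if i < j ∧ {i, j} ∈ M then Blg.U m k i * Blg.U m k j else 0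

/-! # Type `DA` bimodules

Let `A` and `B` be algebras over `𝔽₂` (without differential) with finite families `eA`, `eB` of
orthogonal idempotents with sum `1`, which span the idempotent rings. A bimodule `N` over the
idempotent rings is given by a finite set `G` of generators, where `x : G` has the left idempotent
`eB (lft x)` and the right idempotent `eA (rgt x)`. Operations
`δ¹_{1+k} : N ⊗ A ⊗ ⋯ ⊗ A → B ⊗ N`, with tensor products over the idempotent rings, are given by
their coefficients: `δ¹_{1+k}(x, a₁, …, a_k) = ∑ y, δ x [a₁, …, a_k] y ⊗ y`. -/

section DA

variable {S T G A B : Type} [Ring A] [Ring B] [Algebra (ZMod 2) A] [Algebra (ZMod 2) B]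

open Classical in
/-- `δ` is a family of multilinear maps that are balanced over the idempotent rings and maps of
bimodules over the idempotent rings. -/
structure IsDAOperation (eA : S → A) (eB : T → B) (rgt : G → S) (lft : G → T)
    (δ : G → List A → G → B) : Prop where
  map_add : ∀ x u a b v y, δ x (u ++ (a + b) :: v) y = δ x (u ++ a :: v) y + δ x (u ++ b :: v) y
  map_smul : ∀ x u (c : ZMod 2) a v y, δ x (u ++ (c • a) :: v) y = c • δ x (u ++ a :: v) y
  balanced_first : ∀ x s a v y,
    δ x ((eA s * a) :: v) y = if rgt x = s then δ x (a :: v) y else 0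
  balanced : ∀ x u a s b v y, δ x (u ++ (a * eA s) :: b :: v) y = δ x (u ++ a :: (eA s * b) :: v) y
  right_linear : ∀ x u a s y,
    δ x (u ++ [a * eA s]) y = if rgt y = s then δ x (u ++ [a]) y else 0
  right_linear_nil : ∀ x y, rgt x ≠ rgt y → δ x [] y = 0
  left_linear : ∀ x l y, eB (lft x) * δ x l y = δ x l y
  mem_tensor : ∀ x l y, δ x l y * eB (lft y) = δ x l y

/-- The coefficient of `y` in the left-hand side of the structure relation of a type `DA` bimodule,
on the inputs `x` and `l = [a₁, …, a_k]`. -/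
def structureSum [Fintype G] (δ : G → List A → G → B) (x : G) (l : List A) (y : G) : B :=
  (∑ i ∈ Finset.range (l.length + 1), ∑ g : G, δ x (l.take i) g * δ g (l.drop i) y) +
  ∑ i ∈ Finset.range (l.length - 1),
    δ x (l.take i ++ (l.getD i 0 * l.getD (i + 1) 0) :: l.drop (i + 2)) y

/-- Type `DA` bimodules. -/
structure IsTypeDA [Fintype G] (eA : S → A) (eB : T → B) (rgt : G → S) (lft : G → T)
    (δ : G → List A → G → B) : Prop extends IsDAOperation eA eB rgt lft δ where
  relation : ∀ x l y, structureSum δ x l y = 0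

open Classical in
/-- Curved type `DA` bimodules, where `A` and `B` are curved algebras with the curvatures `κA` and
`κB`. -/
structure IsCurvedTypeDA [Fintype G] (eA : S → A) (eB : T → B) (rgt : G → S) (lft : G → T)
    (κA : A) (κB : B) (δ : G → List A → G → B) : Prop
    extends IsDAOperation eA eB rgt lft δ where
  center_left : κB ∈ Set.center B
  center_right : κA ∈ Set.center A
  relation : ∀ x l y, structureSum δ x l y +
      ∑ i ∈ Finset.range (l.length + 1), δ x (l.take i ++ κA :: l.drop i) y =
    if l = [] ∧ x = y then κB * eB (lft x) else 0

open Classical in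
/-- The `a`-`b`-equivariant bimodules: `δ¹₂(x, a) = b ⊗ x`, and `δ¹_{1+k}` vanishes for `k > 1` as
soon as one of its algebra inputs is `a`. -/
def IsEquivariant (eB : T → B) (lft : G → T) (a : A) (b : B) (δ : G → List A → G → B) : Prop :=
  (∀ x y, δ x [a] y = if x = y then b * eB (lft x) else 0) ∧
  ∀ x l y, 1 < l.length → a ∈ l → δ x l y = 0

/-- Unital bimodules. -/
def IsUnital (eB : T → B) (lft : G → T) (δ : G → List A → G → B) : Prop :=
  IsEquivariant eB lft 1 1 δ

/-- Bimodules that are annihilated by `a`. -/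
def IsAnnihilatedBy (eB : T → B) (lft : G → T) (a : A) (δ : G → List A → G → B) : Prop :=
  IsEquivariant eB lft a 0 δ

end DA

/-! # The bimodules of a marked minimum -/

section MarkedMin

variable {n : ℕ}

/-- Strand `1`. -/
def strand1 (n : ℕ) : Fin (2 * (n + 1)) := ⟨0, by omega⟩

/-- Strand `2`. -/
def strand2 (n : ℕ) : Fin (2 * (n + 1)) := ⟨1, by omega⟩

/-- The strand `i + 2`. -/
def shift (i : Fin (2 * n)) : Fin (2 * (n + 1)) := ⟨i.val + 2, by omega⟩

/-- The intersection `x ∩ {0, 1, 2}`. -/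
def loc (x : Finset (Fin (2 * (n + 1) + 1))) : Finset (Fin (2 * (n + 1) + 1)) :=
  x.filter fun j => j.val ≤ 2

/-- Preferred idempotent states. -/
def Preferred (x : Finset (Fin (2 * (n + 1) + 1))) : Prop :=
  1 ≤ (loc x).card ∧ (loc x).card ≤ 2 ∧ loc x ≠ {0, 1}

/-- The set `ψ(x)`: it contains `0` if and only if `|x ∩ {0, 1, 2}| = 2`, and it contains `i > 0` if
and only if `i + 2 ∈ x`. -/
def psi (x : Finset (Fin (2 * (n + 1) + 1))) : Finset (Fin (2 * n + 1)) :=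
  Finset.univ.filter fun i =>
    (i.val = 0 ∧ (loc x).card = 2) ∨
      (0 < i.val ∧ (⟨i.val + 2, by omega⟩ : Fin (2 * (n + 1) + 1)) ∈ x)

theorem card_psi (x : Finset (Fin (2 * (n + 1) + 1))) (hx : x.card = n + 1) (h : Preferred x) :
    (psi x).card = n := by
  have h1 : (loc x).card + (x.filter fun j => ¬ j.val ≤ 2).card = n + 1 := by
    exact (Finset.card_filter_add_card_filter_not _).trans hx
  have h2 : ((psi x).filter fun i => ¬ i.val = 0).card = (x.filter fun j => ¬ j.val ≤ 2).card := by
    refine Finset.card_nbij' (fun i => (⟨i.val + 2, by omega⟩ : Fin (2 * (n + 1) + 1)))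
      (fun j => (⟨j.val - 2, by omega⟩ : Fin (2 * n + 1))) ?_ ?_ ?_ ?_
    · intro i hi
      simp only [psi, Finset.coe_filter, Finset.mem_filter, Finset.mem_univ, true_and,
        Set.mem_ofPred_eq] at hi ⊢
      rcases hi with ⟨hi | hi, h0⟩
      · exact absurd hi.1 h0
      · exact ⟨hi.2, by omega⟩
    · intro j hj
      simp only [psi, Finset.coe_filter, Finset.mem_filter, Finset.mem_univ, true_and,
        Set.mem_ofPred_eq] at hj ⊢
      refine ⟨Or.inr ⟨by omega, ?_⟩, by omega⟩
      convert hj.1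
      omega
    · intro i _; ext; simp
    · intro j hj
      simp only [Finset.coe_filter, Set.mem_ofPred_eq] at hj
      ext; simp only; omega
  have h3 : ((psi x).filter fun i => i.val = 0).card = (loc x).card - 1 := by
    obtain ⟨a, b, _⟩ := h
    rcases (by omega : (loc x).card = 1 ∨ (loc x).card = 2) with hc | hc
    · rw [hc, Finset.card_eq_zero, Finset.filter_eq_empty_iff]
      intro i hi h0
      simp only [psi, Finset.mem_filter, Finset.mem_univ, true_and, hc] at hi
      omega
    · rw [hc, Finset.card_eq_one]
      refine ⟨0, ?_⟩
      ext i
      simp only [psi, Finset.mem_filter, Finset.mem_univ, true_and, hc, Finset.mem_singleton,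
        Fin.ext_iff, Fin.val_zero]
      exact ⟨fun h => h.2, fun h => ⟨Or.inl ⟨h, trivial⟩, h⟩⟩
  have h4 : ((psi x).filter fun i => i.val = 0).card +
      ((psi x).filter fun i => ¬ i.val = 0).card = (psi x).card :=
    Finset.card_filter_add_card_filter_not _
  have := h.1
  omega

/-- The six types of generators. -/
inductive Ty : Type
  | X0 | X1 | X2 | Y0 | Y1 | Y2
  deriving DecidableEq

instance : Fintype Ty := ⟨{.X0, .X1, .X2, .Y0, .Y1, .Y2}, fun t => by cases t <;> decide⟩

/-- The index of a type. -/
def Ty.index : Ty → ℕ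
  | .X0 => 0
  | .X1 => 1
  | .X2 => 2
  | .Y0 => 0
  | .Y1 => 1
  | .Y2 => 2

/-- The generators of the bimodule. The summands `X_i` and `Y_i` have one generator for each
preferred idempotent state whose smallest element is `i`, its right idempotent state. -/
def Gen (n : ℕ) : Type :=
  {g : Ty × State (2 * (n + 1)) (n + 1) // Preferred g.2.1 ∧
    (∃ j ∈ g.2.1, j.val = g.1.index) ∧ ∀ j ∈ g.2.1, g.1.index ≤ j.val}

open Classical in
instance : Fintype (Gen n) := inferInstanceAs (Fintype (Subtype _))

/-- The type of a generator. -/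
def Gen.ty (x : Gen n) : Ty := x.1.1

/-- The right idempotent state of a generator. -/
def Gen.rgt (x : Gen n) : State (2 * (n + 1)) (n + 1) := x.1.2

/-- The left idempotent state `ψ(x)` of a generator with the right idempotent state `x`. -/
def Gen.lft (x : Gen n) : State (2 * n) n := ⟨psi x.rgt.1, card_psi _ x.rgt.2 x.2.1⟩

/-- The map `Ψ`: the pure element with the idempotent states `ψ(x)` and `ψ(y)` and the weights
`weight_i(Ψ(b)) = weight_{i+2}(b)`. (It is only used for preferred `x` and `y`, and the weights at
the strands `1` and `2` are recorded separately.) -/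
def Psi (b : Pure (2 * (n + 1)) (n + 1)) : BAlg n :=
  Blg.elt (2 * n) n (psi b.src.1) (psi b.tgt.1) fun i => b.dwt (shift i)

/-- The labels in the diagrams. With `i = 1, 2`, the label `one` is `1`, the label `U_i k` is
`U_i^{k+1}`, and the labels `L_i k` and `R_i k` are `L_i U_i^k` and `R_i U_i^k`. -/
inductive Letter : Type
  | one
  | U1 (k : ℕ)
  | U2 (k : ℕ)
  | L1 (k : ℕ)
  | L2 (k : ℕ)
  | R1 (k : ℕ)
  | R2 (k : ℕ)

/-- The label that describes a pure element at the strands `1` and `2`. It is `none` if both weights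
are positive, as no label in the diagrams is of that kind. -/
def letter (b : Pure (2 * (n + 1)) (n + 1)) : Option Letter :=
  let d1 := b.dwt (strand1 n)
  let d2 := b.dwt (strand2 n)
  if d1 = 0 ∧ d2 = 0 then some .one
  else if d2 = 0 then
    if d1 % 2 = 0 then some (.U1 (d1 / 2 - 1))
    else if level b.src.1 (strand1 n) < level b.tgt.1 (strand1 n) then some (.R1 (d1 / 2))
    else some (.L1 (d1 / 2))
  else if d1 = 0 then
    if d2 % 2 = 0 then some (.U2 (d2 / 2 - 1))
    else if level b.src.1 (strand2 n) < level b.tgt.1 (strand2 n) then some (.R2 (d2 / 2))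
    else some (.L2 (d2 / 2))
  else none

/-- The arrows of the specialized diagram. The last line is `δ¹₂(X, b) = Ψ(b) ⊗ X` for `b` of weight
`0` at the strands `1` and `2`. -/
def hatArrow : Ty → List Letter → Ty → Bool
  | .X1, [.U1 0, .U2 0], .Y1 => true
  | .X1, [.U2 0, .U1 0], .Y1 => true
  | .X1, [.R2 0], .X2 => true
  | .X1, [.L1 0], .X0 => true
  | .X0, [.R1 0, .R2 0], .Y2 => true
  | .Y2, [.L2 0], .Y1 => true
  | .X2, [.L2 0, .L1 0], .Y0 => true
  | .Y0, [.R1 0], .Y1 => true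
  | .X1, [.U2 0, .L1 0], .Y0 => true
  | .X1, [.U1 0, .R2 0], .Y2 => true
  | .X2, [.L2 0, .U1 0], .Y1 => true
  | .X0, [.R1 0, .U2 0], .Y1 => true
  | s, [.one], t => decide (s = t)
  | _, _, _ => false

/-- The arrows of the unspecialized diagram, where `some (p, q)` is an arrow with the coefficient
`w^p z^q`, and `none` means that there is no arrow. -/
def arrow : Ty → List Letter → Ty → Option (ℕ × ℕ)
  | .X1, [.R2 l], .X2 => some (0, l)
  | .X2, [.L2 l], .X1 => some (0, l + 1)
  | .X1, [.L1 k], .X0 => some (k, 0)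
  | .X0, [.R1 k], .X1 => some (k + 1, 0)
  | .X1, [.U1 k, .U2 l], .Y1 => some (k, l)
  | .X1, [.U2 l, .U1 k], .Y1 => some (k, l)
  | .Y1, [], .X1 => some (1, 1)
  | .X0, [.R1 k, .R2 l], .Y2 => some (k, l)
  | .Y2, [.L2 l], .Y1 => some (0, l)
  | .Y1, [.R2 l], .Y2 => some (0, l + 1)
  | .X2, [.L2 l, .L1 k], .Y0 => some (k, l)
  | .Y0, [.R1 k], .Y1 => some (k, 0)
  | .Y1, [.L1 k], .Y0 => some (k + 1, 0)
  | .X1, [.U2 l, .L1 k], .Y0 => some (k, l)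
  | .X1, [.U1 k, .R2 l], .Y2 => some (k, l)
  | .X2, [.L2 l, .U1 k], .Y1 => some (k, l)
  | .X0, [.R1 k, .U2 l], .Y1 => some (k, l)
  | .Y2, [], .X2 => some (1, 0)
  | .Y0, [], .X0 => some (0, 1)
  | .X1, [.U1 k], .X1 => some (k + 1, 0)
  | .X1, [.U2 l], .X1 => some (0, l + 1)
  | .Y1, [.U1 k], .Y1 => some (k + 1, 0)
  | .Y1, [.U2 l], .Y1 => some (0, l + 1)
  | .X0, [.U1 k], .X0 => some (k + 1, 0)
  | .Y0, [.U1 k], .Y0 => some (k + 1, 0)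
  | .X2, [.U2 l], .X2 => some (0, l + 1)
  | .Y2, [.U2 l], .Y2 => some (0, l + 1)
  | s, [.one], t => if s = t then some (0, 0) else none
  | _, _, _ => none

/-- The pure elements in the list are successively composable and lead from `x` to `y`. -/
def Chain {m k : ℕ} : State m k → List (Pure m k) → State m k → Prop
  | x, [], y => x = y
  | x, p :: ps, y => p.src = x ∧ Chain p.tgt ps y

/-- The multilinear extension to `B(m,k)` of a function on lists of pure elements. -/
def multilinearExt {m k : ℕ} {E : Type} [AddCommGroup E] [Module (ZMod 2) E] :
    (List (Pure m k) → E) → List (Blg m k) → E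
  | f, [] => f []
  | f, a :: l => a.coeffs.sum fun p c => c • multilinearExt (fun ps => f (p.1 :: ps)) l

/-- The operations on pure algebra elements that are specified by a diagram: an arrow with the labels
of `b₁, …, b_k` and the coefficient `c` (`coef t ls t' b` stands for `c · b`) gives the term
`c · Ψ(b₁) ⋯ Ψ(b_k) ⊗ y` of `δ¹_{1+k}(x, b₁, …, b_k)`. -/
def pureOp {E : Type} [AddCommGroup E] (coef : Ty → List Letter → Ty → BAlg n → E) (x : Gen n)
    (ps : List (Pure (2 * (n + 1)) (n + 1))) (y : Gen n) : E :=
  open Classical in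
  if Chain x.rgt ps y.rgt then
    match ps.mapM letter with
    | some ls => coef x.ty ls y.ty (Blg.idem x.lft * (ps.map Psi).prod)
    | none => 0
  else 0

/-- The operations of the specialized bimodule over `B(n)` and `B(n+1)`. -/
def markedMinHat (n : ℕ) (x : Gen n) (l : List (BAlg (n + 1))) (y : Gen n) : BAlg n :=
  multilinearExt (fun ps => pureOp (fun s ls t b => if hatArrow s ls t then b else 0) x ps y) l

/-- The operations of the bimodule over `B(n)[w,z]` and `B(n+1)`. -/
def markedMin (n : ℕ) (x : Gen n) (l : List (BAlg (n + 1))) (y : Gen n) : BAlgWZ n :=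
  multilinearExt (fun ps => pureOp (fun s ls t b =>
    match arrow s ls t with
    | some (p, q) => monomial p (monomial q b)
    | none => 0) x ps y) l

/-- The inclusion of `B(n)` in `B(n)[w,z]`. -/
def incl (n : ℕ) : BAlg n →+* BAlgWZ n := C.comp C

/-- The specialization `w = z = 0`. -/
def specialize (f : BAlgWZ n) : BAlg n := (f.eval 0).eval 0

/-- Twice the total weight of a pure element, that is, `-2Δ`. -/
def Pure.total {m k : ℕ} (p : Pure m k) : ℕ := ∑ i, p.dwt i

/-- Boundedness: a lower bound on `Δ` of a term of `δ¹_{1+k}(x, a₁, …, a_k)` implies a lower bound on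
`Δ(a₁) + ⋯ + Δ(a_k)`. Here `a₁, …, a_k` are pure, and `-2Δ` of `w^p z^q b` is twice the total weight
of `b`, plus `2p + 2q`. -/
def IsBounded (δ : Gen n → List (BAlg (n + 1)) → Gen n → BAlgWZ n) : Prop :=
  ∀ M : ℕ, ∃ N : ℕ, ∀ (x y : Gen n) (ps : List (Pure (2 * (n + 1)) (n + 1))) (p q : ℕ)
    (b : {b : Pure (2 * n) n // ¬ b.InJ}),
    Blg.coeffs (((δ x (ps.map Blg.ofPure) y).coeff p).coeff q) b ≠ 0 →
    b.1.total + 2 * p + 2 * q ≤ M → (ps.map Pure.total).sum ≤ N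

end MarkedMin

end BorderedLink

end

/-!
The proof rests on three ideas.

**Heights.** An idempotent state `x` is determined by its height function `i ↦ #{j ∈ x : i ≤ j}`,
a lattice path, and the minimal doubled weights of a pure element from `x` to `y` are the
distances `gap x y` of the two paths. A pure element lies in the ideal of relations if and only if
either its weights suffice for a detour through a state `s` with a full turn at a strand `i` where
`s` has no element next to `i` (`Flat`), or some element of the state moves by more than one step
(`Pure.InJ.flat_or_tooFar`, `Flat.inJ`, `Pure.inJ_of_tooFar`).

**Local conditions.** In terms of heights, the bimodule is simple. For preferred states `x`, `y`
and a single pure input `p` from `x` to `y`, there is an arrow between the generators of type `X`,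
and one between those of type `Y`, if and only if `p` is `Allowed`, a condition on the weights at
the strands `1` and `2` and on the initial state. Two inputs `p`, `q` have an arrow from an `X` to
a `Y` if and only if the path makes a `Turn` between them. The exponents of `w` and `z` are
determined by gradings of the types (`Ty.wdeg`, `Ty.zdeg`), so every term of an operation is of
the form `term x d y`, with `d` the total doubled weight of the inputs, and terms multiply by
adding weights (`Graded.term_mul`). In order that the description holds for all pure inputs,
including those whose class is zero, `Ψ` has to respect the relations on allowed elements; this is
`psiPure_inJ`.

**The structure relation.** If the intermediate states are preferred, then a turn between `p` and
`q` is exactly the failure of allowedness to be multiplicative (`turn_iff`, `allowed_of_mul`), and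
the structure relations for two and three inputs become parity statements. If an intermediate
state is not preferred, the only term that is left contains `Ψ` of an allowed product through that
state, which is zero in `B(n)` (`psiPure_mul_inJ`). With at least four inputs no term is left.

The elements `1` and `U_i U_j` are sums of loops with fixed even weights. Such a sum acts by its
image if the weights at the strands `1` and `2` are zero, and by zero if both are positive
(`actsBy_diag`, `actsBy_zero_of_pos`). In both cases it is never an input of a turn
(`opTwo_diag`). This gives all equivariance statements. The curved structure relation follows,
since by equivariance the curvature only contributes in the case without inputs
(`IsTypeDA.isCurved`). Boundedness follows from the gradings. Finally the specialization `w = z =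
0` is a ring homomorphism that takes the operations of one bimodule to those of the other
(`specializeHom_markedMin`), and carries all the properties along.
-/

noncomputable section

namespace BorderedLink

/-! ### Height functions of idempotent states -/

/-- The height function of a set `x`: the number of its elements that are at least `i`. At the
strand `i` it is the number `v_i(x)`. -/
def height {N : ℕ} (x : Finset (Fin N)) (i : ℕ) : ℕ :=
  (x.filter fun j => i ≤ j.val).card

theorem level_eq_height {m : ℕ} (x : Finset (Fin (m + 1))) (i : Fin m) :
    level x i = height x (i.val + 1) := rfl

theorem height_zero {N : ℕ} (x : Finset (Fin N)) : height x 0 = x.card := by simp [height]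

theorem height_eq_zero {N : ℕ} (x : Finset (Fin N)) {i : ℕ} (hi : N ≤ i) : height x i = 0 := by
  rw [height, Finset.card_eq_zero, Finset.filter_eq_empty_iff]
  intro j _
  omega

theorem height_eq {N : ℕ} (x : Finset (Fin N)) (i : Fin N) :
    height x i.val = height x (i.val + 1) + if i ∈ x then 1 else 0 := by
  classical
  have h : (x.filter fun j => i.val ≤ j.val) =
      (x.filter fun j => i.val + 1 ≤ j.val) ∪ (if i ∈ x then {i} else ∅) := by
    ext j
    by_cases hj : j = i
    · subst hj
      by_cases h : j ∈ x <;> simp [h]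
    · have : j.val ≠ i.val := fun h => hj (Fin.ext h)
      by_cases h : i ∈ x <;> simp [h, hj] <;> omega
  rw [height, h, Finset.card_union_of_disjoint]
  · split_ifs <;> simp [height]
  · split_ifs <;> simp

theorem mem_iff_height {N : ℕ} (x : Finset (Fin N)) (i : Fin N) :
    i ∈ x ↔ height x i.val = height x (i.val + 1) + 1 := by
  have := height_eq x i
  by_cases h : i ∈ x
  · simpa [h] using this
  · simp only [h, if_false] at this
    simp only [h, false_iff]
    omega

theorem not_mem_iff_height {N : ℕ} (x : Finset (Fin N)) (i : Fin N) :
    i ∉ x ↔ height x i.val = height x (i.val + 1) := by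
  have := height_eq x i
  by_cases h : i ∈ x
  · simp only [h, if_true] at this
    simp only [h, not_true, false_iff]
    omega
  · simpa [h] using this

theorem height_step {N : ℕ} (x : Finset (Fin N)) (i : ℕ) :
    height x (i + 1) ≤ height x i ∧ height x i ≤ height x (i + 1) + 1 := by
  by_cases hi : i < N
  · have := height_eq x ⟨i, hi⟩
    simp only at this
    split_ifs at this <;> omega
  · rw [height_eq_zero x (i := i) (by omega), height_eq_zero x (i := i + 1) (by omega)]
    omega

theorem eq_of_height_eq {N : ℕ} {x y : Finset (Fin N)} (h : ∀ i, height x i = height y i) :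
    x = y := by
  ext i
  rw [mem_iff_height, mem_iff_height, h, h]

/-- Functions with the formal properties of the height function of a `k`-element subset of
`{0, …, m}`. -/
structure IsHeight (m k : ℕ) (H : ℕ → ℕ) : Prop where
  zero : H 0 = k
  top : H (m + 1) = 0
  step : ∀ i ≤ m, H (i + 1) ≤ H i ∧ H i ≤ H (i + 1) + 1

theorem State.isHeight {m k : ℕ} (x : State m k) : IsHeight m k (height x.1) :=
  ⟨(height_zero _).trans x.2, height_eq_zero _ le_rfl, fun i _ => height_step x.1 i⟩

theorem IsHeight.exists_state {m k : ℕ} {H : ℕ → ℕ} (hH : IsHeight m k H) :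
    ∃ s : State m k, ∀ i ≤ m + 1, height s.1 i = H i := by
  classical
  set x : Finset (Fin (m + 1)) := Finset.univ.filter fun j => H j.val = H (j.val + 1) + 1 with hx
  have key : ∀ r ≤ m + 1, height x (m + 1 - r) = H (m + 1 - r) := by
    intro r
    induction r with
    | zero => intro _; rw [Nat.sub_zero, height_eq_zero x le_rfl, hH.top]
    | succ r ih =>
      intro hr
      have e : m + 1 - (r + 1) + 1 = m + 1 - r := by omega
      have h1 := height_eq x ⟨m + 1 - (r + 1), by omega⟩
      have h2 := hH.step (m + 1 - (r + 1)) (by omega)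
      simp only [hx, Finset.mem_filter, Finset.mem_univ, true_and] at h1
      rw [e] at h1 h2
      rw [← hx, ih (by omega)] at h1
      split_ifs at h1 <;> omega
  have key' : ∀ i ≤ m + 1, height x i = H i := by
    intro i hi
    have := key (m + 1 - i) (by omega)
    rwa [show m + 1 - (m + 1 - i) = i by omega] at this
  exact ⟨⟨x, by rw [← height_zero, key' 0 (by omega), hH.zero]⟩, key'⟩

/-- The median of three numbers, that is, `h` clamped to the interval between `a` and `b`. -/
def clamp (a b h : ℕ) : ℕ := max (min a b) (min (max a b) h)

theorem clamp_of_mem {a b h : ℕ} (h1 : a ≤ h) (h2 : h ≤ b) : clamp a b h = h := by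
  unfold clamp; omega

theorem gap_clamp (a b h : ℕ) : ((a - clamp a b h) + (clamp a b h - a)) +
    ((clamp a b h - b) + (b - clamp a b h)) ≤ (a - b) + (b - a) := by
  unfold clamp; omega

/-- Height functions form a distributive lattice. Hence a function with the right steps, clamped
between two height functions, is a height function. -/
theorem IsHeight.clamp {m k : ℕ} {F G h : ℕ → ℕ} (hF : IsHeight m k F) (hG : IsHeight m k G)
    (hh : ∀ i, h (i + 1) ≤ h i ∧ h i ≤ h (i + 1) + 1) :
    IsHeight m k fun i => BorderedLink.clamp (F i) (G i) (h i) where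
  zero := by simp only [hF.zero, hG.zero, BorderedLink.clamp]; omega
  top := by simp only [hF.top, hG.top, BorderedLink.clamp]; omega
  step i hi := by
    have := hF.step i hi
    have := hG.step i hi
    have := hh i
    unfold BorderedLink.clamp
    omega

/-! ### The ideal of relations in terms of heights -/

/-- The distance of the height functions of `x` and `y` at `i`, which is the smallest doubled weight
at the strand `i` of a pure element from `x` to `y`. -/
def gap {N : ℕ} (x y : Finset (Fin N)) (i : ℕ) : ℕ :=
  (height x i - height y i) + (height y i - height x i)

theorem gap_comm {N : ℕ} (x y : Finset (Fin N)) (i : ℕ) : gap x y i = gap y x i := add_comm _ _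

theorem gap_triangle {N : ℕ} (x y z : Finset (Fin N)) (i : ℕ) :
    gap x z i ≤ gap x y i + gap y z i := by
  unfold gap; omega

theorem admissible_iff {m : ℕ} (x y : Finset (Fin (m + 1))) (d : Fin m → ℕ) :
    Admissible x y d ↔ ∀ i : Fin m, gap x y (i.val + 1) ≤ d i ∧
      Even (height x (i.val + 1) + height y (i.val + 1) + d i) := by
  refine forall_congr' fun i => ?_
  rw [level_eq_height, level_eq_height, gap, ← and_assoc]
  refine and_congr_left fun _ => ?_
  omega

variable {m k : ℕ}

namespace Pure

theorem gap_le (p : Pure m k) (i : Fin m) : gap p.src.1 p.tgt.1 (i.val + 1) ≤ p.dwt i :=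
  ((admissible_iff _ _ _).1 p.adm i).1

theorem even_height (p : Pure m k) (i : Fin m) :
    Even (height p.src.1 (i.val + 1) + height p.tgt.1 (i.val + 1) + p.dwt i) :=
  ((admissible_iff _ _ _).1 p.adm i).2

/-- A pure element lies in the ideal if its weights suffice for a path through an element `g` of the
ideal. -/
theorem InJ.of_path {p g : Pure m k} (hg : g.InJ)
    (h : ∀ i : Fin m, gap p.src.1 g.src.1 (i.val + 1) + g.dwt i + gap g.tgt.1 p.tgt.1 (i.val + 1) ≤
      p.dwt i) : p.InJ := by
  let a : Pure m k := ⟨p.src, g.src, fun i => gap p.src.1 g.src.1 (i.val + 1), by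
    rw [admissible_iff]
    refine fun i => ⟨le_rfl, ?_⟩
    rw [Nat.even_iff, gap]
    omega⟩
  let b : Pure m k := ⟨g.tgt, p.tgt,
    fun i => p.dwt i - g.dwt i - gap p.src.1 g.src.1 (i.val + 1), by
    rw [admissible_iff]
    intro i
    have h1 := h i
    have h2 := g.even_height i
    have h3 := p.even_height i
    rw [Nat.even_iff] at h2 h3 ⊢
    unfold gap at *
    omega⟩
  have e : p = (a.mul g rfl).mul b rfl := by
    ext1
    · rfl
    · rfl
    · funext i
      have h1 := h i
      simp only [Pure.mul, Pi.add_apply, a, b]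
      omega
  rw [e]
  exact .mul_right _ _ _ (.mul_left _ _ _ hg)

end Pure

/-- The weights `d` suffice for the path from `x` through `s` to `y` with a full turn at the strand
`i`, and `s` has no element next to this strand. -/
def Flat (x y : State m k) (d : Fin m → ℕ) (s : State m k) (i : Fin m) : Prop :=
  i.castSucc ∉ s.1 ∧ i.succ ∉ s.1 ∧ ∀ j : Fin m,
    gap x.1 s.1 (j.val + 1) + (if j = i then 2 else 0) + gap s.1 y.1 (j.val + 1) ≤ d j

theorem Flat.symm {x y : State m k} {d : Fin m → ℕ} {s : State m k} {i : Fin m}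
    (h : Flat x y d s i) : Flat y x d s i := by
  refine ⟨h.1, h.2.1, fun j => ?_⟩
  have := h.2.2 j
  rw [gap_comm y.1 s.1, gap_comm s.1 x.1]
  omega

theorem Flat.inJ {p : Pure m k} {s : State m k} {i : Fin m} (h : Flat p.src p.tgt p.dwt s i) :
    p.InJ := by
  let g : Pure m k := ⟨s, s, Pi.single i 2, by
    rw [admissible_iff]
    intro j
    refine ⟨by simp [gap], ?_⟩
    rw [Nat.even_iff]
    by_cases hj : j = i
    · subst hj; simp; omega
    · simp [hj]; omega⟩
  refine Pure.InJ.of_path (g := g) (.U i g ⟨rfl, rfl⟩ h.1 h.2.1) fun j => ?_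
  have := h.2.2 j
  simpa [g, Pi.single_apply] using this

/-- The states `s` and `t` are the ends of a generator `R_i R_{i+1}` of the ideal; those of
`L_{i+1} L_i` are the same in the opposite order. -/
def IsJump (s t : State m k) (i j : Fin m) : Prop :=
  i.val + 1 = j.val ∧ height s.1 i.val = height s.1 (i.val + 1) + 1 ∧
    height s.1 (i.val + 1) = height s.1 (i.val + 2) ∧
    height s.1 (i.val + 2) = height s.1 (i.val + 3) ∧
    ∀ l, height t.1 l = height s.1 l + if l = i.val + 1 ∨ l = i.val + 2 then 1 else 0

/-- If the path from `x` to `y` through a generator `R_i R_{i+1}` has to turn back at the strand `i`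
or `i + 1`, this makes room for one of the generators `U_i` or `U_{i+1}`. -/
theorem IsJump.flat_or_lt {x y s t : State m k} {i j : Fin m} {d : Fin m → ℕ} (h : IsJump s t i j)
    (hd : ∀ l : Fin m, gap x.1 s.1 (l.val + 1) + gap s.1 t.1 (l.val + 1) +
      gap t.1 y.1 (l.val + 1) ≤ d l) :
    (∃ s i, Flat x y d s i) ∨ height x.1 (i.val + 1) < height y.1 (i.val + 2) := by
  obtain ⟨hij, h1, h2, h3, h4⟩ := h
  have a1 := h4 i.val
  have a2 := h4 (i.val + 1)
  have a3 := h4 (i.val + 2)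
  rw [if_neg (by omega)] at a1
  rw [if_pos (by omega)] at a2 a3
  by_cases c1 : height s.1 (i.val + 1) < height x.1 (i.val + 1)
  · refine Or.inl ⟨t, i, ?_, ?_, fun l => ?_⟩
    · rw [not_mem_iff_height, Fin.val_castSucc]; omega
    · rw [not_mem_iff_height, Fin.val_succ]; simp only [add_assoc, Nat.reduceAdd]; omega
    · refine le_trans (Nat.add_le_add_right ?_ _) (hd l)
      by_cases hl : l = i
      · rw [if_pos hl, hl]; unfold gap; omega
      · rw [if_neg hl]; exact gap_triangle _ _ _ _
  by_cases c2 : height y.1 (i.val + 2) ≤ height s.1 (i.val + 1)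
  · refine Or.inl ⟨s, j, ?_, ?_, fun l => ?_⟩
    · rw [not_mem_iff_height, Fin.val_castSucc, ← hij]
      simp only [add_assoc, Nat.reduceAdd]; omega
    · rw [not_mem_iff_height, Fin.val_succ, ← hij]
      simp only [add_assoc, Nat.reduceAdd]; omega
    · refine le_trans ?_ (hd l)
      rw [add_assoc, add_assoc]
      refine Nat.add_le_add_left ?_ _
      by_cases hl : l = j
      · rw [if_pos hl, hl, ← hij]; simp only [gap, add_assoc, Nat.reduceAdd]; omega
      · rw [if_neg hl, zero_add]; exact gap_triangle _ _ _ _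
  exact Or.inr (by omega)

theorem height_move {N : ℕ} {x : Finset (Fin N)} {a b : Fin N} (hab : a.val + 1 = b.val)
    (ha : a ∈ x) (hb : b ∉ x) (l : ℕ) :
    height (insert b (x.erase a)) l = height x l + if l = b.val then 1 else 0 := by
  classical
  have hne : a ≠ b := by rintro rfl; omega
  by_cases h1 : l ≤ a.val
  · have e1 : ((insert b (x.erase a)).filter fun j => l ≤ j.val) =
        insert b ((x.filter fun j => l ≤ j.val).erase a) := by
      ext j
      simp only [Finset.mem_filter, Finset.mem_insert, Finset.mem_erase]
      constructor
      · tauto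
      · rintro (rfl | h)
        · exact ⟨Or.inl rfl, by omega⟩
        · tauto
    rw [height, e1, Finset.card_insert_of_notMem (by simp [hb]),
      Finset.card_erase_of_mem (by simp [ha, h1]), height, if_neg (by omega)]
    have : 0 < (x.filter fun j => l ≤ j.val).card := Finset.card_pos.2 ⟨a, by simp [ha, h1]⟩
    omega
  · by_cases h2 : l = b.val
    · have e1 : ((insert b (x.erase a)).filter fun j => l ≤ j.val) =
          insert b (x.filter fun j => l ≤ j.val) := by
        ext j
        simp only [Finset.mem_filter, Finset.mem_insert, Finset.mem_erase]
        constructor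
        · tauto
        · rintro (rfl | h)
          · exact ⟨Or.inl rfl, by omega⟩
          · exact ⟨Or.inr ⟨by rintro rfl; omega, h.1⟩, h.2⟩
      rw [height, e1, Finset.card_insert_of_notMem (by simp [hb]), if_pos h2, height]
    · have e1 : ((insert b (x.erase a)).filter fun j => l ≤ j.val) =
          (x.filter fun j => l ≤ j.val) := by
        ext j
        simp only [Finset.mem_filter, Finset.mem_insert, Finset.mem_erase]
        constructor
        · rintro ⟨rfl | h, h'⟩
          · omega
          · exact ⟨h.2, h'⟩
        · rintro ⟨h, h'⟩
          exact ⟨Or.inr ⟨by rintro rfl; omega, h⟩, h'⟩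
      rw [height, e1, if_neg h2, height, add_zero]

theorem eq_insert_of_height {N : ℕ} {x y : Finset (Fin N)} {a b : Fin N} (hab : a.val + 1 = b.val)
    (ha : a ∈ x) (hb : b ∉ x)
    (h : ∀ l, height y l = height x l + if l = b.val then 1 else 0) :
    y = insert b (x.erase a) :=
  eq_of_height_eq fun l => by rw [h, height_move hab ha hb]

namespace Pure

theorem IsR.height {i : Fin m} {p : Pure m k} (hp : IsR i p) (l : ℕ) :
    height p.tgt.1 l = height p.src.1 l + if l = i.val + 1 then 1 else 0 := by
  rw [hp.2.2.1, height_move (by simp) hp.1 hp.2.1]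
  rfl

theorem IsL.height {i : Fin m} {p : Pure m k} (hp : IsL i p) (l : ℕ) :
    height p.src.1 l = height p.tgt.1 l + if l = i.val + 1 then 1 else 0 := by
  have h1 : p.src.1 = insert i.succ (p.tgt.1.erase i.castSucc) := by
    have hne : i.succ ≠ i.castSucc := by simp [Fin.ext_iff]
    rw [hp.2.2.1, Finset.erase_insert (by simp [hp.2.1]), Finset.insert_erase hp.1]
  have h2 : i.castSucc ∈ p.tgt.1 := by rw [hp.2.2.1]; simp
  have h3 : i.succ ∉ p.tgt.1 := by rw [hp.2.2.1]; simp [Fin.ext_iff]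
  conv_lhs => rw [h1]
  rw [height_move (by simp) h2 h3]
  rfl

/-- Every pure element of the ideal has a path through one of the generators of the ideal. -/
theorem InJ.exists_path {p : Pure m k} (h : p.InJ) :
    (∃ s i, Flat p.src p.tgt p.dwt s i) ∨
    (∃ (s t : State m k) (i j : Fin m), IsJump s t i j ∧ ∀ l : Fin m,
      gap p.src.1 s.1 (l.val + 1) + gap s.1 t.1 (l.val + 1) + gap t.1 p.tgt.1 (l.val + 1) ≤
        p.dwt l) ∨
    (∃ (s t : State m k) (i j : Fin m), IsJump s t i j ∧ ∀ l : Fin m,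
      gap p.src.1 t.1 (l.val + 1) + gap t.1 s.1 (l.val + 1) + gap s.1 p.tgt.1 (l.val + 1) ≤
        p.dwt l) := by
  induction h with
  | RR i j hij p q hp hq h =>
    refine Or.inr (Or.inl ⟨p.src, q.tgt, i, j, ⟨hij, ?_, ?_, ?_, ?_⟩, ?_⟩)
    · exact (mem_iff_height _ _).1 hp.1
    · exact (not_mem_iff_height _ _).1 hp.2.1
    · have h1 := (not_mem_iff_height _ _).1 hq.2.1
      rw [← h, Fin.val_succ, hp.height, hp.height, ← hij, if_neg (by omega), if_neg (by omega)]
        at h1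
      exact h1
    · intro l
      rw [hq.height, ← h, hp.height]
      split_ifs <;> omega
    · intro l
      have h1 := hp.height (l.val + 1)
      have h2 := hq.height (l.val + 1)
      rw [← h] at h2
      simp only [mul, Pi.add_apply, hp.2.2.2, hq.2.2.2, Pi.single_apply, gap, Fin.ext_iff]
      split_ifs at * <;> omega
  | LL i j hij p q hp hq h =>
    refine Or.inr (Or.inr ⟨q.tgt, p.src, i, j, ⟨hij, ?_, ?_, ?_, ?_⟩, ?_⟩)
    · refine (mem_iff_height _ i.castSucc).1 ?_
      rw [hq.2.2.1]; simp
    · refine (not_mem_iff_height _ i.succ).1 ?_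
      rw [hq.2.2.1]; simp [Fin.ext_iff]
    · have h1 := (not_mem_iff_height _ j.succ).1 (show j.succ ∉ p.tgt.1 by
        rw [hp.2.2.1]; simp [Fin.ext_iff])
      rw [h, Fin.val_succ, hq.height, hq.height, ← hij, if_neg (by omega), if_neg (by omega)] at h1
      exact h1
    · intro l
      rw [hp.height, h, hq.height]
      split_ifs <;> omega
    · intro l
      have h1 := hp.height (l.val + 1)
      have h2 := hq.height (l.val + 1)
      rw [h] at h1
      simp only [mul, Pi.add_apply, hp.2.2.2, hq.2.2.2, Pi.single_apply, gap, Fin.ext_iff]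
      split_ifs at * <;> omega
  | U i p hp h1 h2 =>
    refine Or.inl ⟨p.src, i, h1, h2, fun j => ?_⟩
    simp only [hp.1, hp.2, Pi.single_apply, gap]
    omega
  | mul_left p q h hq ih =>
    have tri : ∀ (s : State m k) (l : Fin m), gap p.src.1 s.1 (l.val + 1) ≤
        p.dwt l + gap q.src.1 s.1 (l.val + 1) := by
      intro s l
      have := p.gap_le l
      rw [h] at this
      unfold gap at *
      omega
    refine ih.imp ?_ (Or.imp ?_ ?_)
    · rintro ⟨s, i, h1, h2, h3⟩
      refine ⟨s, i, h1, h2, fun l => ?_⟩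
      have h4 := h3 l
      have h5 := tri s l
      simp only [mul, Pi.add_apply]
      omega
    all_goals
      rintro ⟨s, t, i, j, h1, h2⟩
      refine ⟨s, t, i, j, h1, fun l => ?_⟩
      have h3 := h2 l
      have h4 := tri s l
      have h5 := tri t l
      simp only [mul, Pi.add_apply]
      omega
  | mul_right p q h hp ih =>
    have tri : ∀ (s : State m k) (l : Fin m), gap s.1 q.tgt.1 (l.val + 1) ≤
        gap s.1 p.tgt.1 (l.val + 1) + q.dwt l := by
      intro s l
      have := q.gap_le l
      rw [← h] at this
      unfold gap at *
      omega
    refine ih.imp ?_ (Or.imp ?_ ?_)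
    · rintro ⟨s, i, h1, h2, h3⟩
      refine ⟨s, i, h1, h2, fun l => ?_⟩
      have h4 := h3 l
      have h5 := tri s l
      simp only [mul, Pi.add_apply]
      omega
    all_goals
      rintro ⟨s, t, i, j, h1, h2⟩
      refine ⟨s, t, i, j, h1, fun l => ?_⟩
      have h3 := h2 l
      have h4 := tri s l
      have h5 := tri t l
      simp only [mul, Pi.add_apply]
      omega

/-- The generators `R_i R_{i+1}` and `L_{i+1} L_i` only matter for pure elements along which some
element of the state moves by more than one step. -/
theorem InJ.flat_or_tooFar {p : Pure m k} (h : p.InJ) :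
    (∃ s i, Flat p.src p.tgt p.dwt s i) ∨ ∃ i j : Fin m, i.val + 1 = j.val ∧
      (height p.src.1 (i.val + 1) < height p.tgt.1 (i.val + 2) ∨
        height p.tgt.1 (i.val + 1) < height p.src.1 (i.val + 2)) := by
  rcases h.exists_path with h | ⟨s, t, i, j, h1, h2⟩ | ⟨s, t, i, j, h1, h2⟩
  · exact Or.inl h
  · exact (h1.flat_or_lt h2).imp_right fun h => ⟨i, j, h1.1, Or.inl h⟩
  · refine (h1.flat_or_lt (x := p.tgt) (y := p.src) (d := p.dwt) fun l => ?_).imp ?_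
      fun h => ⟨i, j, h1.1, Or.inr h⟩
    · have := h2 l
      rw [gap_comm p.tgt.1 s.1, gap_comm s.1 t.1, gap_comm t.1 p.src.1]
      omega
    · rintro ⟨s, i, h⟩
      exact ⟨s, i, h.symm⟩

end Pure

/-- Between two states that are far apart there is a generator `R_i R_{i+1}` of the ideal, whose
ends are obtained from step functions by clamping them between the height functions of the two
states. -/
theorem exists_jump (x y : State m k) (i j : Fin m) (hij : i.val + 1 = j.val)
    (h : height x.1 (i.val + 1) < height y.1 (i.val + 2)) :
    ∃ s u t : State m k,
      (i.castSucc ∈ s.1 ∧ i.succ ∉ s.1 ∧ u.1 = insert i.succ (s.1.erase i.castSucc)) ∧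
      (j.castSucc ∈ u.1 ∧ j.succ ∉ u.1 ∧ t.1 = insert j.succ (u.1.erase j.castSucc)) ∧
      ∀ l : Fin m, gap x.1 s.1 (l.val + 1) + (if l = i then 1 else 0) + (if l = j then 1 else 0) +
        gap t.1 y.1 (l.val + 1) ≤ gap x.1 y.1 (l.val + 1) := by
  obtain ⟨c, hc⟩ : ∃ c, c = height x.1 (i.val + 1) := ⟨_, rfl⟩
  have hx := x.isHeight
  have hy := y.isHeight
  -- the heights of `x` and `y` near the two strands lie on different sides of `c`
  have x0 : c ≤ height x.1 i.val ∧ height x.1 i.val ≤ c + 1 := by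
    have := height_step x.1 i.val; omega
  have x2 : height x.1 (i.val + 2) ≤ c := by
    have := height_step x.1 (i.val + 1); simp only [add_assoc, Nat.reduceAdd] at this; omega
  have x3 : height x.1 (i.val + 3) ≤ c := by
    have := height_step x.1 (i.val + 2); simp only [add_assoc, Nat.reduceAdd] at this; omega
  have y2 : c + 1 ≤ height y.1 (i.val + 2) := by omega
  have y1 : c + 1 ≤ height y.1 (i.val + 1) := by
    have := height_step y.1 (i.val + 1); simp only [add_assoc, Nat.reduceAdd] at this; omega
  have y0 : c + 1 ≤ height y.1 i.val := by
    have := height_step y.1 i.val; omega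
  have y3 : c ≤ height y.1 (i.val + 3) := by
    have := height_step y.1 (i.val + 2); simp only [add_assoc, Nat.reduceAdd] at this; omega
  -- the height `c` on the positions `i + 1, i + 2, i + 3`, with slope one outside of them
  let f : ℕ → ℕ := fun l => (c + (i.val + 1 - l)) - (l - (i.val + 3))
  have f0 : f i.val = c + 1 := by simp only [f]; omega
  have f1 : f (i.val + 1) = c := by simp only [f]; omega
  have f2 : f (i.val + 2) = c := by simp only [f]; omega
  have f3 : f (i.val + 3) = c := by simp only [f]; omega
  obtain ⟨s, hs⟩ := (hx.clamp hy (h := f) (fun l => by simp only [f]; omega)).exists_state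
  obtain ⟨u, hu⟩ := (hx.clamp hy (h := fun l => f l + if l = i.val + 1 then 1 else 0)
    (fun l => by simp only [f]; split_ifs <;> omega)).exists_state
  obtain ⟨t, ht⟩ := (hx.clamp hy
    (h := fun l => f l + if l = i.val + 1 ∨ l = i.val + 2 then 1 else 0)
    (fun l => by simp only [f]; split_ifs <;> omega)).exists_state
  clear_value f
  have im := i.isLt
  have jm := j.isLt
  have s0 : height s.1 i.val = c + 1 := by
    rw [hs _ (by omega), f0]; exact clamp_of_mem (by omega) (by omega)
  have s1 : height s.1 (i.val + 1) = c := by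
    rw [hs _ (by omega), f1]; exact clamp_of_mem (by omega) (by omega)
  have s2 : height s.1 (i.val + 2) = c := by
    rw [hs _ (by omega), f2]; exact clamp_of_mem (by omega) (by omega)
  have s3 : height s.1 (i.val + 3) = c := by
    rw [hs _ (by omega), f3]; exact clamp_of_mem (by omega) (by omega)
  have us : ∀ l, height u.1 l = height s.1 l + if l = i.val + 1 then 1 else 0 := by
    intro l
    by_cases hl : l ≤ m + 1
    · by_cases h1 : l = i.val + 1
      · rw [h1, s1, hu _ (by omega), f1, if_pos rfl]
        exact clamp_of_mem (by omega) y1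
      · rw [hs l hl, hu l hl, if_neg h1, add_zero, add_zero]
    · rw [height_eq_zero _ (by omega), height_eq_zero _ (by omega), if_neg (by omega)]
  have tu : ∀ l, height t.1 l = height u.1 l + if l = j.val + 1 then 1 else 0 := by
    intro l
    by_cases hl : l ≤ m + 1
    · rw [← hij]
      by_cases h1 : l = i.val + 1
      · rw [h1, us, s1, ht _ (by omega), f1, if_pos (Or.inl rfl), if_pos rfl, if_neg (by omega)]
        exact clamp_of_mem (by omega) y1
      · by_cases h2 : l = i.val + 2
        · rw [h2, us, s2, ht _ (by omega), f2, if_pos (Or.inr rfl), if_neg (by omega),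
            if_pos rfl]
          exact clamp_of_mem (by omega) y2
        · rw [ht l hl, hu l hl, if_neg h1, if_neg (by omega), if_neg (by omega), add_zero, add_zero]
    · rw [height_eq_zero _ (by omega), height_eq_zero _ (by omega), if_neg (by omega)]
  have m1 : i.castSucc ∈ s.1 := by
    rw [mem_iff_height, Fin.val_castSucc, s0, s1]
  have m2 : i.succ ∉ s.1 := by
    rw [not_mem_iff_height, Fin.val_succ, s1]; exact s2.symm
  have m3 : j.castSucc ∈ u.1 := by
    rw [mem_iff_height, Fin.val_castSucc, ← hij, us, us, if_pos rfl, if_neg (by omega), s1]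
    simp only [add_assoc, Nat.reduceAdd, s2, zero_add]
  have m4 : j.succ ∉ u.1 := by
    rw [not_mem_iff_height, Fin.val_succ, ← hij, us, us, if_neg (by omega), if_neg (by omega)]
    simp only [add_assoc, Nat.reduceAdd, s2, s3]
  refine ⟨s, u, t, ⟨m1, m2, eq_insert_of_height (by simp) m1 m2 us⟩,
    ⟨m3, m4, eq_insert_of_height (by simp) m3 m4 tu⟩, fun l => ?_⟩
  have ts : ∀ l, height t.1 l =
      height s.1 l + (if l = i.val + 1 then 1 else 0) + if l = j.val + 1 then 1 else 0 :=
    fun l => by rw [tu, us]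
  clear us tu hu ht f0 f1 f2 f3 m1 m2 m3 m4 x0 x3 y0 y3 s0 s3 hx hy
  unfold gap
  rw [ts]
  by_cases h1 : l.val = i.val
  · have h2 : ¬ l.val = j.val := by omega
    rw [if_pos (Fin.ext h1), if_neg fun h => h2 (congrArg _ h), h1, if_pos rfl,
      if_neg (by omega), s1]
    clear hs
    omega
  by_cases h2 : l.val = j.val
  · rw [if_neg fun h => h1 (congrArg _ h), if_pos (Fin.ext h2), h2, ← hij,
      if_neg (by omega), if_pos rfl]
    simp only [add_assoc, Nat.reduceAdd, s2]
    clear hs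
    omega
  rw [if_neg fun h => h1 (congrArg _ h), if_neg fun h => h2 (congrArg _ h), if_neg (by omega),
    if_neg (by omega), hs _ (by omega)]
  exact gap_clamp _ _ _

/-- A pure element along which some element of the state moves by more than one step lies in the
ideal. -/
theorem Pure.inJ_of_tooFar {p : Pure m k} {i j : Fin m} (hij : i.val + 1 = j.val)
    (h : height p.src.1 (i.val + 1) < height p.tgt.1 (i.val + 2) ∨
      height p.tgt.1 (i.val + 1) < height p.src.1 (i.val + 2)) : p.InJ := by
  have adm : ∀ (s u : State m k) (i : Fin m), i.castSucc ∈ s.1 → i.succ ∉ s.1 →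
      u.1 = insert i.succ (s.1.erase i.castSucc) →
      Admissible s.1 u.1 (Pi.single i 1) ∧ Admissible u.1 s.1 (Pi.single i 1) := by
    intro s u i h1 h2 h3
    have h4 : ∀ l, height u.1 l = height s.1 l + if l = i.val + 1 then 1 else 0 := fun l => by
      rw [h3, height_move (by simp) h1 h2]; rfl
    rw [admissible_iff, admissible_iff]
    constructor
    all_goals
      intro l
      rw [Nat.even_iff, gap, h4]
      by_cases hl : l = i
      · subst hl; simp; omega
      · have : l.val ≠ i.val := fun h => hl (Fin.ext h)
        simp [hl, this]; omega
  have back : ∀ (s u : State m k) (i : Fin m), i.castSucc ∈ s.1 → i.succ ∉ s.1 →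
      u.1 = insert i.succ (s.1.erase i.castSucc) →
      i.succ ∈ u.1 ∧ i.castSucc ∉ u.1 ∧ s.1 = insert i.castSucc (u.1.erase i.succ) := by
    intro s u i h1 h2 h3
    rw [h3]
    refine ⟨by simp, by simp [Fin.ext_iff], ?_⟩
    rw [Finset.erase_insert (by simp [h2]), Finset.insert_erase h1]
  rcases h with h | h
  · obtain ⟨s, u, t, ⟨a1, a2, a3⟩, ⟨b1, b2, b3⟩, h3⟩ := exists_jump p.src p.tgt i j hij h
    let r1 : Pure m k := ⟨s, u, Pi.single i 1, (adm s u i a1 a2 a3).1⟩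
    let r2 : Pure m k := ⟨u, t, Pi.single j 1, (adm u t j b1 b2 b3).1⟩
    have hg : (r1.mul r2 rfl).InJ := .RR i j hij r1 r2 ⟨a1, a2, a3, rfl⟩ ⟨b1, b2, b3, rfl⟩ rfl
    refine hg.of_path fun l => ?_
    have h4 := h3 l
    have h5 := p.gap_le l
    simp only [Pure.mul, r1, r2, Pi.add_apply, Pi.single_apply]
    omega
  · obtain ⟨s, u, t, ⟨a1, a2, a3⟩, ⟨b1, b2, b3⟩, h3⟩ := exists_jump p.tgt p.src i j hij h
    let r1 : Pure m k := ⟨t, u, Pi.single j 1, (adm u t j b1 b2 b3).2⟩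
    let r2 : Pure m k := ⟨u, s, Pi.single i 1, (adm s u i a1 a2 a3).2⟩
    obtain ⟨c1, c2, c3⟩ := back u t j b1 b2 b3
    obtain ⟨d1, d2, d3⟩ := back s u i a1 a2 a3
    have hg : (r1.mul r2 rfl).InJ := .LL i j hij r1 r2 ⟨c1, c2, c3, rfl⟩ ⟨d1, d2, d3, rfl⟩ rfl
    refine hg.of_path fun l => ?_
    have h4 := h3 l
    have h5 := p.gap_le l
    simp only [Pure.mul, r1, r2, Pi.add_apply, Pi.single_apply]
    unfold gap at *
    omega

/-! ### Preferred idempotent states and the map `ψ` -/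

section Local

variable {n : ℕ}

theorem card_loc_add_height (x : Finset (Fin (2 * (n + 1) + 1))) :
    (loc x).card + height x 3 = x.card := by
  have h : height x 3 = (x.filter fun j => ¬ j.val ≤ 2).card := by
    rw [height]
    congr 1
    ext j
    simp only [Finset.mem_filter, not_le, Nat.succ_le_iff]
  rw [h]
  exact Finset.card_filter_add_card_filter_not _

theorem preferred_iff (x : State (2 * (n + 1)) (n + 1)) :
    Preferred x.1 ↔ height x.1 3 ≤ n ∧ n ≤ height x.1 2 := by
  have h0 : height x.1 0 = n + 1 := (height_zero _).trans x.2
  have hl := card_loc_add_height x.1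
  rw [x.2] at hl
  have s0 := height_step x.1 0
  have s1 := height_step x.1 1
  have s2 := height_step x.1 2
  have v1 : ((1 : Fin (2 * (n + 1) + 1)) : ℕ) = 1 := by
    rw [Fin.val_one', Nat.mod_eq_of_lt (by omega)]
  have m0 : (0 : Fin (2 * (n + 1) + 1)) ∈ x.1 ↔ height x.1 0 = height x.1 1 + 1 :=
    mem_iff_height _ _
  have m1 : (1 : Fin (2 * (n + 1) + 1)) ∈ x.1 ↔ height x.1 1 = height x.1 2 + 1 := by
    rw [mem_iff_height, v1]
  simp only [zero_add, Nat.reduceAdd] at s0 s1 s2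
  have h01 : (0 : Fin (2 * (n + 1) + 1)) ≠ 1 := by
    rw [Ne, Fin.ext_iff, v1]; simp
  constructor
  · rintro ⟨h1, h2, h3⟩
    refine ⟨by omega, ?_⟩
    by_contra h4
    refine h3 (Finset.eq_of_subset_of_card_le ?_ ?_).symm
    · intro j hj
      rw [Finset.mem_insert, Finset.mem_singleton] at hj
      rcases hj with rfl | rfl
      · exact Finset.mem_filter.2 ⟨m0.2 (by omega), by simp⟩
      · exact Finset.mem_filter.2 ⟨m1.2 (by omega), by rw [v1]; omega⟩
    · rw [Finset.card_pair h01]; exact h2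
  · rintro ⟨h1, h2⟩
    refine ⟨by omega, by omega, fun h3 => ?_⟩
    have a0 : (0 : Fin (2 * (n + 1) + 1)) ∈ loc x.1 := by rw [h3]; simp
    have a1 : (1 : Fin (2 * (n + 1) + 1)) ∈ loc x.1 := by rw [h3]; simp
    have b0 := m0.1 (Finset.mem_filter.1 a0).1
    have b1 := m1.1 (Finset.mem_filter.1 a1).1
    omega

theorem height_psi (x : Finset (Fin (2 * (n + 1) + 1))) (i : ℕ) :
    height (psi x) (i + 1) = height x (i + 3) := by
  refine Finset.card_nbij' (fun i => (⟨i.val + 2, by omega⟩ : Fin (2 * (n + 1) + 1)))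
    (fun j => (⟨j.val - 2, by omega⟩ : Fin (2 * n + 1))) ?_ ?_ ?_ ?_
  · intro j hj
    simp only [psi, Finset.coe_filter, Finset.mem_filter, Finset.mem_univ, true_and,
      Set.mem_ofPred_eq] at hj ⊢
    rcases hj with ⟨hj | hj, h0⟩
    · omega
    · exact ⟨hj.2, by omega⟩
  · intro j hj
    simp only [psi, Finset.coe_filter, Finset.mem_filter, Finset.mem_univ, true_and,
      Set.mem_ofPred_eq] at hj ⊢
    refine ⟨Or.inr ⟨by omega, ?_⟩, by omega⟩
    convert hj.1
    omega
  · intro i _; ext; simp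
  · intro j hj
    simp only [Finset.coe_filter, Set.mem_ofPred_eq] at hj
    ext; simp only; omega

/-- The idempotent state `ψ(x)`. -/
def psiState (x : State (2 * (n + 1)) (n + 1)) (hx : Preferred x.1) : State (2 * n) n :=
  ⟨psi x.1, card_psi _ x.2 hx⟩

theorem gap_psi (x y : Finset (Fin (2 * (n + 1) + 1))) (i : ℕ) :
    gap (psi x) (psi y) (i + 1) = gap x y (i + 3) := by
  simp only [gap, height_psi]

theorem Admissible.psi {x y : Finset (Fin (2 * (n + 1) + 1))} {d : Fin (2 * (n + 1)) → ℕ}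
    (h : Admissible x y d) : Admissible (psi x) (psi y) fun i => d (shift i) := by
  rw [admissible_iff] at h ⊢
  intro i
  rw [gap_psi, height_psi, height_psi]
  exact h (shift i)

/-- The pure element whose class is `Ψ(b)`, for `b` between preferred idempotent states. -/
def psiPure (b : Pure (2 * (n + 1)) (n + 1)) (hs : Preferred b.src.1) (ht : Preferred b.tgt.1) :
    Pure (2 * n) n :=
  ⟨psiState b.src hs, psiState b.tgt ht, fun i => b.dwt (shift i), b.adm.psi⟩

/-- The doubled weight at the strand `1`. -/
def Pure.dwt1 (b : Pure (2 * (n + 1)) (n + 1)) : ℕ := b.dwt (strand1 n)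

/-- The doubled weight at the strand `2`. -/
def Pure.dwt2 (b : Pure (2 * (n + 1)) (n + 1)) : ℕ := b.dwt (strand2 n)

/-- The pure elements `b` that appear in the diagrams as the single input of an arrow. With the
initial state `x` of `b`, excluded are elements with two positive weights at the strands `1` and
`2`, the multiples of `U_2` with `0 ∈ x`, and the multiples of `U_1` with `0, 1 ∉ x`. -/
def Pure.Allowed (b : Pure (2 * (n + 1)) (n + 1)) : Prop :=
  (b.dwt1 = 0 ∨ b.dwt2 = 0) ∧ (b.dwt1 = 0 → 0 < b.dwt2 → height b.src.1 1 = n + 1) ∧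
    (b.dwt2 = 0 → 0 < b.dwt1 → height b.src.1 2 = n)

theorem Preferred.heights {x : State (2 * (n + 1)) (n + 1)} (hx : Preferred x.1) :
    n ≤ height x.1 2 ∧ height x.1 2 ≤ height x.1 1 ∧ height x.1 1 ≤ n + 1 ∧ height x.1 3 ≤ n ∧
      height x.1 2 ≤ height x.1 3 + 1 ∧ height x.1 3 ≤ height x.1 2 := by
  have h0 : height x.1 0 = n + 1 := (height_zero _).trans x.2
  have h := (preferred_iff x).1 hx
  have s0 := height_step x.1 0
  have s1 := height_step x.1 1
  have s2 := height_step x.1 2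
  simp only [zero_add, Nat.reduceAdd] at s0 s1 s2
  omega

/-- A state of `B(n)` that is obtained from the state `s` of `B(n+1)` by forgetting the strands `1`
and `2`, where the heights are truncated if all elements of `s` lie beyond these strands. -/
theorem exists_truncation (s : State (2 * (n + 1)) (n + 1)) (h : n ≤ height s.1 3 + 1) :
    ∃ t : State (2 * n) n, height t.1 0 = n ∧
      ∀ i, height t.1 (i + 1) = min (height s.1 (i + 3)) n := by
  obtain ⟨t, ht⟩ := (show IsHeight (2 * n) n (fun i => if i = 0 then n else
      min (height s.1 (i + 2)) n) from
    { zero := if_pos rfl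
      top := by
        rw [if_neg (by omega), height_eq_zero _ (by omega), Nat.zero_min]
      step := fun i _ => by
        have := height_step s.1 (i + 2)
        simp only [add_assoc, Nat.reduceAdd] at this
        rw [if_neg (by omega)]
        simp only [add_assoc, Nat.reduceAdd]
        split_ifs with hi
        · subst hi; simp only [zero_add]; omega
        · omega }).exists_state
  refine ⟨t, (height_zero _).trans t.2, fun i => ?_⟩
  by_cases hi : i + 1 ≤ 2 * n + 1
  · rw [ht _ hi, if_neg (by omega)]
  · rw [height_eq_zero _ (by omega), height_eq_zero _ (by omega), Nat.zero_min]

theorem height_le_of_preferred {x : State (2 * (n + 1)) (n + 1)} (hx : Preferred x.1) (j : ℕ) :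
    height x.1 (j + 3) ≤ n :=
  (Finset.card_le_card fun a ha => by
    rw [Finset.mem_filter] at ha ⊢; exact ⟨ha.1, by omega⟩ :
      height x.1 (j + 3) ≤ height x.1 3).trans hx.heights.2.2.2.1

/-- Truncation at a bound for the heights of `x` and `y` does not lengthen a path from `x` to
`y`. -/
theorem gap_truncation_add_le {N N' : ℕ} {x y s : Finset (Fin N)} {x' y' t : Finset (Fin N')}
    {a b c : ℕ} (hx : height x' a = height x b) (hy : height y' a = height y b)
    (ht : height t a = min (height s b) c) (h1 : height x b ≤ c) (h2 : height y b ≤ c) :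
    gap x' t a + gap t y' a ≤ gap x s b + gap s y b := by
  unfold gap
  rw [hx, hy, ht]
  omega

theorem flat_of_truncation {x y s : State (2 * (n + 1)) (n + 1)} (hx : Preferred x.1)
    (hy : Preferred y.1) {d : Fin (2 * (n + 1)) → ℕ} {t : State (2 * n) n}
    (h1 : ∀ i, height t.1 (i + 1) = min (height s.1 (i + 3)) n) (i : Fin (2 * n))
    (h2 : i.castSucc ∉ t.1) (h3 : i.succ ∉ t.1)
    (hd : ∀ j : Fin (2 * n), gap x.1 s.1 (j.val + 3) + gap s.1 y.1 (j.val + 3) ≤ d (shift j))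
    (hi : gap (psi x.1) t.1 (i.val + 1) + 2 + gap t.1 (psi y.1) (i.val + 1) ≤ d (shift i)) :
    Flat (psiState x hx) (psiState y hy) (fun i => d (shift i)) t i := by
  refine ⟨h2, h3, fun j => ?_⟩
  by_cases hj : j = i
  · rw [if_pos hj, hj]; exact hi
  · rw [if_neg hj]
    exact le_trans (gap_truncation_add_le (height_psi _ _) (height_psi _ _) (h1 _)
      (height_le_of_preferred hx j.val) (height_le_of_preferred hy j.val)) (hd j)

/-- A path through a state `s` without elements in `{0, 1, 2}` becomes, after truncation, a path
with a full turn at the first strand: there the height of `s` exceeds those of `x` and `y`, and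
truncation saves a doubled weight of `2`. -/
theorem exists_flat_of_far {x y s : State (2 * (n + 1)) (n + 1)} (hx : Preferred x.1)
    (hy : Preferred y.1) {d : Fin (2 * (n + 1)) → ℕ} (hs : height s.1 3 = n + 1)
    (hd : ∀ j : Fin (2 * n), gap x.1 s.1 (j.val + 3) + gap s.1 y.1 (j.val + 3) ≤ d (shift j)) :
    ∃ t i, Flat (psiState x hx) (psiState y hy) (fun i => d (shift i)) t i := by
  have hn : 0 < n := by
    by_contra hn
    rw [height_eq_zero _ (by omega)] at hs
    omega
  obtain ⟨t, ht0, ht⟩ := exists_truncation s (by omega)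
  have t1 : height t.1 1 = n := by have := ht 0; simp only [zero_add] at this; omega
  have t2 : height t.1 2 = n := by
    have := height_step s.1 3
    simp only [Nat.reduceAdd] at this
    have := ht 1
    simp only [Nat.reduceAdd] at this
    omega
  refine ⟨t, ⟨0, by omega⟩, flat_of_truncation hx hy ht _ ?_ ?_ hd ?_⟩
  · rw [not_mem_iff_height]
    exact ht0.trans t1.symm
  · rw [not_mem_iff_height]
    exact t1.trans t2.symm
  · refine le_trans ?_ (hd ⟨0, by omega⟩)
    have b1 := height_le_of_preferred hx 0
    have b2 := height_le_of_preferred hy 0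
    simp only [zero_add] at b1 b2
    simp only [gap, zero_add, height_psi, hs, t1]
    omega

theorem height_eq_of_gap_eq_zero {N : ℕ} {x y : Finset (Fin N)} {i : ℕ} (h : gap x y i = 0) :
    height x i = height y i := by
  unfold gap at h; omega

/-- The path of an allowed element does not pass through a state that contains both `0` and `1`. -/
theorem le_height_two_of_path {b : Pure (2 * (n + 1)) (n + 1)} (hs : Preferred b.src.1)
    (ht : Preferred b.tgt.1) (hb : b.Allowed) {s : State (2 * (n + 1)) (n + 1)}
    (h1 : gap b.src.1 s.1 1 + gap s.1 b.tgt.1 1 ≤ b.dwt1)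
    (h2 : gap b.src.1 s.1 2 + gap s.1 b.tgt.1 2 ≤ b.dwt2) : n ≤ height s.1 2 := by
  obtain ⟨h3, h4, h5⟩ := hb
  have hx := hs.heights
  have hy := ht.heights
  have s0 := height_step s.1 1
  simp only [Nat.reduceAdd] at s0
  unfold gap at h1 h2
  omega

/-- The map `Ψ` is compatible with the relations of the algebras on the elements that appear in the
diagrams. -/
theorem psiPure_inJ {b : Pure (2 * (n + 1)) (n + 1)} (hs : Preferred b.src.1)
    (ht : Preferred b.tgt.1) (hb : b.Allowed) (h : b.InJ) : (psiPure b hs ht).InJ := by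
  have hx := hs.heights
  have hy := ht.heights
  rcases h.flat_or_tooFar with ⟨s, i, f1, f2, f3⟩ | ⟨i, j, hij, h⟩
  · have hd : ∀ j : Fin (2 * (n + 1)),
        gap b.src.1 s.1 (j.val + 1) + gap s.1 b.tgt.1 (j.val + 1) ≤ b.dwt j := fun j => by
      have := f3 j; omega
    have d1 : gap b.src.1 s.1 1 + gap s.1 b.tgt.1 1 ≤ b.dwt1 := hd (strand1 n)
    have d2 : gap b.src.1 s.1 2 + gap s.1 b.tgt.1 2 ≤ b.dwt2 := hd (strand2 n)
    have s2 := le_height_two_of_path hs ht hb d1 d2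
    have s0 : height s.1 0 = n + 1 := (height_zero _).trans s.2
    have st2 := height_step s.1 2
    simp only [Nat.reduceAdd] at st2
    rw [not_mem_iff_height] at f1 f2
    rw [Fin.val_castSucc] at f1
    rw [Fin.val_succ] at f2
    have fi := f3 i
    rw [if_pos rfl] at fi
    obtain ⟨h3, h4, h5⟩ := hb
    have hi : i = strand1 n ∨ i = strand2 n ∨ ∃ i', i = shift i' := by
      by_cases h0 : i.val = 0
      · exact Or.inl (Fin.ext h0)
      by_cases h1 : i.val = 1
      · exact Or.inr (Or.inl (Fin.ext h1))
      · exact Or.inr (Or.inr ⟨⟨i.val - 2, by omega⟩, Fin.ext (by simp only [shift]; omega)⟩)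
    rcases hi with rfl | rfl | ⟨i, rfl⟩
    · -- `0, 1 ∉ s`, and the weight at the strand `1` is positive, so that the one at the strand `2`
      -- is zero; then `s` and the initial state agree at the strand `2`, and `b` is not allowed
      simp only [strand1, zero_add, Nat.reduceAdd] at f1 f2 fi
      change _ ≤ b.dwt1 at fi
      have := height_eq_of_gap_eq_zero (show gap b.src.1 s.1 2 = 0 by omega)
      omega
    · -- the weight at the strand `2` is positive, so that the one at the strand `1` is zero and
      -- `0` is in neither the initial state nor `s`; since `1, 2 ∉ s`, the state `s` is far to the
      -- right
      simp only [strand2, Nat.reduceAdd] at f1 f2 fi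
      change _ ≤ b.dwt2 at fi
      have s3 : height s.1 3 = n + 1 := by
        have := height_eq_of_gap_eq_zero (show gap b.src.1 s.1 1 = 0 by omega)
        omega
      obtain ⟨t, i, h⟩ := exists_flat_of_far (d := b.dwt) hs ht s3 fun j => hd (shift j)
      exact Flat.inJ (p := psiPure b hs ht) h
    · obtain ⟨t, ht0, ht1⟩ := exists_truncation s (by omega)
      change height s.1 (i.val + 2) = height s.1 (i.val + 3) at f1
      change height s.1 (i.val + 3) = height s.1 (i.val + 4) at f2
      suffices h : Flat (psiState b.src hs) (psiState b.tgt ht) (fun i => b.dwt (shift i)) t i from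
        Flat.inJ (p := psiPure b hs ht) h
      refine flat_of_truncation hs ht ht1 i ?_ ?_ (fun j => hd (shift j)) ?_
      · rw [not_mem_iff_height, Fin.val_castSucc, ht1, ← f1]
        rcases Nat.eq_zero_or_pos i.val with h0 | h0
        · rw [h0, ht0, zero_add]; omega
        · obtain ⟨a, ha⟩ : ∃ a, i.val = a + 1 := ⟨i.val - 1, by omega⟩
          rw [ha, ht1]
      · rw [not_mem_iff_height, Fin.val_succ, ht1, ht1, f2]
      · have key := gap_truncation_add_le (height_psi b.src.1 i.val) (height_psi b.tgt.1 i.val)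
          (ht1 i.val) (height_le_of_preferred hs i.val) (height_le_of_preferred ht i.val)
        change gap b.src.1 s.1 (i.val + 3) + 2 + gap s.1 b.tgt.1 (i.val + 3) ≤ _ at fi
        clear f1 f2 f3 hd d1 d2 h3 h4 h5
        omega
  · have g1 : gap b.src.1 b.tgt.1 1 ≤ b.dwt1 := b.gap_le (strand1 n)
    have g2 : gap b.src.1 b.tgt.1 2 ≤ b.dwt2 := b.gap_le (strand2 n)
    obtain ⟨h3, h4, h5⟩ := hb
    have hi : 2 ≤ i.val := by
      by_contra hi
      unfold gap at g1 g2
      rcases (by omega : i.val = 0 ∨ i.val = 1) with h0 | h0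
      · simp only [h0, zero_add] at h; omega
      · simp only [h0, Nat.reduceAdd] at h; omega
    obtain ⟨a, ha⟩ : ∃ a, i.val = a + 2 := ⟨i.val - 2, by omega⟩
    have hj := j.isLt
    refine Pure.inJ_of_tooFar (i := ⟨a, by omega⟩) (j := ⟨a + 1, by omega⟩) rfl ?_
    simp only [psiPure, psiState, height_psi]
    rw [ha] at h
    exact h

/-- If the path along an allowed product `p q` passes through a state that is not preferred, then
`Ψ(p q) = 0`. The state then has no element in `{0, 1, 2}`. -/
theorem psiPure_mul_inJ {p q : Pure (2 * (n + 1)) (n + 1)} (h : p.tgt = q.src)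
    (hs : Preferred (p.mul q h).src.1) (ht : Preferred (p.mul q h).tgt.1)
    (hb : (p.mul q h).Allowed) (hm : ¬ Preferred p.tgt.1) :
    (psiPure (p.mul q h) hs ht).InJ := by
  have hx := hs.heights
  have hy := ht.heights
  have hd : ∀ j : Fin (2 * (n + 1)), gap (p.mul q h).src.1 p.tgt.1 (j.val + 1) +
      gap p.tgt.1 (p.mul q h).tgt.1 (j.val + 1) ≤ (p.mul q h).dwt j := fun j => by
    have h1 := p.gap_le j
    have h2 := q.gap_le j
    rw [← h] at h2
    exact Nat.add_le_add h1 h2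
  have d2 := le_height_two_of_path hs ht hb (hd (strand1 n)) (hd (strand2 n))
  rw [preferred_iff] at hm
  have s0 : height p.tgt.1 0 = n + 1 := (height_zero _).trans p.tgt.2
  have a0 := height_step p.tgt.1 0
  have a1 := height_step p.tgt.1 1
  have a2 := height_step p.tgt.1 2
  simp only [zero_add, Nat.reduceAdd] at a0 a1 a2
  obtain ⟨t, i, h⟩ := exists_flat_of_far (d := (p.mul q h).dwt) hs ht (s := p.tgt) (by omega)
    fun j => hd (shift j)
  exact Flat.inJ (p := psiPure _ hs ht) h

end Local

/-! ### Multilinear extensions -/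

section Multilinear

variable {m k : ℕ} {E : Type} [AddCommGroup E] [Module (ZMod 2) E]

theorem multilinearExt_cons (f : List (Pure m k) → E) (a : Blg m k) (l : List (Blg m k)) :
    multilinearExt f (a :: l) =
      a.coeffs.sum fun p c => c • multilinearExt (fun ps => f (p.1 :: ps)) l := rfl

theorem multilinearExt_add (f : List (Pure m k) → E) (u : List (Blg m k)) (a b : Blg m k)
    (v : List (Blg m k)) : multilinearExt f (u ++ (a + b) :: v) =
      multilinearExt f (u ++ a :: v) + multilinearExt f (u ++ b :: v) := by
  induction u generalizing f with
  | nil =>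
    simp only [List.nil_append, multilinearExt_cons]
    exact Finsupp.sum_add_index' (fun _ => zero_smul (ZMod 2) _)
      (fun _ _ _ => add_smul _ _ _)
  | cons c u ih =>
    simp only [List.cons_append, multilinearExt_cons, ih, smul_add]
    exact Finsupp.sum_add

theorem multilinearExt_smul (f : List (Pure m k) → E) (u : List (Blg m k)) (c : ZMod 2)
    (a : Blg m k) (v : List (Blg m k)) :
    multilinearExt f (u ++ (c • a) :: v) = c • multilinearExt f (u ++ a :: v) := by
  induction u generalizing f with
  | nil =>
    simp only [List.nil_append, multilinearExt_cons]
    refine (Finsupp.sum_smul_index (M := E) (g := a.coeffs) (b := c)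
      (h := fun (p : {p : Pure m k // ¬ p.InJ}) c =>
        c • multilinearExt (fun ps => f (p.1 :: ps)) v)
      (fun _ => zero_smul (ZMod 2) _)).trans ?_
    rw [Finsupp.smul_sum]
    simp only [mul_smul]
  | cons b u ih =>
    simp only [List.cons_append, multilinearExt_cons, ih]
    rw [Finsupp.smul_sum]
    exact Finsupp.sum_congr fun _ _ => smul_comm _ _ _

theorem multilinearExt_ofPure_cons (f : List (Pure m k) → E) {p : Pure m k} (hp : ¬ p.InJ)
    (l : List (Blg m k)) : multilinearExt f (Blg.ofPure p :: l) =
      multilinearExt (fun ps => f (p :: ps)) l := by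
  rw [multilinearExt_cons, Blg.ofPure_of_not p hp]
  refine (Finsupp.sum_single_index
    (h := fun (p : {p : Pure m k // ¬ p.InJ}) c =>
      c • multilinearExt (fun ps => f (p.1 :: ps)) l) ?_).trans ?_
  · exact zero_smul (ZMod 2) _
  · exact one_smul (ZMod 2) _

theorem multilinearExt_zero_cons (f : List (Pure m k) → E) (l : List (Blg m k)) :
    multilinearExt f (0 :: l) = 0 := by
  rw [multilinearExt_cons]
  exact Finsupp.sum_zero_index

theorem multilinearExt_eq_zero (f : List (Pure m k) → E) (l : List (Blg m k))
    (h : ∀ ps, ps.length = l.length → f ps = 0) : multilinearExt f l = 0 := by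
  induction l generalizing f with
  | nil => exact h [] rfl
  | cons a l ih =>
    rw [multilinearExt_cons]
    refine Finset.sum_eq_zero fun p _ => ?_
    simp only
    rw [ih _ fun ps hps => h _ (by simp [hps]), smul_zero]

theorem map_multilinearExt {E' : Type} [AddCommGroup E'] [Module (ZMod 2) E'] (φ : E →+ E')
    (f : List (Pure m k) → E) (l : List (Blg m k)) :
    φ (multilinearExt f l) = multilinearExt (fun ps => φ (f ps)) l := by
  induction l generalizing f with
  | nil => rfl
  | cons a l ih =>
    rw [multilinearExt_cons, multilinearExt_cons, map_finsuppSum]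
    refine Finsupp.sum_congr fun p _ => ?_
    rw [← ih]
    exact ZMod.map_smul φ _ _

end Multilinear

/-! ### The generators and the terms of the operations -/

section Terms

variable {n : ℕ}

/-- The types `Y_0`, `Y_1`, `Y_2`. -/
def Ty.IsY : Ty → Bool
  | .X0 | .X1 | .X2 => false
  | .Y0 | .Y1 | .Y2 => true

/-- The grading of the types for which an arrow with the coefficient `w^p z^q` from `s` to `t` has
inputs of doubled total weight `2 p + t.wdeg - s.wdeg` at the strand `1`. -/
def Ty.wdeg : Ty → ℕ
  | .X0 => 1
  | .X1 => 0
  | .X2 => 0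
  | .Y0 => 1
  | .Y1 => 2
  | .Y2 => 2

/-- The grading of the types that corresponds to the strand `2` and the variable `z`. -/
def Ty.zdeg : Ty → ℕ
  | .X0 => 0
  | .X1 => 0
  | .X2 => 1
  | .Y0 => 2
  | .Y1 => 2
  | .Y2 => 1

theorem Gen.preferred (x : Gen n) : Preferred x.rgt.1 := x.2.1

theorem height_eq_of_min {m k : ℕ} (x : State m k) {i : ℕ} (h : ∀ j ∈ x.1, i ≤ j.val) (l : ℕ)
    (hl : l ≤ i) : height x.1 l = k := by
  refine Eq.trans (congrArg Finset.card ?_) x.2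
  exact Finset.filter_true_of_mem fun j hj => hl.trans (h j hj)

/-- The height at the strand `1` of a right idempotent state, relative to `n`. -/
def Ty.rise1 : Ty → ℕ
  | .X0 | .Y0 => 0
  | .X1 | .X2 | .Y1 | .Y2 => 1

/-- The height at the strand `2` of a right idempotent state, relative to `n`. -/
def Ty.rise2 : Ty → ℕ
  | .X0 | .X1 | .Y0 | .Y1 => 0
  | .X2 | .Y2 => 1

theorem Gen.heights (x : Gen n) :
    height x.rgt.1 1 = n + x.ty.rise1 ∧ height x.rgt.1 2 = n + x.ty.rise2 := by
  obtain ⟨⟨t, s⟩, h1, ⟨j, h2, h3⟩, h4⟩ := x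
  change height s.1 1 = n + t.rise1 ∧ height s.1 2 = n + t.rise2
  have h6 := h1.heights
  have h7 := height_eq_of_min s h4
  simp only at h2 h3 h4 h6 h7
  have h5 := (mem_iff_height s.1 j).1 h2
  have h0 := height_zero s.1
  rw [s.2] at h0
  rw [h3] at h5
  have c0 : t.index = 0 → height s.1 1 = n ∧ height s.1 2 = n := fun h => by
    rw [h, zero_add] at h5; omega
  have c1 : t.index = 1 → height s.1 1 = n + 1 ∧ height s.1 2 = n := fun h => by
    rw [h] at h5 h7; have := h7 1 le_rfl; simp only [Nat.reduceAdd] at h5; omega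
  have c2 : t.index = 2 → height s.1 1 = n + 1 ∧ height s.1 2 = n + 1 := fun h => by
    rw [h] at h7; exact ⟨h7 1 (by omega), h7 2 le_rfl⟩
  cases t
  exacts [c0 rfl, c1 rfl, c2 rfl, c0 rfl, c1 rfl, c2 rfl]

theorem Gen.ext {x y : Gen n} (h1 : x.ty.IsY = y.ty.IsY) (h2 : x.rgt = y.rgt) : x = y := by
  obtain ⟨hx, hx'⟩ := x.heights
  obtain ⟨hy, hy'⟩ := y.heights
  rw [h2] at hx hx'
  have h3 : x.ty = y.ty := by
    have e1 : x.ty.rise1 = y.ty.rise1 := by omega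
    have e2 : x.ty.rise2 = y.ty.rise2 := by omega
    revert h1 e1 e2
    generalize x.ty = s
    generalize y.ty = t
    cases s <;> cases t <;> simp [Ty.IsY, Ty.rise1, Ty.rise2]
  exact Subtype.ext (Prod.ext h3 h2)

/-- Each preferred state is the right idempotent state of one generator in `X_0 ⊕ X_1 ⊕ X_2`, and of
one in `Y_0 ⊕ Y_1 ⊕ Y_2`. -/
theorem exists_gen (s : State (2 * (n + 1)) (n + 1)) (hs : Preferred s.1) (Y : Bool) :
    ∃ g : Gen n, g.ty.IsY = Y ∧ g.rgt = s := by
  obtain ⟨h1, h2, h3, h4, h5, h6⟩ := hs.heights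
  have h0 : height s.1 0 = n + 1 := (height_zero _).trans s.2
  have key : ∀ (j : Fin (2 * (n + 1) + 1)), height s.1 j.val = n + 1 →
      height s.1 (j.val + 1) = n → j ∈ s.1 ∧ ∀ i ∈ s.1, j.val ≤ i.val := by
    intro j a1 a2
    refine ⟨(mem_iff_height _ _).2 (by omega), fun i hi => ?_⟩
    by_contra hlt
    have b1 := (mem_iff_height _ _).1 hi
    have b2 : height s.1 j.val ≤ height s.1 (i.val + 1) := Finset.card_le_card fun a ha => by
      rw [Finset.mem_filter] at ha ⊢; exact ⟨ha.1, by omega⟩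
    have b3 : height s.1 i.val ≤ n + 1 :=
      (Finset.card_filter_le _ _).trans s.2.le
    omega
  have mk : ∀ (t : Ty) (j : Fin (2 * (n + 1) + 1)), j.val = t.index → height s.1 j.val = n + 1 →
      height s.1 (j.val + 1) = n → t.IsY = Y → ∃ g : Gen n, g.ty.IsY = Y ∧ g.rgt = s := by
    intro t j hj a1 a2 ht
    obtain ⟨b1, b2⟩ := key j a1 a2
    exact ⟨⟨(t, s), hs, ⟨j, b1, hj⟩, fun i hi => hj ▸ b2 i hi⟩, ht, rfl⟩
  rcases (by omega : height s.1 1 = n ∨ height s.1 1 = n + 1) with c1 | c1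
  · cases Y
    · exact mk .X0 ⟨0, by omega⟩ rfl h0 c1 rfl
    · exact mk .Y0 ⟨0, by omega⟩ rfl h0 c1 rfl
  rcases (by omega : height s.1 2 = n ∨ height s.1 2 = n + 1) with c2 | c2
  · cases Y
    · exact mk .X1 ⟨1, by omega⟩ rfl c1 c2 rfl
    · exact mk .Y1 ⟨1, by omega⟩ rfl c1 c2 rfl
  · have c3 : height s.1 3 = n := by omega
    cases Y
    · exact mk .X2 ⟨2, by omega⟩ rfl c2 c3 rfl
    · exact mk .Y2 ⟨2, by omega⟩ rfl c2 c3 rfl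

theorem Blg.elt_eq {m k : ℕ} {x y : Finset (Fin (m + 1))} {d : Fin m → ℕ} (hx : x.card = k)
    (hy : y.card = k) (h : Admissible x y d) :
    Blg.elt m k x y d = Blg.ofPure ⟨⟨x, hx⟩, ⟨y, hy⟩, d, h⟩ := dif_pos ⟨hx, hy, h⟩

theorem Blg.elt_mul {m k : ℕ} {x y z : Finset (Fin (m + 1))} {d e : Fin m → ℕ} (hx : x.card = k)
    (hy : y.card = k) (hz : z.card = k) (h1 : Admissible x y d) (h2 : Admissible y z e) :
    Blg.elt m k x y d * Blg.elt m k y z e = Blg.elt m k x z (d + e) := by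
  rw [Blg.elt_eq hx hy h1, Blg.elt_eq hy hz h2, Blg.ofPure_mul_of_eq _ _ rfl, Blg.elt_eq hx hz]
  rfl

theorem Blg.idem_eq_elt {m k : ℕ} (x : State m k) : Blg.idem x = Blg.elt m k x.1 x.1 0 := by
  exact (Blg.elt_eq x.2 x.2 (Pure.idem x).adm).symm

/-- The only possible nonzero coefficient of `y` in the value of an operation at `x`, on pure inputs
of total doubled weight `d`. The exponents of `w` and `z` are determined by the gradings. -/
def term (x : Gen n) (d : Fin (2 * (n + 1)) → ℕ) (y : Gen n) : BAlgWZ n :=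
  monomial ((d (strand1 n) + x.ty.wdeg - y.ty.wdeg) / 2)
    (monomial ((d (strand2 n) + x.ty.zdeg - y.ty.zdeg) / 2)
      (Blg.elt (2 * n) n (psi x.rgt.1) (psi y.rgt.1) fun i => d (shift i)))

/-- The gradings are compatible with an arrow from `x` to `y` whose inputs have the total doubled
weight `d`. -/
structure Graded (x : Gen n) (d : Fin (2 * (n + 1)) → ℕ) (y : Gen n) : Prop where
  adm : Admissible x.rgt.1 y.rgt.1 d
  w_le : y.ty.wdeg ≤ d (strand1 n) + x.ty.wdeg
  w_even : Even (d (strand1 n) + x.ty.wdeg + y.ty.wdeg)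
  z_le : y.ty.zdeg ≤ d (strand2 n) + x.ty.zdeg
  z_even : Even (d (strand2 n) + x.ty.zdeg + y.ty.zdeg)

theorem Graded.term_mul {x g y : Gen n} {d e : Fin (2 * (n + 1)) → ℕ} (h1 : Graded x d g)
    (h2 : Graded g e y) : term x d g * term g e y = term x (d + e) y := by
  obtain ⟨a1, a2, a3, a4, a5⟩ := h1
  obtain ⟨b1, b2, b3, b4, b5⟩ := h2
  rw [Nat.even_iff] at a3 a5 b3 b5
  rw [term, term, term, monomial_mul_monomial, monomial_mul_monomial,
    Blg.elt_mul (card_psi _ x.rgt.2 x.preferred) (card_psi _ g.rgt.2 g.preferred)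
      (card_psi _ y.rgt.2 y.preferred) a1.psi b1.psi]
  congr 2
  · simp only [Pi.add_apply]; omega
  · congr 1
    simp only [Pi.add_apply]; omega

theorem term_eq_zero {x y : Gen n} {b : Pure (2 * (n + 1)) (n + 1)} (hx : b.src = x.rgt)
    (hy : b.tgt = y.rgt) (h : ∀ hs ht, (psiPure b hs ht).InJ) : term x b.dwt y = 0 := by
  have hs : Preferred b.src.1 := hx ▸ x.preferred
  have ht : Preferred b.tgt.1 := hy ▸ y.preferred
  have : Blg.elt (2 * n) n (psi x.rgt.1) (psi y.rgt.1) (fun i => b.dwt (shift i)) = 0 := by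
    rw [← hx, ← hy]
    exact (Blg.elt_eq (card_psi _ b.src.2 hs) (card_psi _ b.tgt.2 ht) b.adm.psi).trans
      (Blg.ofPure_of_inJ _ (h hs ht))
  rw [term, this, map_zero, map_zero]

theorem add_self_eq_zero {E : Type} [AddCommGroup E] [Module (ZMod 2) E] (a : E) : a + a = 0 := by
  have : ((1 : ZMod 2) + 1) • a = 0 := by
    rw [show (1 : ZMod 2) + 1 = 0 from rfl, zero_smul]
  rwa [add_smul, one_smul] at this

end Terms

/-! ### The arrows of the diagram -/

section Arrows

variable {n : ℕ}

/-- The meaning of a label for a pure element with the doubled weights `d₁`, `d₂` at the strands `1`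
and `2`, and with initial and terminal states of height `s₁`, `s₂` and `t₁`, `t₂` there. -/
def Letter.Spec (d₁ d₂ s₁ t₁ s₂ t₂ : ℕ) : Letter → Prop
  | .one => d₁ = 0 ∧ d₂ = 0
  | .U1 k => d₁ = 2 * k + 2 ∧ d₂ = 0
  | .U2 l => d₁ = 0 ∧ d₂ = 2 * l + 2
  | .L1 k => d₁ = 2 * k + 1 ∧ d₂ = 0 ∧ t₁ ≤ s₁
  | .L2 l => d₁ = 0 ∧ d₂ = 2 * l + 1 ∧ t₂ ≤ s₂
  | .R1 k => d₁ = 2 * k + 1 ∧ d₂ = 0 ∧ s₁ < t₁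
  | .R2 l => d₁ = 0 ∧ d₂ = 2 * l + 1 ∧ s₂ < t₂

theorem letter_eq_some_iff (b : Pure (2 * (n + 1)) (n + 1)) (a : Letter) :
    letter b = some a ↔ a.Spec b.dwt1 b.dwt2 (height b.src.1 1) (height b.tgt.1 1)
      (height b.src.1 2) (height b.tgt.1 2) := by
  have e1 : level b.src.1 (strand1 n) = height b.src.1 1 := rfl
  have e2 : level b.tgt.1 (strand1 n) = height b.tgt.1 1 := rfl
  have e3 : level b.src.1 (strand2 n) = height b.src.1 2 := rfl
  have e4 : level b.tgt.1 (strand2 n) = height b.tgt.1 2 := rfl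
  have e5 : b.dwt (strand1 n) = b.dwt1 := rfl
  have e6 : b.dwt (strand2 n) = b.dwt2 := rfl
  simp only [letter, e1, e2, e3, e4, e5, e6]
  cases a <;> simp only [Letter.Spec] <;> split_ifs <;>
    simp only [Option.some.injEq, reduceCtorEq, Letter.U1.injEq, Letter.U2.injEq, Letter.L1.injEq,
      Letter.L2.injEq, Letter.R1.injEq, Letter.R2.injEq, true_iff, false_iff] <;> omega

/-- The constraints on a pure element at the strands `1` and `2`. -/
theorem Pure.constraints (b : Pure (2 * (n + 1)) (n + 1)) :
    (height b.src.1 1 ≤ height b.tgt.1 1 + b.dwt1 ∧ height b.tgt.1 1 ≤ height b.src.1 1 + b.dwt1 ∧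
      (height b.src.1 1 + height b.tgt.1 1 + b.dwt1) % 2 = 0) ∧
    (height b.src.1 2 ≤ height b.tgt.1 2 + b.dwt2 ∧ height b.tgt.1 2 ≤ height b.src.1 2 + b.dwt2 ∧
      (height b.src.1 2 + height b.tgt.1 2 + b.dwt2) % 2 = 0) := by
  have h1 := b.adm (strand1 n)
  have h2 := b.adm (strand2 n)
  rw [Nat.even_iff] at h1 h2
  exact ⟨h1, h2⟩

/-- There is an arrow from `x` to `y` with the single input `p`. -/
structure Step (x : Gen n) (p : Pure (2 * (n + 1)) (n + 1)) (y : Gen n) : Prop where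
  sheet : x.ty.IsY = y.ty.IsY
  src : p.src = x.rgt
  tgt : p.tgt = y.rgt
  allowed : p.Allowed

/-- The path along `p` and `q` stops at a state whose smallest element is `1`, after `p` has met
only the strand on one side of `1` and before `q` meets only the strand on the other side. -/
def Turn (p q : Pure (2 * (n + 1)) (n + 1)) : Prop :=
  height p.tgt.1 1 = n + 1 ∧ height p.tgt.1 2 = n ∧
    (0 < p.dwt1 ∧ p.dwt2 = 0 ∧ q.dwt1 = 0 ∧ 0 < q.dwt2 ∨
      p.dwt1 = 0 ∧ 0 < p.dwt2 ∧ 0 < q.dwt1 ∧ q.dwt2 = 0)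

/-- There is an arrow from `x` to `y` with the two inputs `p` and `q`. -/
structure Step₂ (x : Gen n) (p q : Pure (2 * (n + 1)) (n + 1)) (y : Gen n) : Prop where
  isX : x.ty.IsY = false
  isY : y.ty.IsY = true
  src : p.src = x.rgt
  mid : p.tgt = q.src
  tgt : q.tgt = y.rgt
  turn : Turn p q

/-- There is an arrow from `x` to `y` without input. -/
structure Step₀ (x y : Gen n) : Prop where
  isY : x.ty.IsY = true
  isX : y.ty.IsY = false
  rgt : x.rgt = y.rgt

theorem Gen.deg_of_isX {x : Gen n} (h : x.ty.IsY = false) :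
    x.ty.wdeg + height x.rgt.1 1 = n + 1 ∧ x.ty.zdeg + n = height x.rgt.1 2 := by
  rw [x.heights.1, x.heights.2]
  revert h
  generalize x.ty = t
  cases t <;> simp [Ty.IsY, Ty.wdeg, Ty.zdeg, Ty.rise1, Ty.rise2] <;> omega

theorem Gen.deg_of_isY {x : Gen n} (h : x.ty.IsY = true) :
    x.ty.wdeg + n = height x.rgt.1 1 + 1 ∧ x.ty.zdeg + height x.rgt.1 2 = n + 2 := by
  rw [x.heights.1, x.heights.2]
  revert h
  generalize x.ty = t
  cases t <;> simp [Ty.IsY, Ty.wdeg, Ty.zdeg, Ty.rise1, Ty.rise2] <;> omega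

theorem Step.graded {x y : Gen n} {p : Pure (2 * (n + 1)) (n + 1)} (h : Step x p y) :
    Graded x p.dwt y := by
  obtain ⟨h1, h2, h3, h4⟩ := h
  have hc := p.constraints
  have hx := x.preferred.heights
  have hy := y.preferred.heights
  have ha : Admissible x.rgt.1 y.rgt.1 p.dwt := h2 ▸ h3 ▸ p.adm
  have e5 : p.dwt (strand1 n) = p.dwt1 := rfl
  have e6 : p.dwt (strand2 n) = p.dwt2 := rfl
  rw [h2, h3] at hc
  cases hY : x.ty.IsY
  · have dx := Gen.deg_of_isX hY
    have dy := Gen.deg_of_isX (h1 ▸ hY)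
    refine ⟨ha, ?_, ?_, ?_, ?_⟩ <;> simp only [Nat.even_iff, e5, e6] <;> omega
  · have dx := Gen.deg_of_isY hY
    have dy := Gen.deg_of_isY (h1 ▸ hY)
    refine ⟨ha, ?_, ?_, ?_, ?_⟩ <;> simp only [Nat.even_iff, e5, e6] <;> omega

theorem Step₂.graded {x y : Gen n} {p q : Pure (2 * (n + 1)) (n + 1)} (h : Step₂ x p q y) :
    Graded x (p.dwt + q.dwt) y := by
  obtain ⟨h1, h1', h2, hm, h3, h4, h5, h6⟩ := h
  have hc := p.constraints
  have hd := q.constraints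
  have hx := x.preferred.heights
  have hy := y.preferred.heights
  have ha : Admissible x.rgt.1 y.rgt.1 (p.dwt + q.dwt) := h2 ▸ h3 ▸ (p.mul q hm).adm
  have e5 : (p.dwt + q.dwt) (strand1 n) = p.dwt1 + q.dwt1 := rfl
  have e6 : (p.dwt + q.dwt) (strand2 n) = p.dwt2 + q.dwt2 := rfl
  rw [h2] at hc
  rw [← hm, h3] at hd
  have dx := Gen.deg_of_isX h1
  have dy := Gen.deg_of_isY h1'
  refine ⟨ha, ?_, ?_, ?_, ?_⟩ <;> simp only [Nat.even_iff, e5, e6] <;> omega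

theorem Step₀.graded {x y : Gen n} (h : Step₀ x y) : Graded x 0 y := by
  obtain ⟨h1, h1', h2⟩ := h
  have hx := x.preferred.heights
  have ha : Admissible x.rgt.1 y.rgt.1 0 := h2 ▸ (Pure.idem x.rgt).adm
  have dx := Gen.deg_of_isY h1
  have dy := Gen.deg_of_isX h1'
  rw [← h2] at dy
  refine ⟨ha, ?_, ?_, ?_, ?_⟩ <;> simp only [Nat.even_iff, Pi.zero_apply] <;> omega

/-- The multiple of `b` by the coefficient of the arrow from `s` to `t` with the labels `ls` in the
unspecialized diagram, and `0` if there is no such arrow. -/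
def arrowCoef (s : Ty) (ls : List Letter) (t : Ty) (b : BAlg n) : BAlgWZ n :=
  match arrow s ls t with
  | some (p, q) => monomial p (monomial q b)
  | none => 0

theorem markedMin_eq (x : Gen n) (l : List (BAlg (n + 1))) (y : Gen n) :
    markedMin n x l y = multilinearExt (fun ps => pureOp arrowCoef x ps y) l := rfl

theorem arrow_nil_iff {x y : Gen n} (h : x.rgt = y.rgt) (r : ℕ × ℕ) :
    arrow x.ty [] y.ty = some r ↔ (x.ty.IsY = true ∧ y.ty.IsY = false) ∧
      r = ((x.ty.wdeg - y.ty.wdeg) / 2, (x.ty.zdeg - y.ty.zdeg) / 2) := by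
  have hx := x.heights
  rw [h, y.heights.1, y.heights.2] at hx
  revert hx
  generalize x.ty = s
  generalize y.ty = t
  obtain ⟨r1, r2⟩ := r
  cases s <;> cases t <;>
    simp [arrow, Ty.IsY, Ty.wdeg, Ty.zdeg, Ty.rise1, Ty.rise2, eq_comm]

set_option maxHeartbeats 4000000 in
theorem arrow_one_iff {x y : Gen n} {p : Pure (2 * (n + 1)) (n + 1)} (h1 : p.src = x.rgt)
    (h2 : p.tgt = y.rgt) {a : Letter} (ha : letter p = some a) (r : ℕ × ℕ) :
    arrow x.ty [a] y.ty = some r ↔ (x.ty.IsY = y.ty.IsY ∧ p.Allowed) ∧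
      r = ((p.dwt1 + x.ty.wdeg - y.ty.wdeg) / 2, (p.dwt2 + x.ty.zdeg - y.ty.zdeg) / 2) := by
  have hc := p.constraints
  rw [letter_eq_some_iff] at ha
  rw [Pure.Allowed]
  obtain ⟨r1, r2⟩ := r
  rw [h1, h2, x.heights.1, x.heights.2, y.heights.1, y.heights.2] at hc
  rw [h1, x.heights.1, x.heights.2]
  rw [h1, h2, x.heights.1, x.heights.2, y.heights.1, y.heights.2] at ha
  cases a <;> simp only [Letter.Spec] at ha <;> revert ha hc <;>
    generalize x.ty = s <;> generalize y.ty = t <;> clear h1 h2 <;>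
    generalize p.dwt1 = d1 <;> generalize p.dwt2 = d2 <;> cases s <;> cases t <;>
    simp only [Ty.rise1, Ty.rise2] <;> intro ha hc <;> first | (exfalso; omega) |
    (simp [arrow, Ty.IsY, Ty.wdeg, Ty.zdeg] <;> omega)

theorem arrow_two_eq_some_iff (s t : Ty) (a b : Letter) (k l : ℕ) :
    arrow s [a, b] t = some (k, l) ↔
      (a = .U1 k ∧ s = .X1 ∨ a = .R1 k ∧ s = .X0) ∧
        (b = .U2 l ∧ t = .Y1 ∨ b = .R2 l ∧ t = .Y2) ∨
      (a = .U2 l ∧ s = .X1 ∨ a = .L2 l ∧ s = .X2) ∧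
        (b = .U1 k ∧ t = .Y1 ∨ b = .L1 k ∧ t = .Y0) := by
  constructor
  · intro h
    unfold arrow at h
    split at h <;> simp_all
  · rintro (⟨⟨rfl, rfl⟩ | ⟨rfl, rfl⟩, ⟨rfl, rfl⟩ | ⟨rfl, rfl⟩⟩ |
      ⟨⟨rfl, rfl⟩ | ⟨rfl, rfl⟩, ⟨rfl, rfl⟩ | ⟨rfl, rfl⟩⟩) <;> rfl

set_option maxHeartbeats 4000000 in
theorem arrow_two_iff {x y : Gen n} {p q : Pure (2 * (n + 1)) (n + 1)} (h1 : p.src = x.rgt)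
    (hm : p.tgt = q.src) (h2 : q.tgt = y.rgt) {a b : Letter} (ha : letter p = some a)
    (hb : letter q = some b) (k l : ℕ) :
    arrow x.ty [a, b] y.ty = some (k, l) ↔ ((x.ty.IsY = false ∧ y.ty.IsY = true) ∧ Turn p q) ∧
      k = (p.dwt1 + q.dwt1 + x.ty.wdeg - y.ty.wdeg) / 2 ∧
      l = (p.dwt2 + q.dwt2 + x.ty.zdeg - y.ty.zdeg) / 2 := by
  have hc := p.constraints
  have hd := q.constraints
  have m0 : height p.tgt.1 0 = n + 1 := (height_zero _).trans p.tgt.2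
  have m1 := height_step p.tgt.1 0
  have m2 := height_step p.tgt.1 1
  simp only [zero_add, Nat.reduceAdd, m0] at m1 m2
  rw [letter_eq_some_iff] at ha hb
  rw [arrow_two_eq_some_iff, Turn]
  rw [← hm, h2, y.heights.1, y.heights.2] at hd
  rw [h1, x.heights.1, x.heights.2] at hc
  rw [h1, x.heights.1, x.heights.2] at ha
  rw [← hm, h2, y.heights.1, y.heights.2] at hb
  clear h1 h2 hm m0
  revert hc hd ha hb
  generalize x.ty = s
  generalize y.ty = t
  generalize p.dwt1 = p1
  generalize p.dwt2 = p2
  generalize q.dwt1 = q1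
  generalize q.dwt2 = q2
  generalize height p.tgt.1 1 = v1 at *
  generalize height p.tgt.1 2 = v2 at *
  intro ha hb hc hd
  constructor
  · rintro (⟨⟨rfl, rfl⟩ | ⟨rfl, rfl⟩, ⟨rfl, rfl⟩ | ⟨rfl, rfl⟩⟩ |
      ⟨⟨rfl, rfl⟩ | ⟨rfl, rfl⟩, ⟨rfl, rfl⟩ | ⟨rfl, rfl⟩⟩) <;>
    simp only [Letter.Spec, Ty.IsY, Ty.wdeg, Ty.zdeg, Ty.rise1, Ty.rise2, and_self,
      true_and] at * <;> omega
  · rintro ⟨⟨⟨hs, ht⟩, t1, t2, t3⟩, e1, e2⟩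
    cases s <;> simp only [Ty.IsY, reduceCtorEq] at hs <;>
    cases t <;> simp only [Ty.IsY, reduceCtorEq] at ht <;>
    simp only [Ty.wdeg, Ty.zdeg, Ty.rise1, Ty.rise2] at * <;>
    cases a <;> simp only [Letter.Spec] at ha <;> first | (exfalso; omega) | skip
    all_goals
      cases b <;> simp only [Letter.Spec] at hb <;> first | (exfalso; omega) |
        (simp; omega)

end Arrows

/-! ### The operations on pure elements -/

section Values

variable {n : ℕ}

theorem letter_eq_none {b : Pure (2 * (n + 1)) (n + 1)} (h : letter b = none) :
    0 < b.dwt1 ∧ 0 < b.dwt2 := by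
  have e5 : b.dwt (strand1 n) = b.dwt1 := rfl
  have e6 : b.dwt (strand2 n) = b.dwt2 := rfl
  simp only [letter, e5, e6] at h
  split_ifs at h
  omega

theorem arrow_long (s t : Ty) (a b c : Letter) (l : List Letter) :
    arrow s (a :: b :: c :: l) t = none := by
  unfold arrow
  split <;> simp_all

theorem psiState_congr {x y : State (2 * (n + 1)) (n + 1)} (h : x = y) (hx : Preferred x.1)
    (hy : Preferred y.1) : psiState x hx = psiState y hy := by
  subst h; rfl

theorem Psi_eq {p : Pure (2 * (n + 1)) (n + 1)} (hs : Preferred p.src.1) (ht : Preferred p.tgt.1) :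
    Psi p = Blg.ofPure (psiPure p hs ht) :=
  Blg.elt_eq (card_psi _ p.src.2 hs) (card_psi _ p.tgt.2 ht) p.adm.psi

theorem idem_mul_ofPure {m k : ℕ} {x : State m k} {p : Pure m k} (h : x = p.src) :
    Blg.idem x * Blg.ofPure p = Blg.ofPure p := by
  rw [Blg.idem, Blg.ofPure_mul_of_eq (Pure.idem x) p h]
  congr 1
  ext1
  · exact h
  · rfl
  · exact zero_add _

theorem term_eq {x y : Gen n} (b : Pure (2 * (n + 1)) (n + 1)) (hx : b.src = x.rgt)
    (hy : b.tgt = y.rgt) (hs : Preferred b.src.1) (ht : Preferred b.tgt.1) :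
    term x b.dwt y = monomial ((b.dwt1 + x.ty.wdeg - y.ty.wdeg) / 2)
      (monomial ((b.dwt2 + x.ty.zdeg - y.ty.zdeg) / 2) (Blg.ofPure (psiPure b hs ht))) := by
  rw [← Psi_eq, Psi, hx, hy]
  rfl

open Classical in
theorem pureOp_nil (x y : Gen n) :
    pureOp arrowCoef x [] y = if Step₀ x y then term x 0 y else 0 := by
  by_cases h : x.rgt = y.rgt
  · have hc : Chain x.rgt [] y.rgt := h
    simp only [pureOp, if_pos hc, List.mapM_nil, List.map_nil, List.prod_nil, mul_one, arrowCoef]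
    change (match arrow x.ty [] y.ty with
      | some (p, q) => monomial p (monomial q (Blg.idem x.lft))
      | none => 0) = _
    by_cases hs : Step₀ x y
    · rw [if_pos hs, (arrow_nil_iff h _).2 ⟨⟨hs.isY, hs.isX⟩, rfl⟩, Blg.idem_eq_elt, term, ← h]
      simp only [Pi.zero_apply, zero_add]
      rfl
    · rw [if_neg hs]
      cases ha : arrow x.ty [] y.ty with
      | none => rfl
      | some r =>
        obtain ⟨⟨h1, h2⟩, -⟩ := (arrow_nil_iff h r).1 ha
        exact absurd ⟨h1, h2, h⟩ hs
  · have hc : ¬ Chain x.rgt [] y.rgt := h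
    rw [pureOp, if_neg hc, if_neg fun hs => h hs.rgt]

open Classical in
theorem pureOp_one (x : Gen n) (p : Pure (2 * (n + 1)) (n + 1)) (y : Gen n) :
    pureOp arrowCoef x [p] y = if Step x p y then term x p.dwt y else 0 := by
  by_cases h : p.src = x.rgt ∧ p.tgt = y.rgt
  · have hc : Chain x.rgt [p] y.rgt := h
    have hs : Preferred p.src.1 := h.1 ▸ x.preferred
    have ht : Preferred p.tgt.1 := h.2 ▸ y.preferred
    cases hl : letter p with
    | none =>
      have h0 := letter_eq_none hl
      rw [if_neg fun hs => by have := hs.allowed.1; omega]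
      simp [pureOp, hl]
    | some a =>
      have hm : [p].mapM letter = some [a] := by simp [hl]
      have hv : Blg.idem x.lft * ([p].map Psi).prod = Blg.ofPure (psiPure p hs ht) := by
        rw [List.map_singleton, List.prod_singleton, Psi_eq hs ht]
        exact idem_mul_ofPure (psiState_congr h.1.symm x.preferred hs)
      simp only [pureOp, if_pos hc, hm, hv, arrowCoef]
      by_cases hst : Step x p y
      · rw [if_pos hst, (arrow_one_iff h.1 h.2 hl _).2 ⟨⟨hst.sheet, hst.allowed⟩, rfl⟩,
          term_eq p h.1 h.2 hs ht]
      · rw [if_neg hst]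
        cases ha : arrow x.ty [a] y.ty with
        | none => rfl
        | some r =>
          obtain ⟨⟨h1, h2⟩, -⟩ := (arrow_one_iff h.1 h.2 hl r).1 ha
          exact absurd ⟨h1, h.1, h.2, h2⟩ hst
  · have hc : ¬ Chain x.rgt [p] y.rgt := h
    rw [pureOp, if_neg hc, if_neg fun hs => h ⟨hs.src, hs.tgt⟩]

theorem Turn.preferred {p q : Pure (2 * (n + 1)) (n + 1)} (h : Turn p q) : Preferred p.tgt.1 := by
  rw [preferred_iff]
  have h1 := height_step p.tgt.1 2
  simp only [Nat.reduceAdd] at h1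
  have h2 := h.2.1
  omega

open Classical in
theorem pureOp_two (x : Gen n) (p q : Pure (2 * (n + 1)) (n + 1)) (y : Gen n) :
    pureOp arrowCoef x [p, q] y = if Step₂ x p q y then term x (p.dwt + q.dwt) y else 0 := by
  by_cases h : p.src = x.rgt ∧ q.src = p.tgt ∧ q.tgt = y.rgt
  · have hc : Chain x.rgt [p, q] y.rgt := h
    have hs : Preferred p.src.1 := h.1 ▸ x.preferred
    have ht : Preferred q.tgt.1 := h.2.2 ▸ y.preferred
    cases hl : letter p with
    | none =>
      have h0 := letter_eq_none hl
      rw [if_neg fun hs => by have := hs.turn.2.2; omega]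
      simp [pureOp, hl]
    | some a =>
    cases hl' : letter q with
    | none =>
      have h0 := letter_eq_none hl'
      rw [if_neg fun hs => by have := hs.turn.2.2; omega]
      simp [pureOp, hl, hl']
    | some b =>
      have hm : [p, q].mapM letter = some [a, b] := by simp [hl, hl']
      simp only [pureOp, if_pos hc, hm, arrowCoef]
      by_cases hst : Step₂ x p q y
      · have hp := hst.turn.preferred
        have hv : Blg.idem x.lft * ([p, q].map Psi).prod =
            Blg.ofPure (psiPure (p.mul q h.2.1.symm) hs ht) := by
          rw [List.map_cons, List.map_singleton, List.prod_cons, List.prod_singleton, Psi_eq hs hp,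
            Psi_eq (h.2.1 ▸ hp) ht, Blg.ofPure_mul_of_eq _ _
              (psiState_congr h.2.1.symm hp (h.2.1 ▸ hp))]
          exact idem_mul_ofPure (psiState_congr h.1.symm x.preferred hs)
        rw [if_pos hst, (arrow_two_iff h.1 h.2.1.symm h.2.2 hl hl' _ _).2
          ⟨⟨⟨hst.isX, hst.isY⟩, hst.turn⟩, rfl, rfl⟩, hv]
        exact (term_eq (p.mul q h.2.1.symm) h.1 h.2.2 hs ht).symm
      · rw [if_neg hst]
        cases ha : arrow x.ty [a, b] y.ty with
        | none => rfl
        | some r =>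
          obtain ⟨⟨⟨h1, h2⟩, h3⟩, -⟩ := (arrow_two_iff h.1 h.2.1.symm h.2.2 hl hl' r.1 r.2).1 ha
          exact absurd ⟨h1, h2, h.1, h.2.1.symm, h.2.2, h3⟩ hst
  · have hc : ¬ Chain x.rgt [p, q] y.rgt := h
    rw [pureOp, if_neg hc, if_neg fun hs => h ⟨hs.src, hs.mid.symm, hs.tgt⟩]

theorem pureOp_long (x : Gen n) (p q r : Pure (2 * (n + 1)) (n + 1))
    (l : List (Pure (2 * (n + 1)) (n + 1))) (y : Gen n) :
    pureOp arrowCoef x (p :: q :: r :: l) y = 0 := by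
  rw [pureOp]
  split_ifs
  · cases hp : letter p <;> cases hq : letter q <;> cases hr : letter r <;>
      cases hl : l.mapM letter <;> simp [List.mapM_cons, hp, hq, hr, hl, arrowCoef, arrow_long]
  · rfl

end Values

/-! ### The values of the operations -/

section Operations

variable {n : ℕ}

open Classical in
theorem markedMin_nil (x y : Gen n) :
    markedMin n x [] y = if Step₀ x y then term x 0 y else 0 := pureOp_nil x y

open Classical in
/-- For pure elements in the ideal, the right-hand side is zero by `psiPure_inJ`. -/
theorem markedMin_one (x : Gen n) (p : Pure (2 * (n + 1)) (n + 1)) (y : Gen n) :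
    markedMin n x [Blg.ofPure p] y = if Step x p y then term x p.dwt y else 0 := by
  rw [markedMin_eq]
  by_cases hp : p.InJ
  · rw [Blg.ofPure_of_inJ p hp, multilinearExt_zero_cons]
    split_ifs with h
    · exact (term_eq_zero h.src h.tgt fun hs ht => psiPure_inJ hs ht h.allowed hp).symm
    · rfl
  · rw [multilinearExt_ofPure_cons _ hp]
    exact pureOp_one x p y

theorem Turn.allowed_left {p q : Pure (2 * (n + 1)) (n + 1)} (h : Turn p q)
    (hs : Preferred p.src.1) : p.Allowed := by
  obtain ⟨h1, h2, h3⟩ := h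
  have hc := p.constraints
  have := hs.heights
  unfold Pure.Allowed
  omega

theorem Turn.allowed_right {p q : Pure (2 * (n + 1)) (n + 1)} (h : Turn p q)
    (hm : p.tgt = q.src) : q.Allowed := by
  obtain ⟨h1, h2, h3⟩ := h
  rw [hm] at h1 h2
  unfold Pure.Allowed
  omega

theorem psiPure_mul {p q : Pure (2 * (n + 1)) (n + 1)} (h : p.tgt = q.src)
    (hs : Preferred p.src.1) (hm : Preferred p.tgt.1) (ht : Preferred q.tgt.1) :
    psiPure (p.mul q h) hs ht = (psiPure p hs hm).mul (psiPure q (h ▸ hm) ht)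
      (psiState_congr h hm (h ▸ hm)) := rfl

open Classical in
theorem markedMin_two (x : Gen n) (p q : Pure (2 * (n + 1)) (n + 1)) (y : Gen n) :
    markedMin n x [Blg.ofPure p, Blg.ofPure q] y =
      if Step₂ x p q y then term x (p.dwt + q.dwt) y else 0 := by
  rw [markedMin_eq]
  by_cases hp : p.InJ
  · rw [Blg.ofPure_of_inJ p hp, multilinearExt_zero_cons]
    split_ifs with h
    · refine (term_eq_zero (b := p.mul q h.mid) h.src h.tgt fun hs ht => ?_).symm
      rw [psiPure_mul h.mid hs h.turn.preferred ht]
      exact .mul_right _ _ _ (psiPure_inJ _ _ (h.turn.allowed_left hs) hp)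
    · rfl
  rw [multilinearExt_ofPure_cons _ hp]
  by_cases hq : q.InJ
  · rw [Blg.ofPure_of_inJ q hq, multilinearExt_zero_cons]
    split_ifs with h
    · refine (term_eq_zero (b := p.mul q h.mid) h.src h.tgt fun hs ht => ?_).symm
      rw [psiPure_mul h.mid hs h.turn.preferred ht]
      exact .mul_left _ _ _ (psiPure_inJ _ _ (h.turn.allowed_right h.mid) hq)
    · rfl
  rw [multilinearExt_ofPure_cons _ hq]
  exact pureOp_two x p q y

theorem markedMin_long (x : Gen n) (l : List (BAlg (n + 1))) (hl : 3 ≤ l.length) (y : Gen n) :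
    markedMin n x l y = 0 := by
  rw [markedMin_eq]
  refine multilinearExt_eq_zero _ _ fun ps hps => ?_
  match ps with
  | [] | [_] | [_, _] => simp only [List.length_nil, List.length_cons] at hps; omega
  | p :: q :: r :: ps => exact pureOp_long x p q r ps y

theorem markedMin_add (x : Gen n) (u : List (BAlg (n + 1))) (a b : BAlg (n + 1))
    (v : List (BAlg (n + 1))) (y : Gen n) : markedMin n x (u ++ (a + b) :: v) y =
      markedMin n x (u ++ a :: v) y + markedMin n x (u ++ b :: v) y :=
  multilinearExt_add _ _ _ _ _

/-- An operation as an additive map of one of its inputs. -/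
def markedMinSlot (x : Gen n) (u v : List (BAlg (n + 1))) (y : Gen n) :
    BAlg (n + 1) →+ BAlgWZ n :=
  AddMonoidHom.mk' (fun a => markedMin n x (u ++ a :: v) y) fun a b => markedMin_add x u a b v y

end Operations

section Relation

variable {n : ℕ}

theorem Blg.hom_congr {m k : ℕ} {E : Type} [AddCommGroup E] (f g : Blg m k →+ E)
    (h : ∀ p, f (Blg.ofPure p) = g (Blg.ofPure p)) (a : Blg m k) : f a = g a := by
  refine Blg.induction (fun a => f a = g a) ?_ ?_ (fun p _ => h p) a
  · rw [map_zero, map_zero]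
  · intro a b ha hb
    rw [map_add, map_add, ha, hb]

/-! ### The structure relation -/

/-- The operation with one input, as an additive map. -/
def opOne (x y : Gen n) : BAlg (n + 1) →+ BAlgWZ n := markedMinSlot x [] [] y

/-- The operation with two inputs, as a biadditive map. -/
def opTwo (x y : Gen n) : BAlg (n + 1) →+ BAlg (n + 1) →+ BAlgWZ n :=
  AddMonoidHom.mk' (fun a => markedMinSlot x [a] [] y) fun a b =>
    AddMonoidHom.ext fun c => markedMin_add x [] a b [c] y

theorem opOne_apply (x y : Gen n) (a : BAlg (n + 1)) : opOne x y a = markedMin n x [a] y := rfl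

theorem opTwo_apply (x y : Gen n) (a b : BAlg (n + 1)) :
    opTwo x y a b = markedMin n x [a, b] y := rfl

open Classical in
/-- A sum over intermediate generators, as it occurs in the structure relation. The intermediate
generator is unique if it exists. -/
theorem sum_terms {x y : Gen n} {d e : Fin (2 * (n + 1)) → ℕ} {A B : Gen n → Prop}
    (hA : ∀ g, A g → Graded x d g) (hB : ∀ g, B g → Graded g e y)
    (hu : ∀ g g', A g → B g → A g' → B g' → g = g') :
    (∑ g, (if A g then term x d g else 0) * (if B g then term g e y else 0)) =
      if ∃ g, A g ∧ B g then term x (d + e) y else 0 := by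
  split_ifs with h
  · obtain ⟨g, h1, h2⟩ := h
    rw [Finset.sum_eq_single g]
    · rw [if_pos h1, if_pos h2, (hA g h1).term_mul (hB g h2)]
    · intro g' _ hg'
      by_cases h3 : A g'
      · by_cases h4 : B g'
        · exact absurd (hu g' g h3 h4 h1 h2) hg'
        · rw [if_neg h4, mul_zero]
      · rw [if_neg h3, zero_mul]
    · intro hg
      exact absurd (Finset.mem_univ g) hg
  · refine Finset.sum_eq_zero fun g _ => ?_
    by_cases h3 : A g
    · rw [if_neg fun h4 => h ⟨g, h3, h4⟩, mul_zero]
    · rw [if_neg h3, zero_mul]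

/-- A product is allowed if and only if both factors are, unless there is a turn between them. Thus
the two-input operations measure the failure of the one-input operations to be multiplicative. -/
theorem turn_iff {p q : Pure (2 * (n + 1)) (n + 1)} (h : p.tgt = q.src) (hs : Preferred p.src.1)
    (hm : Preferred p.tgt.1) :
    Turn p q ↔ p.Allowed ∧ q.Allowed ∧ ¬ (p.mul q h).Allowed := by
  have hc := p.constraints
  have h1 := hs.heights
  have h2 := hm.heights
  have e1 : (p.mul q h).dwt1 = p.dwt1 + q.dwt1 := rfl
  have e2 : (p.mul q h).dwt2 = p.dwt2 + q.dwt2 := rfl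
  have e3 : (p.mul q h).src = p.src := rfl
  unfold Turn Pure.Allowed
  rw [e1, e2, e3, ← h]
  omega

theorem allowed_of_mul {p q : Pure (2 * (n + 1)) (n + 1)} (h : p.tgt = q.src)
    (hs : Preferred p.src.1) (hm : Preferred p.tgt.1) (ha : (p.mul q h).Allowed) :
    p.Allowed ∧ q.Allowed := by
  have hc := p.constraints
  have h1 := hs.heights
  have h2 := hm.heights
  have e1 : (p.mul q h).dwt1 = p.dwt1 + q.dwt1 := rfl
  have e2 : (p.mul q h).dwt2 = p.dwt2 + q.dwt2 := rfl
  have e3 : (p.mul q h).src = p.src := rfl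
  unfold Pure.Allowed at *
  rw [e1, e2, e3] at ha
  rw [← h]
  omega

open Classical in
theorem relation_one (x y : Gen n) (a : BAlg (n + 1)) :
    ∑ g, markedMin n x [] g * opOne g y a + ∑ g, opOne x g a * markedMin n g [] y = 0 := by
  refine Blg.induction (fun a => ∑ g, markedMin n x [] g * opOne g y a +
    ∑ g, opOne x g a * markedMin n g [] y = 0) ?_ ?_ ?_ a
  · simp
  · intro a b ha hb
    simp only [map_add, mul_add, add_mul, Finset.sum_add_distrib]
    rw [add_add_add_comm, ha, hb, add_zero]
  intro p _
  simp only [opOne_apply, markedMin_one, markedMin_nil]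
  rw [sum_terms (fun g h => h.graded) (fun g h => h.graded) fun g g' h1 h2 h3 h4 =>
      Gen.ext (h1.isX.trans h3.isX.symm) (h1.rgt.symm.trans h3.rgt),
    sum_terms (fun g h => h.graded) (fun g h => h.graded) fun g g' h1 h2 h3 h4 =>
      Gen.ext (h2.isY.trans h4.isY.symm) (h2.rgt.trans h4.rgt.symm), zero_add, add_zero]
  have key : (∃ g, Step₀ x g ∧ Step g p y) ↔ ∃ g, Step x p g ∧ Step₀ g y := by
    constructor
    · rintro ⟨g, h1, h2⟩
      obtain ⟨g', e1, e2⟩ := exists_gen y.rgt y.preferred true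
      exact ⟨g', ⟨h1.isY.trans e1.symm, h2.src.trans h1.rgt.symm, h2.tgt.trans e2.symm, h2.allowed⟩,
        ⟨e1, h2.sheet.symm.trans h1.isX, e2⟩⟩
    · rintro ⟨g, h1, h2⟩
      obtain ⟨g', e1, e2⟩ := exists_gen x.rgt x.preferred false
      exact ⟨g', ⟨h1.sheet.trans h2.isY, e1, e2.symm⟩,
        ⟨e1.trans h2.isX.symm, h1.src.trans e2.symm, h1.tgt.trans h2.rgt, h1.allowed⟩⟩
  simp only [key]
  exact add_self_eq_zero _

open Classical in
theorem opOne_mul_ofPure (x y : Gen n) (p q : Pure (2 * (n + 1)) (n + 1)) :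
    opOne x y (Blg.ofPure p * Blg.ofPure q) =
      if ∃ h : p.tgt = q.src, Step x (p.mul q h) y then term x (p.dwt + q.dwt) y else 0 := by
  by_cases h : p.tgt = q.src
  · rw [Blg.ofPure_mul_of_eq p q h, opOne_apply, markedMin_one]
    simp only [h, exists_true_left]
    rfl
  · rw [Blg.ofPure_mul_of_ne p q h, map_zero, if_neg fun hs => h hs.1]

open Classical in
theorem relation_two (x y : Gen n) (a b : BAlg (n + 1)) :
    ∑ g, markedMin n x [] g * opTwo g y a b + ∑ g, opOne x g a * opOne g y b +
      ∑ g, opTwo x g a b * markedMin n g [] y + opOne x y (a * b) = 0 := by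
  refine Blg.induction (fun a => ∑ g, markedMin n x [] g * opTwo g y a b +
    ∑ g, opOne x g a * opOne g y b + ∑ g, opTwo x g a b * markedMin n g [] y +
      opOne x y (a * b) = 0) ?_ ?_ ?_ a
  · simp
  · intro a a' ha hb
    simp only [map_add, AddMonoidHom.add_apply, mul_add, add_mul, Finset.sum_add_distrib]
    rw [← add_zero (0 : BAlgWZ n)]
    nth_rw 1 [← ha]
    nth_rw 1 [← hb]
    abel
  intro p _
  refine Blg.induction (fun b => ∑ g, markedMin n x [] g * opTwo g y (Blg.ofPure p) b +
    ∑ g, opOne x g (Blg.ofPure p) * opOne g y b +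
      ∑ g, opTwo x g (Blg.ofPure p) b * markedMin n g [] y +
        opOne x y (Blg.ofPure p * b) = 0) ?_ ?_ ?_ b
  · simp
  · intro a a' ha hb
    simp only [map_add, mul_add, add_mul, Finset.sum_add_distrib]
    rw [← add_zero (0 : BAlgWZ n)]
    nth_rw 1 [← ha]
    nth_rw 1 [← hb]
    abel
  intro q _
  rw [opOne_mul_ofPure]
  simp only [opOne_apply, opTwo_apply, markedMin_one, markedMin_nil, markedMin_two]
  rw [sum_terms (fun g h => h.graded) (fun g h => h.graded) fun g g' h1 h2 h3 h4 =>
      Gen.ext (h1.isX.trans h3.isX.symm) (h1.rgt.symm.trans h3.rgt),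
    sum_terms (fun g h => h.graded) (fun g h => h.graded) fun g g' h1 h2 h3 h4 =>
      Gen.ext (h1.sheet.symm.trans h3.sheet) (h1.tgt.symm.trans h3.tgt),
    sum_terms (fun g h => h.graded) (fun g h => h.graded) fun g g' h1 h2 h3 h4 =>
      Gen.ext (h2.isY.trans h4.isY.symm) (h2.rgt.trans h4.rgt.symm), zero_add, add_zero]
  by_cases hc : x.ty.IsY = y.ty.IsY ∧ p.src = x.rgt ∧ p.tgt = q.src ∧ q.tgt = y.rgt
  · obtain ⟨c1, c2, c3, c4⟩ := hc
    have hs : Preferred p.src.1 := c2 ▸ x.preferred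
    have ht : Preferred q.tgt.1 := c4 ▸ y.preferred
    have e1 : (∃ g, Step₀ x g ∧ Step₂ g p q y) ↔ x.ty.IsY = true ∧ Turn p q := by
      constructor
      · rintro ⟨g, h1, h2⟩
        exact ⟨h1.isY, h2.turn⟩
      · rintro ⟨h1, h2⟩
        obtain ⟨g, g1, g2⟩ := exists_gen x.rgt x.preferred false
        exact ⟨g, ⟨h1, g1, g2.symm⟩, ⟨g1, c1 ▸ h1, c2.trans g2.symm, c3, c4, h2⟩⟩
    have e2 : (∃ g, Step x p g ∧ Step g q y) ↔ Preferred p.tgt.1 ∧ p.Allowed ∧ q.Allowed := by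
      constructor
      · rintro ⟨g, h1, h2⟩
        exact ⟨h1.tgt ▸ g.preferred, h1.allowed, h2.allowed⟩
      · rintro ⟨h1, h2, h3⟩
        obtain ⟨g, g1, g2⟩ := exists_gen p.tgt h1 x.ty.IsY
        exact ⟨g, ⟨g1.symm, c2, g2.symm, h2⟩, ⟨g1.trans c1, c3.symm.trans g2.symm, c4, h3⟩⟩
    have e3 : (∃ g, Step₂ x p q g ∧ Step₀ g y) ↔ x.ty.IsY = false ∧ Turn p q := by
      constructor
      · rintro ⟨g, h1, h2⟩
        exact ⟨h1.isX, h1.turn⟩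
      · rintro ⟨h1, h2⟩
        obtain ⟨g, g1, g2⟩ := exists_gen y.rgt y.preferred true
        exact ⟨g, ⟨h1, g1, c2, c3, c4.trans g2.symm, h2⟩, ⟨g1, c1 ▸ h1, g2⟩⟩
    have e4 : (∃ h : p.tgt = q.src, Step x (p.mul q h) y) ↔ (p.mul q c3).Allowed :=
      ⟨fun h => h.2.allowed, fun h => ⟨c3, c1, c2, c4, h⟩⟩
    simp only [e1, e2, e3, e4]
    by_cases hm : Preferred p.tgt.1
    · have key := turn_iff c3 hs hm
      have key' := allowed_of_mul c3 hs hm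
      by_cases hX : x.ty.IsY = true
      · by_cases h1 : Turn p q
        · have := key.1 h1
          simp [hX, h1, hm, this, add_self_eq_zero]
        · by_cases h2 : (p.mul q c3).Allowed
          · have := key' h2
            simp [h1, h2, hm, this, add_self_eq_zero]
          · have : ¬ (p.Allowed ∧ q.Allowed) := by tauto
            simp [h1, h2, this]
      · have hX : x.ty.IsY = false := by simpa using hX
        by_cases h1 : Turn p q
        · have := key.1 h1
          simp [hX, h1, hm, this, add_self_eq_zero]
        · by_cases h2 : (p.mul q c3).Allowed
          · have := key' h2
            simp [h1, h2, hm, this, add_self_eq_zero]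
          · have : ¬ (p.Allowed ∧ q.Allowed) := by tauto
            simp [h1, h2, this]
    · -- only the arrow with the input `p q` is left
      have h1 : ¬ Turn p q := fun h => hm h.preferred
      simp only [h1, hm, and_false, false_and, if_false, zero_add]
      split_ifs with h2
      · exact term_eq_zero (b := p.mul q c3) c2 c4 fun hs ht => psiPure_mul_inJ c3 hs ht h2 hm
      · rfl
  · rw [if_neg, if_neg, if_neg, if_neg, add_zero, add_zero, add_zero]
    · rintro ⟨h, h1⟩; exact hc ⟨h1.sheet, h1.src, h, h1.tgt⟩
    · rintro ⟨g, h1, h2⟩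
      exact hc ⟨h1.isX.trans h2.isX.symm, h1.src, h1.mid, h1.tgt.trans h2.rgt⟩
    · rintro ⟨g, h1, h2⟩
      exact hc ⟨h1.sheet.trans h2.sheet, h1.src, h1.tgt.trans h2.src.symm, h2.tgt⟩
    · rintro ⟨g, h1, h2⟩
      exact hc ⟨h1.isY.trans h2.isY.symm, h2.src.trans h1.rgt.symm, h2.mid, h2.tgt⟩

end Relation

section Relation

variable {n : ℕ}

open Classical in
theorem opTwo_mul_left (x y : Gen n) (p q r : Pure (2 * (n + 1)) (n + 1)) :
    opTwo x y (Blg.ofPure p * Blg.ofPure q) (Blg.ofPure r) =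
      if ∃ h : p.tgt = q.src, Step₂ x (p.mul q h) r y then
        term x (p.dwt + (q.dwt + r.dwt)) y else 0 := by
  by_cases h : p.tgt = q.src
  · rw [Blg.ofPure_mul_of_eq p q h, opTwo_apply, markedMin_two]
    simp only [h, exists_true_left, ← add_assoc]
    rfl
  · rw [Blg.ofPure_mul_of_ne p q h, map_zero, if_neg fun hs => h hs.1]
    rfl

open Classical in
theorem opTwo_mul_right (x y : Gen n) (p q r : Pure (2 * (n + 1)) (n + 1)) :
    opTwo x y (Blg.ofPure p) (Blg.ofPure q * Blg.ofPure r) =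
      if ∃ h : q.tgt = r.src, Step₂ x p (q.mul r h) y then
        term x (p.dwt + (q.dwt + r.dwt)) y else 0 := by
  by_cases h : q.tgt = r.src
  · rw [Blg.ofPure_mul_of_eq q r h, opTwo_apply, markedMin_two]
    simp only [h, exists_true_left]
    rfl
  · rw [Blg.ofPure_mul_of_ne q r h, map_zero, if_neg fun hs => h hs.1]

/-- Four statements of which an even number hold give four equal terms that cancel. -/
theorem four_terms {E : Type} [AddCommGroup E] [Module (ZMod 2) E] (t : E) {a b c d : Prop}
    [Decidable a] [Decidable b] [Decidable c] [Decidable d]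
    (h : ¬ ((a ↔ b) ↔ (c ↔ d)) → t = 0) :
    (if a then t else 0) + (if b then t else 0) + (if c then t else 0) +
      (if d then t else 0) = 0 := by
  have h2 : t + t = 0 := add_self_eq_zero t
  by_cases ha : a <;> by_cases hb : b <;> by_cases hc : c <;> by_cases hd : d <;>
    simp_all

set_option maxHeartbeats 1600000 in
open Classical in
theorem relation_three_ofPure (x y : Gen n) (p q r : Pure (2 * (n + 1)) (n + 1)) :
    ∑ g, opOne x g (Blg.ofPure p) * opTwo g y (Blg.ofPure q) (Blg.ofPure r) +
      ∑ g, opTwo x g (Blg.ofPure p) (Blg.ofPure q) * opOne g y (Blg.ofPure r) +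
      opTwo x y (Blg.ofPure p * Blg.ofPure q) (Blg.ofPure r) +
      opTwo x y (Blg.ofPure p) (Blg.ofPure q * Blg.ofPure r) = 0 := by
  rw [opTwo_mul_left, opTwo_mul_right]
  simp only [opOne_apply, opTwo_apply, markedMin_one, markedMin_two]
  rw [sum_terms (fun g h => h.graded) (fun g h => h.graded) fun g g' h1 h2 h3 h4 =>
      Gen.ext (h1.sheet.symm.trans h3.sheet) (h1.tgt.symm.trans h3.tgt),
    sum_terms (fun g h => h.graded) (fun g h => h.graded) fun g g' h1 h2 h3 h4 =>
      Gen.ext (h2.sheet.trans h4.sheet.symm) (h2.src.symm.trans h4.src), add_assoc p.dwt]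
  refine four_terms _ fun hx => ?_
  by_cases hc : (x.ty.IsY = false ∧ y.ty.IsY = true) ∧
      p.src = x.rgt ∧ p.tgt = q.src ∧ q.tgt = r.src ∧ r.tgt = y.rgt
  · obtain ⟨⟨c0, c1⟩, c2, c3, c4, c5⟩ := hc
    have hs : Preferred p.src.1 := c2 ▸ x.preferred
    have ht : Preferred r.tgt.1 := c5 ▸ y.preferred
    have e1 : (∃ g, Step x p g ∧ Step₂ g q r y) ↔
        Preferred p.tgt.1 ∧ p.Allowed ∧ Turn q r := by
      constructor
      · rintro ⟨g, h1, h2⟩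
        exact ⟨h1.tgt ▸ g.preferred, h1.allowed, h2.turn⟩
      · rintro ⟨h1, h2, h3⟩
        obtain ⟨g, g1, g2⟩ := exists_gen p.tgt h1 false
        exact ⟨g, ⟨c0.trans g1.symm, c2, g2.symm, h2⟩,
          ⟨g1, c1, c3.symm.trans g2.symm, c4, c5, h3⟩⟩
    have e2 : (∃ g, Step₂ x p q g ∧ Step g r y) ↔
        Preferred q.tgt.1 ∧ Turn p q ∧ r.Allowed := by
      constructor
      · rintro ⟨g, h1, h2⟩
        exact ⟨h1.tgt ▸ g.preferred, h1.turn, h2.allowed⟩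
      · rintro ⟨h1, h2, h3⟩
        obtain ⟨g, g1, g2⟩ := exists_gen q.tgt h1 true
        exact ⟨g, ⟨c0, g1, c2, c3, g2.symm, h2⟩, ⟨g1.trans c1.symm, c4.symm.trans g2.symm, c5, h3⟩⟩
    have e3 : (∃ h : p.tgt = q.src, Step₂ x (p.mul q h) r y) ↔ Turn (p.mul q c3) r :=
      ⟨fun h => h.2.turn, fun h => ⟨c3, c0, c1, c2, c4, c5, h⟩⟩
    have e4 : (∃ h : q.tgt = r.src, Step₂ x p (q.mul r h) y) ↔ Turn p (q.mul r c4) :=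
      ⟨fun h => h.2.turn, fun h => ⟨c4, c0, c1, c2, c3, c5, h⟩⟩
    rw [e1, e2, e3, e4] at hx
    have z : ∀ (b : Pure (2 * (n + 1)) (n + 1)), b.src = x.rgt → b.tgt = y.rgt →
      b.dwt = p.dwt + (q.dwt + r.dwt) → (∀ hs ht, (psiPure b hs ht).InJ) →
        term x (p.dwt + (q.dwt + r.dwt)) y = 0 := fun b b1 b2 b3 b4 => b3 ▸ term_eq_zero b1 b2 b4
    by_cases hm : Preferred p.tgt.1
    · by_cases hm' : Preferred q.tgt.1
      · -- all four conditions are Boolean expressions in the allowedness of products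
        exfalso
        have k1 := turn_iff c3 hs hm
        have k2 := turn_iff c4 (c3 ▸ hm) hm'
        have k3 := turn_iff (p := p.mul q c3) c4 hs hm'
        have k4 := turn_iff (q := q.mul r c4) c3 hs hm
        have l1 := allowed_of_mul c3 hs hm
        have l2 := allowed_of_mul c4 (c3 ▸ hm) hm'
        have l3 := allowed_of_mul (p := p.mul q c3) c4 hs hm'
        have l4 := allowed_of_mul (q := q.mul r c4) c3 hs hm
        have e : ((p.mul q c3).mul r c4).Allowed ↔ (p.mul (q.mul r c4) c3).Allowed := by
          have : (p.mul q c3).mul r c4 = p.mul (q.mul r c4) c3 := by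
            ext1
            · rfl
            · rfl
            · exact add_assoc _ _ _
          rw [this]
        clear e1 e2 e3 e4 z
        simp only [k1, k2, k3, k4, hm, hm', true_and, e] at hx
        rw [e] at l3
        generalize p.Allowed = A at *
        generalize q.Allowed = B at *
        generalize r.Allowed = C at *
        generalize (p.mul q c3).Allowed = D at *
        generalize (q.mul r c4).Allowed = F at *
        generalize (p.mul (q.mul r c4) c3).Allowed = G at *
        clear k1 k2 k3 k4 e hs ht hm hm' c0 c1 c2 c3 c4 c5
        by_cases A <;> by_cases B <;> by_cases C <;> simp_all <;> tauto
      · -- only the arrow with the inputs `p` and `q r` is left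
        have n1 : ¬ Turn q r := fun h => hm' h.preferred
        have n2 : ¬ Turn (p.mul q c3) r := fun h => hm' h.preferred
        simp only [n1, n2, hm', and_false, false_and, false_iff, true_iff, not_not] at hx
        refine z (p.mul (q.mul r c4) c3) c2 c5 rfl fun h1 h2 => ?_
        rw [psiPure_mul (q := q.mul r c4) c3 h1 hm h2]
        exact .mul_left _ _ _ (psiPure_mul_inJ c4 _ _ (hx.allowed_right c3) hm')
    · -- only the arrow with the inputs `p q` and `r` is left
      have n1 : ¬ Turn p q := fun h => hm h.preferred
      have n2 : ¬ Turn p (q.mul r c4) := fun h => hm h.preferred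
      simp only [n1, n2, hm, and_false, false_and, iff_false, true_iff, not_not] at hx
      refine z ((p.mul q c3).mul r c4) c2 c5 (add_assoc _ _ _) fun h1 h2 => ?_
      rw [psiPure_mul (p := p.mul q c3) c4 h1 hx.preferred h2]
      exact .mul_right _ _ _ (psiPure_mul_inJ c3 _ _ (hx.allowed_left h1) hm)
  · exfalso
    have n1 : ¬ ∃ g, Step x p g ∧ Step₂ g q r y := by
      rintro ⟨g, h1, h2⟩
      exact hc ⟨⟨h1.sheet.trans h2.isX, h2.isY⟩, h1.src, h1.tgt.trans h2.src.symm, h2.mid, h2.tgt⟩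
    have n2 : ¬ ∃ g, Step₂ x p q g ∧ Step g r y := by
      rintro ⟨g, h1, h2⟩
      exact hc ⟨⟨h1.isX, h2.sheet.symm.trans h1.isY⟩, h1.src, h1.mid, h1.tgt.trans h2.src.symm,
        h2.tgt⟩
    have n3 : ¬ ∃ h : p.tgt = q.src, Step₂ x (p.mul q h) r y := by
      rintro ⟨h, h1⟩; exact hc ⟨⟨h1.isX, h1.isY⟩, h1.src, h, h1.mid, h1.tgt⟩
    have n4 : ¬ ∃ h : q.tgt = r.src, Step₂ x p (q.mul r h) y := by
      rintro ⟨h, h1⟩; exact hc ⟨⟨h1.isX, h1.isY⟩, h1.src, h1.mid, h, h1.tgt⟩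
    exact hx (by simp only [n1, n2, n3, n4])

theorem relation_three (x y : Gen n) (a b c : BAlg (n + 1)) :
    ∑ g, opOne x g a * opTwo g y b c + ∑ g, opTwo x g a b * opOne g y c +
      opTwo x y (a * b) c + opTwo x y a (b * c) = 0 := by
  refine Blg.induction (fun a => ∑ g, opOne x g a * opTwo g y b c +
    ∑ g, opTwo x g a b * opOne g y c + opTwo x y (a * b) c + opTwo x y a (b * c) = 0) ?_ ?_ ?_ a
  · simp
  · intro a a' ha hb
    simp only [map_add, AddMonoidHom.add_apply, add_mul, Finset.sum_add_distrib]
    rw [← add_zero (0 : BAlgWZ n)]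
    nth_rw 1 [← ha]
    nth_rw 1 [← hb]
    abel
  intro p _
  refine Blg.induction (fun b => ∑ g, opOne x g (Blg.ofPure p) * opTwo g y b c +
    ∑ g, opTwo x g (Blg.ofPure p) b * opOne g y c + opTwo x y (Blg.ofPure p * b) c +
      opTwo x y (Blg.ofPure p) (b * c) = 0) ?_ ?_ ?_ b
  · simp
  · intro a a' ha hb
    simp only [map_add, AddMonoidHom.add_apply, mul_add, add_mul, Finset.sum_add_distrib]
    rw [← add_zero (0 : BAlgWZ n)]
    nth_rw 1 [← ha]
    nth_rw 1 [← hb]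
    abel
  intro q _
  refine Blg.induction (fun c => ∑ g, opOne x g (Blg.ofPure p) * opTwo g y (Blg.ofPure q) c +
    ∑ g, opTwo x g (Blg.ofPure p) (Blg.ofPure q) * opOne g y c +
      opTwo x y (Blg.ofPure p * Blg.ofPure q) c +
      opTwo x y (Blg.ofPure p) (Blg.ofPure q * c) = 0) ?_ ?_ ?_ c
  · simp
  · intro a a' ha hb
    simp only [map_add, mul_add, Finset.sum_add_distrib]
    rw [← add_zero (0 : BAlgWZ n)]
    nth_rw 1 [← ha]
    nth_rw 1 [← hb]
    abel
  intro r _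
  exact relation_three_ofPure x y p q r

theorem markedMin_nil_mul_nil (x g y : Gen n) : markedMin n x [] g * markedMin n g [] y = 0 := by
  rw [markedMin_nil, markedMin_nil]
  split_ifs with h1 h2
  · exact absurd (h1.isX.symm.trans h2.isY) (by decide)
  · exact mul_zero _
  · exact zero_mul _
  · exact zero_mul _

theorem opTwo_eq_zero {x y : Gen n} (h : ¬ (x.ty.IsY = false ∧ y.ty.IsY = true))
    (a b : BAlg (n + 1)) : opTwo x y a b = 0 := by
  refine Blg.hom_congr ((opTwo x y).flip b) 0 (fun p => ?_) a
  refine Blg.hom_congr (opTwo x y (Blg.ofPure p)) 0 (fun q => ?_) b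
  rw [opTwo_apply, markedMin_two, if_neg fun hs => h ⟨hs.isX, hs.isY⟩]
  rfl

theorem opTwo_mul_opTwo (x g y : Gen n) (a b c d : BAlg (n + 1)) :
    opTwo x g a b * opTwo g y c d = 0 := by
  cases h : g.ty.IsY
  · rw [opTwo_eq_zero (by simp [h]), zero_mul]
  · rw [opTwo_eq_zero (x := g) (by simp [h]), mul_zero]

theorem markedMin_relation (x : Gen n) (l : List (BAlg (n + 1))) (y : Gen n) :
    structureSum (markedMin n) x l y = 0 := by
  have long := fun (x : Gen n) (l : List (BAlg (n + 1))) (hl : 3 ≤ l.length) (y : Gen n) =>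
    markedMin_long x l hl y
  match l with
  | [] => simp [structureSum, markedMin_nil_mul_nil]
  | [a] =>
    have h := relation_one x y a
    simp only [opOne_apply] at h
    simpa [structureSum, Finset.sum_range_succ] using h
  | [a, b] =>
    have h := relation_two x y a b
    simp only [opOne_apply, opTwo_apply] at h
    simpa [structureSum, Finset.sum_range_succ] using h
  | [a, b, c] =>
    have h := relation_three x y a b c
    simp only [opOne_apply, opTwo_apply] at h
    simpa [structureSum, Finset.sum_range_succ, long, add_assoc] using h
  | [a, b, c, d] =>
    have h := fun g => opTwo_mul_opTwo x g y a b c d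
    simp only [opTwo_apply] at h
    rw [structureSum, Finset.sum_eq_zero, Finset.sum_eq_zero, add_zero]
    · intro i hi
      refine long _ _ ?_ _
      simp only [List.length_cons, List.length_nil, Finset.mem_range] at hi
      simp only [List.length_append, List.length_take, List.length_cons, List.length_drop,
        List.length_nil]
      omega
    · intro i hi
      refine Finset.sum_eq_zero fun g _ => ?_
      simp only [List.length_cons, List.length_nil, Finset.mem_range] at hi
      obtain h2 | h2 | h2 : i < 2 ∨ i = 2 ∨ 2 < i := by omega
      · rw [long g _ (by simp; omega), mul_zero]
      · subst h2
        exact h g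
      · rw [long x _ (by simp; omega), zero_mul]
  | a :: b :: c :: d :: e :: l =>
    rw [structureSum]
    have hl : (a :: b :: c :: d :: e :: l).length = l.length + 5 := rfl
    generalize a :: b :: c :: d :: e :: l = t at hl
    rw [Finset.sum_eq_zero, Finset.sum_eq_zero, add_zero]
    · intro i hi
      rw [Finset.mem_range] at hi
      refine long _ _ ?_ _
      simp only [List.length_append, List.length_take, List.length_cons, List.length_drop]
      omega
    · intro i hi
      refine Finset.sum_eq_zero fun g _ => ?_
      rw [Finset.mem_range] at hi
      by_cases h3 : 3 ≤ i
      · rw [long x _ (by rw [List.length_take]; omega), zero_mul]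
      · rw [long g _ (by rw [List.length_drop]; omega), mul_zero]

end Relation

/-! ### Linearity over the idempotent rings -/

section Linearity

variable {n : ℕ}

open Classical in
theorem ofPure_mul_idem {m k : ℕ} (p : Pure m k) (s : State m k) :
    Blg.ofPure p * Blg.idem s = if p.tgt = s then Blg.ofPure p else 0 := by
  split_ifs with h
  · rw [Blg.idem, Blg.ofPure_mul_of_eq p (Pure.idem s) h]
    congr 1
    ext1
    · rfl
    · exact h.symm
    · exact add_zero _
  · exact Blg.ofPure_mul_of_ne p (Pure.idem s) h

open Classical in
theorem idem_mul_ofPure' {m k : ℕ} (s : State m k) (p : Pure m k) :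
    Blg.idem s * Blg.ofPure p = if s = p.src then Blg.ofPure p else 0 := by
  split_ifs with h
  · exact idem_mul_ofPure h
  · exact Blg.ofPure_mul_of_ne (Pure.idem s) p h

open Classical in
theorem opOne_idem_mul (x y : Gen n) (s : State (2 * (n + 1)) (n + 1)) (a : BAlg (n + 1)) :
    opOne x y (Blg.idem s * a) = if x.rgt = s then opOne x y a else 0 := by
  refine (Blg.hom_congr ((opOne x y).comp (AddMonoidHom.mulLeft (Blg.idem s)))
    (if x.rgt = s then opOne x y else 0) (fun p => ?_) a).trans (by split_ifs <;> rfl)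
  change opOne x y (Blg.idem s * Blg.ofPure p) = _
  rw [idem_mul_ofPure']
  split_ifs with h1 h2 h2
  · rfl
  · rw [opOne_apply, markedMin_one, if_neg fun h => h2 (h.src.symm.trans h1.symm)]
    rfl
  · rw [map_zero, opOne_apply, markedMin_one, if_neg fun h => h1 (h2.symm.trans h.src.symm)]
  · exact map_zero _

open Classical in
theorem opOne_mul_idem (x y : Gen n) (s : State (2 * (n + 1)) (n + 1)) (a : BAlg (n + 1)) :
    opOne x y (a * Blg.idem s) = if y.rgt = s then opOne x y a else 0 := by
  refine (Blg.hom_congr ((opOne x y).comp (AddMonoidHom.mulRight (Blg.idem s)))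
    (if y.rgt = s then opOne x y else 0) (fun p => ?_) a).trans (by split_ifs <;> rfl)
  change opOne x y (Blg.ofPure p * Blg.idem s) = _
  rw [ofPure_mul_idem]
  split_ifs with h1 h2 h2
  · rfl
  · rw [opOne_apply, markedMin_one, if_neg fun h => h2 (h.tgt.symm.trans h1)]
    rfl
  · rw [map_zero, opOne_apply, markedMin_one, if_neg fun h => h1 (h.tgt.trans h2)]
  · exact map_zero _

open Classical in
theorem opTwo_idem_mul (x y : Gen n) (s : State (2 * (n + 1)) (n + 1)) (a b : BAlg (n + 1)) :
    opTwo x y (Blg.idem s * a) b = if x.rgt = s then opTwo x y a b else 0 := by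
  refine (Blg.hom_congr (opTwo x y (Blg.idem s * a))
    (if x.rgt = s then opTwo x y a else 0) (fun q => ?_) b).trans (by split_ifs <;> rfl)
  refine (Blg.hom_congr (((opTwo x y).flip (Blg.ofPure q)).comp
    (AddMonoidHom.mulLeft (Blg.idem s)))
    (if x.rgt = s then (opTwo x y).flip (Blg.ofPure q) else 0) (fun p => ?_) a).trans
      (by split_ifs <;> rfl)
  change opTwo x y (Blg.idem s * Blg.ofPure p) (Blg.ofPure q) = _
  rw [idem_mul_ofPure']
  split_ifs with h1 h2 h2
  · rfl
  · rw [opTwo_apply, markedMin_two, if_neg fun h => h2 (h.src.symm.trans h1.symm)]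
    rfl
  · rw [map_zero, AddMonoidHom.flip_apply, opTwo_apply, markedMin_two,
      if_neg fun h => h1 (h2.symm.trans h.src.symm)]
    rfl
  · rw [map_zero]
    rfl

open Classical in
theorem opTwo_mul_idem (x y : Gen n) (s : State (2 * (n + 1)) (n + 1)) (a b : BAlg (n + 1)) :
    opTwo x y a (b * Blg.idem s) = if y.rgt = s then opTwo x y a b else 0 := by
  refine (Blg.hom_congr ((opTwo x y).flip (b * Blg.idem s))
    (if y.rgt = s then (opTwo x y).flip b else 0) (fun p => ?_) a).trans (by split_ifs <;> rfl)
  refine (Blg.hom_congr ((opTwo x y (Blg.ofPure p)).comp (AddMonoidHom.mulRight (Blg.idem s)))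
    (if y.rgt = s then opTwo x y (Blg.ofPure p) else 0) (fun q => ?_) b).trans
      (by split_ifs <;> rfl)
  change opTwo x y (Blg.ofPure p) (Blg.ofPure q * Blg.idem s) = _
  rw [ofPure_mul_idem]
  split_ifs with h1 h2 h2
  · rfl
  · rw [opTwo_apply, markedMin_two, if_neg fun h => h2 (h.tgt.symm.trans h1)]
    rfl
  · rw [map_zero, opTwo_apply, markedMin_two, if_neg fun h => h1 (h.tgt.trans h2)]
  · exact map_zero _

theorem opTwo_balanced (x y : Gen n) (s : State (2 * (n + 1)) (n + 1)) (a b : BAlg (n + 1)) :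
    opTwo x y (a * Blg.idem s) b = opTwo x y a (Blg.idem s * b) := by
  refine Blg.hom_congr (((opTwo x y).flip b).comp (AddMonoidHom.mulRight (Blg.idem s)))
    ((opTwo x y).flip (Blg.idem s * b)) (fun p => ?_) a
  refine Blg.hom_congr (opTwo x y (Blg.ofPure p * Blg.idem s))
    ((opTwo x y (Blg.ofPure p)).comp (AddMonoidHom.mulLeft (Blg.idem s))) (fun q => ?_) b
  change opTwo x y (Blg.ofPure p * Blg.idem s) (Blg.ofPure q) =
    opTwo x y (Blg.ofPure p) (Blg.idem s * Blg.ofPure q)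
  rw [ofPure_mul_idem, idem_mul_ofPure']
  split_ifs with h1 h2 h2
  · rfl
  · rw [map_zero, opTwo_apply, markedMin_two, if_neg fun h => h2 (h1.symm.trans h.mid)]
  · rw [map_zero, AddMonoidHom.zero_apply, opTwo_apply, markedMin_two,
      if_neg fun h => h1 (h.mid.trans h2.symm)]
  · rw [map_zero, map_zero, AddMonoidHom.zero_apply]

theorem pureOp_eq (x : Gen n) (ps : List (Pure (2 * (n + 1)) (n + 1))) (y : Gen n) :
    pureOp arrowCoef x ps y = 0 ∨ ∃ d, Graded x d y ∧ pureOp arrowCoef x ps y = term x d y := by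
  classical
  match ps with
  | [] =>
    rw [pureOp_nil]
    split_ifs with h
    exacts [.inr ⟨_, h.graded, rfl⟩, .inl rfl]
  | [p] =>
    rw [pureOp_one]
    split_ifs with h
    exacts [.inr ⟨_, h.graded, rfl⟩, .inl rfl]
  | [p, q] =>
    rw [pureOp_two]
    split_ifs with h
    exacts [.inr ⟨_, h.graded, rfl⟩, .inl rfl]
  | p :: q :: r :: ps => exact .inl (pureOp_long x p q r ps y)

/-- An additive map that fixes all terms which respect the gradings fixes the operations. -/
theorem map_markedMin_eq_self (φ : BAlgWZ n →+ BAlgWZ n) {x y : Gen n}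
    (h : ∀ d, Graded x d y → φ (term x d y) = term x d y) (l : List (BAlg (n + 1))) :
    φ (markedMin n x l y) = markedMin n x l y := by
  rw [markedMin_eq, map_multilinearExt]
  congr 1
  funext ps
  rcases pureOp_eq x ps y with h0 | ⟨d, h1, h2⟩
  · rw [h0, map_zero]
  · rw [h2, h d h1]

theorem Gen.idem_lft (x : Gen n) :
    Blg.idem x.lft = Blg.elt (2 * n) n (psi x.rgt.1) (psi x.rgt.1) 0 :=
  Blg.idem_eq_elt _

theorem admissible_zero {m : ℕ} (x : Finset (Fin (m + 1))) : Admissible x x 0 :=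
  fun i => ⟨by simp, by simp, ⟨level x i, by simp⟩⟩

theorem incl_mul_monomial (a b : BAlg n) (p q : ℕ) :
    incl n a * monomial p (monomial q b) = monomial p (monomial q (a * b)) := by
  rw [incl, RingHom.comp_apply, C_mul_monomial, C_mul_monomial]

theorem monomial_mul_incl (a b : BAlg n) (p q : ℕ) :
    monomial p (monomial q b) * incl n a = monomial p (monomial q (b * a)) := by
  rw [incl, RingHom.comp_apply, monomial_mul_C, monomial_mul_C]

theorem Graded.idem_mul_term {x y : Gen n} {d : Fin (2 * (n + 1)) → ℕ} (h : Graded x d y) :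
    incl n (Blg.idem x.lft) * term x d y = term x d y := by
  rw [term, incl_mul_monomial, Gen.idem_lft, Blg.elt_mul (card_psi _ x.rgt.2 x.preferred)
    (card_psi _ x.rgt.2 x.preferred) (card_psi _ y.rgt.2 y.preferred) (admissible_zero _) h.adm.psi,
    zero_add]

theorem Graded.term_mul_idem {x y : Gen n} {d : Fin (2 * (n + 1)) → ℕ} (h : Graded x d y) :
    term x d y * incl n (Blg.idem y.lft) = term x d y := by
  rw [term, monomial_mul_incl, Gen.idem_lft, Blg.elt_mul (card_psi _ x.rgt.2 x.preferred)
    (card_psi _ y.rgt.2 y.preferred) (card_psi _ y.rgt.2 y.preferred) h.adm.psi (admissible_zero _),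
    add_zero]

theorem markedMin_isDAOperation (n : ℕ) :
    IsDAOperation Blg.idem (fun t => incl n (Blg.idem t)) Gen.rgt Gen.lft (markedMin n) where
  map_add x u a b v y := markedMin_add x u a b v y
  map_smul x u c a v y := multilinearExt_smul _ u c a v
  balanced_first x s a v y := by
    match v with
    | [] => exact (opOne_idem_mul x y s a).trans (by congr)
    | [b] => exact (opTwo_idem_mul x y s a b).trans (by congr)
    | b :: c :: v =>
      rw [markedMin_long _ _ (by simp), markedMin_long _ _ (by simp), ite_self]
  balanced x u a s b v y := by
    match u, v with
    | [], [] => exact opTwo_balanced x y s a b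
    | [], c :: v => rw [markedMin_long _ _ (by simp), markedMin_long _ _ (by simp)]
    | c :: u, v =>
      rw [markedMin_long _ _ (by simp; omega), markedMin_long _ _ (by simp; omega)]
  right_linear x u a s y := by
    match u with
    | [] => exact (opOne_mul_idem x y s a).trans (by congr)
    | [b] => exact (opTwo_mul_idem x y s b a).trans (by congr)
    | b :: c :: u =>
      rw [markedMin_long _ _ (by simp), markedMin_long _ _ (by simp), ite_self]
  right_linear_nil x y h := by
    classical
    rw [markedMin_nil, if_neg fun hs => h hs.rgt]
  left_linear x l y := map_markedMin_eq_self (AddMonoidHom.mulLeft _)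
    (fun _ h => h.idem_mul_term) l
  mem_tensor x l y := map_markedMin_eq_self (AddMonoidHom.mulRight _)
    (fun _ h => h.term_mul_idem) l

end Linearity

/-! ### Central elements -/

section Diagonal

variable {m k : ℕ}

/-- The sum over all idempotent states `x` of the pure elements from `x` to `x` with the doubled
weights `d`. -/
def Blg.diag (m k : ℕ) (d : Fin m → ℕ) : Blg m k := ∑ x : State m k, Blg.elt m k x.1 x.1 d

/-- The pure element from `x` to `x` with the doubled weights `d`. -/
def Pure.loop (x : State m k) (d : Fin m → ℕ) (hd : ∀ i, Even (d i)) : Pure m k where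
  src := x
  tgt := x
  dwt := d
  adm := fun i => ⟨Nat.le_add_right _ _, Nat.le_add_right _ _, (Even.add_self _).add (hd i)⟩

theorem Blg.diag_eq {d : Fin m → ℕ} (hd : ∀ i, Even (d i)) :
    Blg.diag m k d = ∑ x : State m k, Blg.ofPure (Pure.loop x d hd) :=
  Finset.sum_congr rfl fun x _ => Blg.elt_eq x.2 x.2 (Pure.loop x d hd).adm

theorem Blg.one_eq_diag : (1 : Blg m k) = Blg.diag m k 0 := by
  rw [Blg.one_eq, Blg.diag_eq (d := 0) (fun i => Even.zero)]
  rfl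

theorem Blg.U_eq_diag (i : Fin m) : Blg.U m k i = Blg.diag m k (Pi.single i 2) := rfl

theorem even_single (i j : Fin m) : Even ((Pi.single i 2 : Fin m → ℕ) j) := by
  by_cases h : j = i
  · subst h; simp
  · simp [h]

theorem Blg.ofPure_mul_diag (p : Pure m k) {d : Fin m → ℕ} (hd : ∀ i, Even (d i)) :
    Blg.ofPure p * Blg.diag m k d = Blg.ofPure (p.mul (Pure.loop p.tgt d hd) rfl) := by
  rw [Blg.diag_eq hd, Finset.mul_sum, Finset.sum_eq_single p.tgt]
  · exact Blg.ofPure_mul_of_eq _ _ rfl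
  · intro x _ hx
    exact Blg.ofPure_mul_of_ne _ _ (Ne.symm hx)
  · intro h
    exact absurd (Finset.mem_univ _) h

theorem Blg.diag_mul_ofPure (p : Pure m k) {d : Fin m → ℕ} (hd : ∀ i, Even (d i)) :
    Blg.diag m k d * Blg.ofPure p = Blg.ofPure (p.mul (Pure.loop p.tgt d hd) rfl) := by
  rw [Blg.diag_eq hd, Finset.sum_mul, Finset.sum_eq_single p.src]
  · rw [Blg.ofPure_mul_of_eq (Pure.loop p.src d hd) p rfl]
    congr 1
    ext1
    · rfl
    · rfl
    · exact add_comm _ _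
  · intro x _ hx
    exact Blg.ofPure_mul_of_ne _ _ hx
  · intro h
    exact absurd (Finset.mem_univ _) h

theorem Blg.diag_mul_diag {d e : Fin m → ℕ} (hd : ∀ i, Even (d i)) (he : ∀ i, Even (e i)) :
    Blg.diag m k d * Blg.diag m k e = Blg.diag m k (d + e) := by
  rw [Blg.diag_eq hd, Finset.sum_mul,
    Blg.diag_eq (d := d + e) fun i => (hd i).add (he i)]
  exact Finset.sum_congr rfl fun x _ => Blg.ofPure_mul_diag _ he

theorem Blg.diag_mem_center {d : Fin m → ℕ} (hd : ∀ i, Even (d i)) :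
    Blg.diag m k d ∈ Subring.center (Blg m k) := by
  rw [Subring.mem_center_iff]
  intro a
  refine Blg.hom_congr (AddMonoidHom.mulRight (Blg.diag m k d))
    (AddMonoidHom.mulLeft (Blg.diag m k d)) (fun p => ?_) a
  exact (Blg.ofPure_mul_diag p hd).trans (Blg.diag_mul_ofPure p hd).symm

theorem Blg.U_mul_U (i j : Fin m) :
    Blg.U m k i * Blg.U m k j = Blg.diag m k (Pi.single i 2 + Pi.single j 2) := by
  rw [Blg.U_eq_diag, Blg.U_eq_diag, Blg.diag_mul_diag (even_single i) (even_single j)]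

theorem curvature_mem_center (M : Finset (Finset (Fin m))) :
    curvature k M ∈ Subring.center (Blg m k) := by
  refine sum_mem fun i _ => sum_mem fun j _ => ?_
  split_ifs
  · exact mul_mem (Blg.diag_mem_center (even_single i)) (Blg.diag_mem_center (even_single j))
  · exact zero_mem _

end Diagonal

/-! ### Equivariance -/

section Equivariance

variable {n : ℕ}

open Classical in
/-- The conditions for `a`-`b`-equivariance, in a form that is additive in `a` and `b`. -/
structure ActsBy (a : BAlg (n + 1)) (b : BAlg n) : Prop where
  one : ∀ x y : Gen n, opOne x y a = if x = y then incl n b * incl n (Blg.idem x.lft) else 0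
  two_left : ∀ (x y : Gen n) (c : BAlg (n + 1)), opTwo x y a c = 0
  two_right : ∀ (x y : Gen n) (c : BAlg (n + 1)), opTwo x y c a = 0

theorem ActsBy.zero : ActsBy (0 : BAlg (n + 1)) (0 : BAlg n) where
  one x y := by rw [map_zero, map_zero, zero_mul, ite_self]
  two_left x y c := by rw [map_zero, AddMonoidHom.zero_apply]
  two_right x y c := map_zero _

theorem ActsBy.add {a a' : BAlg (n + 1)} {b b' : BAlg n} (h : ActsBy a b) (h' : ActsBy a' b') :
    ActsBy (a + a') (b + b') where
  one x y := by
    rw [map_add, h.one, h'.one, map_add, add_mul]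
    split_ifs
    · rfl
    · exact add_zero _
  two_left x y c := by
    rw [map_add, AddMonoidHom.add_apply, h.two_left, h'.two_left, add_zero]
  two_right x y c := by rw [map_add, h.two_right, h'.two_right, add_zero]

theorem ActsBy.sum {ι : Type} (s : Finset ι) {a : ι → BAlg (n + 1)} {b : ι → BAlg n}
    (h : ∀ i, ActsBy (a i) (b i)) : ActsBy (∑ i ∈ s, a i) (∑ i ∈ s, b i) := by
  classical
  induction s using Finset.induction_on with
  | empty => exact ActsBy.zero
  | insert i s hi ih =>
    rw [Finset.sum_insert hi, Finset.sum_insert hi]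
    exact (h i).add ih

theorem ActsBy.isEquivariant {a : BAlg (n + 1)} {b : BAlg n} (h : ActsBy a b) :
    IsEquivariant (fun t => incl n (Blg.idem t)) Gen.lft a (incl n b) (markedMin n) := by
  refine ⟨fun x y => h.one x y, fun x l y hl ha => ?_⟩
  match l with
  | [] | [_] => simp at hl
  | [c, d] =>
    rcases List.mem_pair.1 ha with rfl | rfl
    · exact h.two_left x y d
    · exact h.two_right x y c
  | c :: d :: e :: l => exact markedMin_long _ _ (by simp) _

/-- In a turn, each input has a positive weight at exactly one of the strands `1` and `2`. -/
theorem opTwo_diag {d : Fin (2 * (n + 1)) → ℕ} (hd : ∀ i, Even (d i))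
    (h : d (strand1 n) = 0 ↔ d (strand2 n) = 0) (x y : Gen n) (c : BAlg (n + 1)) :
    opTwo x y (Blg.diag _ _ d) c = 0 ∧ opTwo x y c (Blg.diag _ _ d) = 0 := by
  classical
  rw [Blg.diag_eq hd]
  have e1 : ∀ s, (Pure.loop (k := n + 1) s d hd).dwt1 = d (strand1 n) := fun _ => rfl
  have e2 : ∀ s, (Pure.loop (k := n + 1) s d hd).dwt2 = d (strand2 n) := fun _ => rfl
  constructor
  · refine Blg.hom_congr (opTwo x y (∑ s, Blg.ofPure (Pure.loop s d hd))) 0 (fun p => ?_) c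
    rw [map_sum, AddMonoidHom.finsetSum_apply]
    refine Finset.sum_eq_zero fun s _ => ?_
    rw [opTwo_apply, markedMin_two, if_neg]
    intro hs
    have := hs.turn.2.2
    rw [e1, e2] at this
    omega
  · rw [← AddMonoidHom.flip_apply]
    refine Blg.hom_congr _ 0 (fun p => ?_) c
    rw [AddMonoidHom.flip_apply, map_sum]
    refine Finset.sum_eq_zero fun s _ => ?_
    rw [opTwo_apply, markedMin_two, if_neg]
    intro hs
    have := hs.turn.2.2
    rw [e1, e2] at this
    omega

/-- No arrow has an input with positive weights at both strands. -/
theorem actsBy_zero_of_pos {d : Fin (2 * (n + 1)) → ℕ} (hd : ∀ i, Even (d i))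
    (h1 : 0 < d (strand1 n)) (h2 : 0 < d (strand2 n)) : ActsBy (Blg.diag _ _ d) (0 : BAlg n) where
  one x y := by
    classical
    rw [map_zero, zero_mul, ite_self, Blg.diag_eq hd, map_sum]
    refine Finset.sum_eq_zero fun s _ => ?_
    rw [opOne_apply, markedMin_one, if_neg]
    intro hs
    rcases hs.allowed.1 with h | h
    · exact h1.ne' h
    · exact h2.ne' h
  two_left x y c := (opTwo_diag hd (by omega) x y c).1
  two_right x y c := (opTwo_diag hd (by omega) x y c).2

theorem actsBy_diag {d : Fin (2 * (n + 1)) → ℕ} (hd : ∀ i, Even (d i))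
    (h1 : d (strand1 n) = 0) (h2 : d (strand2 n) = 0) :
    ActsBy (Blg.diag _ _ d) (Blg.diag (2 * n) n fun i => d (shift i)) where
  one x y := by
    classical
    rw [Blg.diag_eq hd, map_sum]
    simp only [opOne_apply, markedMin_one]
    have key : ∀ s, Step x (Pure.loop s d hd) y ↔ x = y ∧ s = x.rgt := by
      intro s
      constructor
      · intro h
        exact ⟨Gen.ext h.sheet (h.src.symm.trans h.tgt), h.src⟩
      · rintro ⟨rfl, rfl⟩
        have e1 : (Pure.loop x.rgt d hd).dwt1 = 0 := h1
        have e2 : (Pure.loop x.rgt d hd).dwt2 = 0 := h2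
        exact ⟨rfl, rfl, rfl, by unfold Pure.Allowed; omega⟩
    simp only [key]
    by_cases hxy : x = y
    · subst hxy
      simp only [true_and, if_true]
      rw [Finset.sum_ite_eq' Finset.univ x.rgt, if_pos (Finset.mem_univ _), ← map_mul, Blg.idem,
        Blg.diag_mul_ofPure _ fun i => hd (shift i)]
      change term x d x = _
      rw [term, h1, h2, zero_add, zero_add, Nat.sub_self, Nat.sub_self]
      refine congrArg (incl n) ((Blg.elt_eq (card_psi _ x.rgt.2 x.preferred)
        (card_psi _ x.rgt.2 x.preferred)
        (Pure.loop x.lft (fun i => d (shift i)) fun i => hd (shift i)).adm).trans ?_)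
      congr 1
      ext1
      · rfl
      · rfl
      · exact (zero_add _).symm
    · simp only [hxy, false_and, if_false, Finset.sum_const_zero]
  two_left x y c := (opTwo_diag hd (by omega) x y c).1
  two_right x y c := (opTwo_diag hd (by omega) x y c).2

theorem actsBy_one : ActsBy (1 : BAlg (n + 1)) (1 : BAlg n) := by
  rw [Blg.one_eq_diag, Blg.one_eq_diag]
  exact actsBy_diag (fun _ => Even.zero) rfl rfl

theorem even_single_add (i j l : Fin (2 * (n + 1))) :
    Even ((Pi.single i 2 + Pi.single j 2 : Fin (2 * (n + 1)) → ℕ) l) :=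
  (even_single i l).add (even_single j l)

theorem strand1_ne_shift (i : Fin (2 * n)) : strand1 n ≠ shift i := fun h => by
  simp [strand1, shift, Fin.ext_iff] at h

theorem strand2_ne_shift (i : Fin (2 * n)) : strand2 n ≠ shift i := fun h => by
  simp [strand2, shift, Fin.ext_iff] at h

theorem shift_injective : Function.Injective (shift (n := n)) := fun i j h => by
  simp only [shift, Fin.ext_iff] at h ⊢
  omega

theorem actsBy_U_strands : ActsBy (Blg.U (2 * (n + 1)) (n + 1) (strand1 n) *
    Blg.U (2 * (n + 1)) (n + 1) (strand2 n)) (0 : BAlg n) := by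
  rw [Blg.U_mul_U]
  refine actsBy_zero_of_pos (even_single_add _ _) ?_ ?_
  · rw [Pi.add_apply, Pi.single_eq_same]; omega
  · rw [Pi.add_apply, Pi.single_eq_same]; omega

theorem actsBy_U_shift (r s : Fin (2 * n)) : ActsBy (Blg.U (2 * (n + 1)) (n + 1) (shift r) *
    Blg.U (2 * (n + 1)) (n + 1) (shift s)) (Blg.U (2 * n) n r * Blg.U (2 * n) n s) := by
  rw [Blg.U_mul_U, Blg.U_mul_U]
  have e : ∀ r i : Fin (2 * n), (Pi.single (shift r) 2 : Fin (2 * (n + 1)) → ℕ) (shift i) =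
      (Pi.single r 2 : Fin (2 * n) → ℕ) i := fun r i => by
    simp only [Pi.single_apply, shift_injective.eq_iff]
  have h := actsBy_diag (even_single_add (shift r) (shift s))
    (by simp [strand1_ne_shift]) (by simp [strand2_ne_shift])
  simp only [Pi.add_apply, e] at h
  exact h

/-! ### Curvature -/

theorem sum_strands {E : Type} [AddCommMonoid E] (f : Fin (2 * (n + 1)) → E) :
    ∑ i, f i = f (strand1 n) + (f (strand2 n) + ∑ i, f (shift i)) :=
  (Fin.sum_univ_succ (n := 2 * n + 1) f).trans
    (congrArg (f (strand1 n) + ·) (Fin.sum_univ_succ (n := 2 * n) fun i => f i.succ))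

theorem IsMatching.eq_of_mem {m : ℕ} {M : Finset (Finset (Fin m))} (h : IsMatching M)
    {i : Fin m} {s t : Finset (Fin m)} (hs : s ∈ M) (ht : t ∈ M) (his : i ∈ s) (hit : i ∈ t) :
    s = t := (h.2 i).unique ⟨hs, his⟩ ⟨ht, hit⟩

/-- The pair of the strands `1` and `2` contributes `U_1 U_2`, and all other pairs of `M₁` come from
`M₂`. -/
theorem curvature_eq {M₁ : Finset (Finset (Fin (2 * (n + 1))))} {M₂ : Finset (Finset (Fin (2 * n)))}
    (h₁ : IsMatching M₁) (h₁₂ : {strand1 n, strand2 n} ∈ M₁)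
    (h : ∀ i j : Fin (2 * n), {i, j} ∈ M₂ ↔ {shift i, shift j} ∈ M₁) :
    curvature (n + 1) M₁ = Blg.U _ _ (strand1 n) * Blg.U _ _ (strand2 n) +
      ∑ i, ∑ j, if i < j ∧ {i, j} ∈ M₂ then
        Blg.U (2 * (n + 1)) (n + 1) (shift i) * Blg.U _ _ (shift j) else 0 := by
  have a1 : strand1 n < strand2 n := Nat.zero_lt_one
  have n1 : ∀ j, {strand1 n, shift j} ∉ M₁ := fun j hj => by
    have h2 := h₁.eq_of_mem hj h₁₂ (i := strand1 n) (by simp) (by simp)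
    have h3 : shift j ∈ ({strand1 n, strand2 n} : Finset _) := h2 ▸ by simp
    simp [(strand1_ne_shift j).symm, (strand2_ne_shift j).symm] at h3
  have n2 : ∀ j, {strand2 n, shift j} ∉ M₁ := fun j hj => by
    have h2 := h₁.eq_of_mem hj h₁₂ (i := strand2 n) (by simp) (by simp)
    have h3 : shift j ∈ ({strand1 n, strand2 n} : Finset _) := h2 ▸ by simp
    simp [(strand1_ne_shift j).symm, (strand2_ne_shift j).symm] at h3
  have l1 : ∀ j, ¬ shift j < strand1 n := fun j => Nat.not_lt_zero _
  have l2 : ∀ j, ¬ shift j < strand2 n := fun j hj => by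
    simp only [shift, strand2, Fin.lt_def] at hj; omega
  have l3 : ∀ i j : Fin (2 * n), shift i < shift j ↔ i < j := fun i j => by
    simp only [shift, Fin.lt_def]; omega
  rw [curvature]
  simp only [sum_strands, lt_self_iff_false, a1, a1.not_gt, n1, n2, l1, l2, l3, h₁₂, ← h, and_false,
    false_and, and_true, if_true, if_false, Finset.sum_const_zero, zero_add, add_zero]

theorem actsBy_curvature {M₁ : Finset (Finset (Fin (2 * (n + 1))))}
    {M₂ : Finset (Finset (Fin (2 * n)))} (h₁ : IsMatching M₁) (h₁₂ : {strand1 n, strand2 n} ∈ M₁)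
    (h : ∀ i j : Fin (2 * n), {i, j} ∈ M₂ ↔ {shift i, shift j} ∈ M₁) :
    ActsBy (curvature (n + 1) M₁) (curvature n M₂) := by
  have key : ∀ i j : Fin (2 * n), ActsBy (if i < j ∧ {i, j} ∈ M₂ then
      Blg.U (2 * (n + 1)) (n + 1) (shift i) * Blg.U _ _ (shift j) else 0)
      (if i < j ∧ {i, j} ∈ M₂ then Blg.U (2 * n) n i * Blg.U _ _ j else 0) := by
    intro i j
    split_ifs
    · exact actsBy_U_shift i j
    · exact ActsBy.zero
  have hs := actsBy_U_strands.add
    (ActsBy.sum Finset.univ fun i => ActsBy.sum Finset.univ fun j => key i j)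
  rw [curvature_eq h₁ h₁₂ h, curvature]
  rwa [zero_add] at hs

theorem incl_mem_center {a : BAlg n} (ha : a ∈ Set.center (BAlg n)) :
    incl n a ∈ Set.center (BAlgWZ n) := by
  rw [Semigroup.mem_center_iff] at ha ⊢
  intro f
  refine Polynomial.ext fun i => Polynomial.ext fun j => ?_
  rw [incl, RingHom.comp_apply, coeff_mul_C, coeff_C_mul, coeff_mul_C, coeff_C_mul, ha]

end Equivariance

/-! ### Boundedness -/

section Bounded

variable {n : ℕ}

theorem Ty.deg_le (t : Ty) : t.wdeg ≤ 2 ∧ t.zdeg ≤ 2 := by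
  cases t <;> simp [Ty.wdeg, Ty.zdeg]

theorem Blg.coeffs_ofPure_ne_zero {m k : ℕ} {p : Pure m k} {b : {b : Pure m k // ¬ b.InJ}}
    (h : Blg.coeffs (Blg.ofPure p) b ≠ 0) : b.1 = p := by
  by_cases hp : p.InJ
  · rw [Blg.ofPure_of_inJ p hp] at h
    exact absurd rfl h
  · rw [Blg.ofPure_of_not p hp] at h
    by_contra hne
    exact h (Finsupp.single_eq_of_ne fun e => hne (congrArg Subtype.val e))

/-- The gradings bound the weights of the inputs by the degree of a term. The constant `4` accounts
for the degrees of the types, at most `2` at each strand. -/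
theorem Graded.sum_le {x y : Gen n} {d : Fin (2 * (n + 1)) → ℕ} (h : Graded x d y) {p q : ℕ}
    {b : {b : Pure (2 * n) n // ¬ b.InJ}}
    (hb : Blg.coeffs (((term x d y).coeff p).coeff q) b ≠ 0) :
    ∑ i, d i ≤ b.1.total + 2 * p + 2 * q + 4 := by
  rw [term, coeff_monomial] at hb
  split_ifs at hb with hp
  · rw [coeff_monomial] at hb
    split_ifs at hb with hq
    · rw [Blg.elt_eq (card_psi _ x.rgt.2 x.preferred) (card_psi _ y.rgt.2 y.preferred) h.adm.psi]
        at hb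
      rw [Blg.coeffs_ofPure_ne_zero hb, sum_strands]
      change _ ≤ (∑ i, d (shift i)) + 2 * p + 2 * q + 4
      have := y.ty.deg_le
      have := Nat.even_iff.1 h.w_even
      have := Nat.even_iff.1 h.z_even
      have := h.w_le
      have := h.z_le
      omega
    · exact absurd rfl hb
  · exact absurd rfl hb

theorem markedMin_isBounded (n : ℕ) : IsBounded (markedMin n) := by
  classical
  refine fun M => ⟨M + 4, fun x y ps p q b hb hM => ?_⟩
  match ps with
  | [] => exact Nat.zero_le _
  | [r] =>
    rw [List.map_singleton, markedMin_one] at hb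
    split_ifs at hb with h
    · have := h.graded.sum_le hb
      change r.total + 0 ≤ _
      rw [Pure.total]
      omega
    · exact absurd rfl hb
  | [r, s] =>
    rw [List.map_cons, List.map_singleton, markedMin_two] at hb
    split_ifs at hb with h
    · have := h.graded.sum_le hb
      simp only [Pi.add_apply, Finset.sum_add_distrib] at this
      change r.total + (s.total + 0) ≤ _
      rw [Pure.total, Pure.total]
      omega
    · exact absurd rfl hb
  | _ :: _ :: _ :: _ =>
    rw [markedMin_long _ _ (by simp)] at hb
    exact absurd rfl hb

end Bounded

/-! ### Change of the output algebra -/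

section Transport

variable {S T G A B B' : Type} [Ring B] [Ring B'] {eA : S → A} {eB : T → B} {rgt : G → S}
  {lft : G → T} {δ : G → List A → G → B} (φ : B →+* B')

theorem IsEquivariant.map {a : A} {b : B} (h : IsEquivariant eB lft a b δ) :
    IsEquivariant (fun t => φ (eB t)) lft a (φ b) fun x l y => φ (δ x l y) :=
  ⟨fun x y => (congrArg φ (h.1 x y)).trans (by rw [apply_ite φ, map_zero, map_mul]),
    fun x l y hl ha => (congrArg φ (h.2 x l y hl ha)).trans (map_zero φ)⟩

variable [Ring A]

theorem map_structureSum [Fintype G] (x : G) (l : List A) (y : G) :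
    φ (structureSum δ x l y) = structureSum (fun x l y => φ (δ x l y)) x l y := by
  simp only [structureSum, map_add, map_sum, map_mul]

variable [Algebra (ZMod 2) A] [Algebra (ZMod 2) B] [Algebra (ZMod 2) B']

theorem IsDAOperation.map (h : IsDAOperation eA eB rgt lft δ) :
    IsDAOperation eA (fun t => φ (eB t)) rgt lft fun x l y => φ (δ x l y) where
  map_add x u a b v y := by rw [h.map_add, _root_.map_add]
  map_smul x u c a v y := by
    rw [h.map_smul]
    exact ZMod.map_smul φ _ _
  balanced_first x s a v y := by rw [h.balanced_first, apply_ite φ, map_zero]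
  balanced x u a s b v y := by rw [h.balanced]
  right_linear x u a s y := by rw [h.right_linear, apply_ite φ, map_zero]
  right_linear_nil x y hxy := by rw [h.right_linear_nil x y hxy, map_zero]
  left_linear x l y := by rw [← map_mul, h.left_linear]
  mem_tensor x l y := by rw [← map_mul, h.mem_tensor]

/-- An equivariant bimodule satisfies the curved structure relation if it satisfies the uncurved
one: the curvature only contributes to the relation without inputs. -/
theorem IsTypeDA.isCurved [Fintype G] {κA : A} {κB : B} (h : IsTypeDA eA eB rgt lft δ)
    (hA : κA ∈ Set.center A) (hB : κB ∈ Set.center B) (he : IsEquivariant eB lft κA κB δ) :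
    IsCurvedTypeDA eA eB rgt lft κA κB δ where
  toIsDAOperation := h.toIsDAOperation
  center_left := hB
  center_right := hA
  relation x l y := by
    rw [h.relation, zero_add]
    by_cases hl : l = []
    · subst hl
      simp only [List.length_nil, zero_add, Finset.sum_range_one, List.take_nil, List.drop_nil,
        List.nil_append, true_and, he.1]
      by_cases hxy : x = y <;> simp [hxy]
    · rw [if_neg fun hc => hl hc.1]
      refine Finset.sum_eq_zero fun i _ => he.2 _ _ _ ?_ (by simp)
      have := List.length_pos_of_ne_nil hl
      have h1 : (l.take i).length + (l.drop i).length = l.length := by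
        rw [← List.length_append, List.take_append_drop]
      rw [List.length_append, List.length_cons]
      omega

end Transport

/-! ### The specialization -/

section Specialization

variable {n : ℕ}

/-- The specialization at `w = z = 0`, as a ring homomorphism. -/
def specializeHom (n : ℕ) : BAlgWZ n →+* BAlg n := constantCoeff.comp constantCoeff

theorem specializeHom_apply (f : BAlgWZ n) : specializeHom n f = specialize f := by
  rw [specialize, ← coeff_zero_eq_eval_zero, ← coeff_zero_eq_eval_zero]
  rfl

theorem specializeHom_incl (b : BAlg n) : specializeHom n (incl n b) = b := by
  rw [specializeHom, incl, RingHom.comp_apply, RingHom.comp_apply]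
  simp

/-- The arrows of the specialized diagram are those with the coefficient `1` of the unspecialized
one, and all other arrows of the latter have a positive power of `w` or `z`. -/
theorem hatArrow_iff (s : Ty) (ls : List Letter) (t : Ty) :
    hatArrow s ls t = true ↔ arrow s ls t = some (0, 0) := by
  constructor
  · intro h
    unfold hatArrow at h
    split at h <;> first | rfl | simp_all [arrow]
  · intro h
    unfold arrow at h
    split at h <;> simp_all [hatArrow]

theorem specializeHom_arrowCoef (s : Ty) (ls : List Letter) (t : Ty) (b : BAlg n) :
    specializeHom n (arrowCoef s ls t b) = if hatArrow s ls t then b else 0 := by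
  have hm : ∀ p q : ℕ, specializeHom n (monomial p (monomial q b)) =
      if p = 0 ∧ q = 0 then b else 0 := by
    intro p q
    change (((monomial p (monomial q b) : BAlgWZ n).coeff 0).coeff 0) = _
    rw [coeff_monomial]
    by_cases hp : p = 0
    · rw [if_pos hp, coeff_monomial]
      simp only [hp, true_and]
    · rw [if_neg hp, if_neg fun h => hp h.1, coeff_zero]
  simp only [hatArrow_iff, arrowCoef]
  cases arrow s ls t with
  | none => simp
  | some r => simp [hm, Prod.ext_iff]

theorem specializeHom_markedMin (x : Gen n) (l : List (BAlg (n + 1))) (y : Gen n) :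
    specializeHom n (markedMin n x l y) = markedMinHat n x l y := by
  rw [markedMin_eq, markedMinHat]
  refine (map_multilinearExt (specializeHom n).toAddMonoidHom _ l).trans ?_
  congr 1
  funext ps
  change specializeHom n (pureOp arrowCoef x ps y) = _
  rw [pureOp, pureOp]
  split_ifs
  · cases ps.mapM letter with
    | none => exact map_zero _
    | some ls => exact specializeHom_arrowCoef _ _ _ _
  · exact map_zero _

theorem markedMinHat_eq :
    markedMinHat n = fun x l y => specializeHom n (markedMin n x l y) := by
  funext x l y
  exact (specializeHom_markedMin x l y).symm

theorem markedMinHat_isBounded (n : ℕ) : IsBounded fun x l y => incl n (markedMinHat n x l y) := by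
  intro M
  obtain ⟨N, hN⟩ := markedMin_isBounded n M
  refine ⟨N, fun x y ps p q b hb hM => hN x y ps 0 0 b ?_ (by omega)⟩
  simp only [incl, RingHom.comp_apply] at hb
  rw [coeff_C] at hb
  split_ifs at hb
  · rw [coeff_C] at hb
    split_ifs at hb
    · rwa [markedMinHat_eq] at hb
    · exact absurd rfl hb
  · exact absurd rfl hb

theorem markedMin_isTypeDA (n : ℕ) :
    IsTypeDA Blg.idem (fun t => incl n (Blg.idem t)) Gen.rgt Gen.lft (markedMin n) where
  toIsDAOperation := markedMin_isDAOperation n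
  relation := markedMin_relation

theorem markedMinHat_isTypeDA (n : ℕ) :
    IsTypeDA Blg.idem Blg.idem Gen.rgt Gen.lft (markedMinHat n) where
  toIsDAOperation := by
    have h := (markedMin_isDAOperation n).map (specializeHom n)
    simp only [specializeHom_incl] at h
    rwa [markedMinHat_eq]
  relation x l y := by
    rw [markedMinHat_eq, ← map_structureSum, markedMin_relation, map_zero]

theorem ActsBy.isEquivariant_hat {a : BAlg (n + 1)} {b : BAlg n} (h : ActsBy a b) :
    IsEquivariant Blg.idem Gen.lft a b (markedMinHat n) := by
  have h' := h.isEquivariant.map (specializeHom n)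
  simp only [specializeHom_incl] at h'
  rwa [markedMinHat_eq]

end Specialization

end BorderedLink

end

open BorderedLink in
theorem mainTheorem8 (n : ℕ) :
    -- the bimodule over `B(n)[w,z]` and `B(n+1)`
    (IsTypeDA Blg.idem (fun t => incl n (Blg.idem t)) Gen.rgt Gen.lft (markedMin n) ∧
      IsUnital (fun t => incl n (Blg.idem t)) Gen.lft (markedMin n) ∧
      IsBounded (markedMin n) ∧
      IsAnnihilatedBy (fun t => incl n (Blg.idem t)) Gen.lft
        (Blg.U (2 * (n + 1)) (n + 1) (strand1 n) * Blg.U (2 * (n + 1)) (n + 1) (strand2 n))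
        (markedMin n) ∧
      ∀ r s : Fin (2 * n), IsEquivariant (fun t => incl n (Blg.idem t)) Gen.lft
        (Blg.U (2 * (n + 1)) (n + 1) (shift r) * Blg.U (2 * (n + 1)) (n + 1) (shift s))
        (incl n (Blg.U (2 * n) n r * Blg.U (2 * n) n s)) (markedMin n)) ∧
    -- the bimodule over `B(n)` and `B(n+1)`
    (IsTypeDA Blg.idem Blg.idem Gen.rgt Gen.lft (markedMinHat n) ∧
      IsUnital Blg.idem Gen.lft (markedMinHat n) ∧
      IsBounded (fun x l y => incl n (markedMinHat n x l y)) ∧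
      IsAnnihilatedBy Blg.idem Gen.lft
        (Blg.U (2 * (n + 1)) (n + 1) (strand1 n) * Blg.U (2 * (n + 1)) (n + 1) (strand2 n))
        (markedMinHat n) ∧
      ∀ r s : Fin (2 * n), IsEquivariant Blg.idem Gen.lft
        (Blg.U (2 * (n + 1)) (n + 1) (shift r) * Blg.U (2 * (n + 1)) (n + 1) (shift s))
        (Blg.U (2 * n) n r * Blg.U (2 * n) n s) (markedMinHat n)) ∧
    -- both are curved bimodules
    (∀ (M₁ : Finset (Finset (Fin (2 * (n + 1))))) (M₂ : Finset (Finset (Fin (2 * n)))),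
      IsMatching M₁ → IsMatching M₂ → {strand1 n, strand2 n} ∈ M₁ →
      (∀ i j : Fin (2 * n), {i, j} ∈ M₂ ↔ {shift i, shift j} ∈ M₁) →
      IsCurvedTypeDA Blg.idem (fun t => incl n (Blg.idem t)) Gen.rgt Gen.lft
        (curvature (n + 1) M₁) (incl n (curvature n M₂)) (markedMin n) ∧
      IsCurvedTypeDA Blg.idem Blg.idem Gen.rgt Gen.lft
        (curvature (n + 1) M₁) (curvature n M₂) (markedMinHat n)) ∧
    -- the specialization `w = z = 0`
    (∀ (x : Gen n) (l : List (BAlg (n + 1))) (y : Gen n),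
      specialize (markedMin n x l y) = markedMinHat n x l y) := by
  refine ⟨⟨markedMin_isTypeDA n, ?_, markedMin_isBounded n, ?_, fun r s =>
      (actsBy_U_shift r s).isEquivariant⟩,
    ⟨markedMinHat_isTypeDA n, actsBy_one.isEquivariant_hat, markedMinHat_isBounded n,
      actsBy_U_strands.isEquivariant_hat, fun r s => (actsBy_U_shift r s).isEquivariant_hat⟩,
    fun M₁ M₂ h₁ _ h₁₂ h => ?_, fun x l y => ?_⟩
  · have h := (actsBy_one (n := n)).isEquivariant
    rwa [map_one] at h
  · have h := (actsBy_U_strands (n := n)).isEquivariant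
    rwa [map_zero] at h
  · have h2 := actsBy_curvature h₁ h₁₂ h
    exact ⟨(markedMin_isTypeDA n).isCurved (curvature_mem_center M₁)
        (incl_mem_center (curvature_mem_center M₂)) h2.isEquivariant,
      (markedMinHat_isTypeDA n).isCurved (curvature_mem_center M₁) (curvature_mem_center M₂)
        h2.isEquivariant_hat⟩
  · rw [← specializeHom_apply, specializeHom_markedMin]
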